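/- **Setting.** Let $d\ge 2$ and let $\Omega\subset\mathbb R^d$ be open and bounded with $\mathcal C^1$ boundary, with outward unit normal $n(x)$ and Lebesgue surface measure $\pi$ on $\partial\Omega$. Let $\boldsymbol m$ be a $\sigma$-finite nonnegative Borel measure on $\mathbb R^d$, invariant under the orthogonal group, with support $V$, such that $0\in V$, $\boldsymbol m(\{0\})=0$ and $\boldsymbol m(V\cap B(0,r))>0$ for all $r>0$. Put $$\Gamma_\pm=\{(x,v)\in\partial\Omega\times V:\ \pm v\cdot n(x)>0\},\qquad d\mu_\pm=|v\cdot n(x)|\,\pi(dx)\otimes\boldsymbol m(dv)\ \text{on }\Gamma_\pm,\qquad L^1_\pm=L^1(\Gamma_\pm,d\mu_\pm)$$ (complex spaces). For $(x,v)\in\Gamma_+$ let $\tau_-(x,v)=\inf\{s>0:\ x-sv\notin\Omega\}$, and for $\lambda\in\mathbb C$ with $\operatorname{Re}\lambda\ge 0$ let $$\mathsf M_\lambda:L^1_-\to L^1_+,\qquad \mathsf M_\lambda u(x,v)=e^{-\lambda\tau_-(x,v)}\,u(x-\tau_-(x,v)v,\,v).$$ Let $\mathsf H:L^1_+\to L^1_-$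 be a bounded linear operator which is stochastic (it maps nonnegative functions to nonnegative functions, and $\int_{\Gamma_-}\mathsf H\psi\,d\mu_-=\int_{\Gamma_+}\psi\,d\mu_+$ for all $\psi\in L^1_+$) and such that: 1. for some integer $n\ge 0$ there is $C\ge 0$ with $\int_{\Gamma_-}\max(1,|v|^{-(n+1)})\,|\mathsf H\psi|\,d\mu_-\le C\|\psi\|_{L^1_+}$ for all $\psi\in L^1_+$; 2. $\mathsf H\mathsf M_0\mathsf H:L^1_+\to L^1_-$ is weakly compact; 3. $\mathsf M_0\mathsf H$ is irreducible on $L^1_+$: if $A\subset\Gamma_+$ is measurable and $\mathsf M_0\mathsf H$ maps the functions vanishing a.e. off $A$ to functions vanishing a.e. off $A$, then $\mu_+(A)=0$ or $\mu_+(\Gamma_+\setminus A)=0$; 4. there is $\ell\in\mathbb N$ such that $\lim_{|\eta|\to\infty}\|(\mathsf M_{\varepsilon+i\eta}\mathsf H)^\ell\|_{\mathscr B(L^1_+)}=0$ for every $\varepsilon\ge 0$. **Proposition 3.6.** For every $\lambda\in\mathbb C$ with $\operatorname{Re}\lambda\ge0$ the formula above defines a bounded operator $\mathsf M_\lambda:L^1_-\to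 L^1_+$, and for every $\lambda\in\mathbb C\setminus\{0\}$ with $\operatorname{Re}\lambda\ge 0$ the spectral radius of $\mathsf M_\lambda\mathsf H\in\mathscr B(L^1_+)$ satisfies $$r_\sigma(\mathsf M_\lambda\mathsf H)<1.$$ In particular $r_\sigma(\mathsf M_{i\eta}\mathsf H)<1$ for every real $\eta\ne0$. -/

import Mathlib

open MeasureTheory Filter Topology Set
open scoped ENNReal InnerProductSpace

noncomputable section

namespace DiffuseTransport

/-- `ℝᵈ` with its Euclidean structure. -/
abbrev E (d : ℕ) : Type := EuclideanSpace ℝ (Fin d)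

variable {d : ℕ}

/-! ### Open sets with `C¹` boundary, outward unit normal, surface measure -/

/-- `ρ` is a local `C¹` defining function of `Ω` at `x`: near `x` it is `C¹`, its gradient does not
vanish at `x`, and near `x` the set `Ω` is exactly `{ρ < 0}` (so `Ω` lies locally on one side of
its boundary). -/
structure IsLocalDefining (Ω : Set (E d)) (x : E d) (ρ : E d → ℝ) : Prop where
  contDiffAt : ContDiffAt ℝ 1 ρ x
  gradient_ne_zero : gradient ρ x ≠ 0
  mem_iff : ∀ᶠ y in 𝓝 x, (y ∈ Ω ↔ ρ y < 0)

/-- `Ω` has a boundary of class `C¹`. -/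
def HasC1Boundary (Ω : Set (E d)) : Prop :=
  ∀ x ∈ frontier Ω, ∃ ρ : E d → ℝ, IsLocalDefining Ω x ρ

open Classical in
/-- The outward unit normal `n(x) = ∇ρ(x) / |∇ρ(x)|`, for `x ∈ ∂Ω` and any local defining function
`ρ` of `Ω` at `x` (see `outwardNormal_eq`); by convention `0` at all other points. -/
def outwardNormal (Ω : Set (E d)) (x : E d) : E d :=
  if h : x ∈ frontier Ω ∧ ∃ ρ : E d → ℝ, IsLocalDefining Ω x ρ then
    ‖gradient h.2.choose x‖⁻¹ • gradient h.2.choose x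
  else 0

/-- The Lebesgue surface measure `π` on `∂Ω`: the `(d-1)`-dimensional Hausdorff measure (normalised
so as to agree with Lebesgue measure on hyperplanes) restricted to `∂Ω`. -/
def surfaceMeasure (Ω : Set (E d)) : Measure (E d) :=
  (Measure.euclideanHausdorffMeasure (d - 1)).restrict (frontier Ω)

/-! ### Phase space -/

/-- Standing assumptions on the phase space `Ω × V`; here `V` is the support of `m`. -/
structure PhaseSpace (Ω : Set (E d)) (m : Measure (E d)) : Prop where
  two_le : 2 ≤ d
  isOpen : IsOpen Ω
  isBounded : Bornology.IsBounded Ω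
  c1Boundary : HasC1Boundary Ω
  orthogonal_invariant : ∀ A : E d ≃ₗᵢ[ℝ] E d, m.map A = m
  zero_mem : (0 : E d) ∈ m.support
  measure_zero : m {0} = 0
  measure_ball_pos : ∀ r : ℝ, 0 < r → 0 < m (m.support ∩ Metric.ball 0 r)

/-- `Γ₊ = {(x, v) ∈ ∂Ω × V : v · n(x) > 0}`. -/
def gammaPlus (Ω : Set (E d)) (m : Measure (E d)) : Set (E d × E d) :=
  {p | p.1 ∈ frontier Ω ∧ p.2 ∈ m.support ∧ 0 < ⟪p.2, outwardNormal Ω p.1⟫_ℝ}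

/-- `Γ₋ = {(x, v) ∈ ∂Ω × V : v · n(x) < 0}`. -/
def gammaMinus (Ω : Set (E d)) (m : Measure (E d)) : Set (E d × E d) :=
  {p | p.1 ∈ frontier Ω ∧ p.2 ∈ m.support ∧ ⟪p.2, outwardNormal Ω p.1⟫_ℝ < 0}

/-- The measure `|v · n(x)| π(dx) ⊗ m(dv)` on `∂Ω × V`. -/
def boundaryMeasure (Ω : Set (E d)) (m : Measure (E d)) : Measure (E d × E d) :=
  ((surfaceMeasure Ω).prod m).withDensity
    (fun p => ENNReal.ofReal |⟪p.2, outwardNormal Ω p.1⟫_ℝ|)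

/-- `μ₊`, carried by `Γ₊`. -/
def muPlus (Ω : Set (E d)) (m : Measure (E d)) : Measure (E d × E d) :=
  (boundaryMeasure Ω m).restrict (gammaPlus Ω m)

/-- `μ₋`, carried by `Γ₋`. -/
def muMinus (Ω : Set (E d)) (m : Measure (E d)) : Measure (E d × E d) :=
  (boundaryMeasure Ω m).restrict (gammaMinus Ω m)

/-- The complex Banach space `L¹₊ = L¹(Γ₊, μ₊)`. -/
abbrev L1Plus (Ω : Set (E d)) (m : Measure (E d)) : Type := Lp ℂ 1 (muPlus Ω m)

/-- The complex Banach space `L¹₋ = L¹(Γ₋, μ₋)`. -/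
abbrev L1Minus (Ω : Set (E d)) (m : Measure (E d)) : Type := Lp ℂ 1 (muMinus Ω m)

/-! ### The operators `M_λ` -/

/-- The backward travel time `τ₋(x, v) = inf {s > 0 : x - s v ∉ Ω}`. -/
def tauMinus (Ω : Set (E d)) (p : E d × E d) : ℝ :=
  sInf {s : ℝ | 0 < s ∧ p.1 - s • p.2 ∉ Ω}

/-- `T` is the bounded operator `L¹₋ → L¹₊` given by the formula
`T u (x, v) = exp (-l τ₋(x, v)) u (x - τ₋(x, v) v, v)` for almost every `(x, v) ∈ Γ₊`. -/
def IsTransfer (Ω : Set (E d)) (m : Measure (E d)) (l : ℂ)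
    (T : L1Minus Ω m →L[ℂ] L1Plus Ω m) : Prop :=
  ∀ u : L1Minus Ω m, ∀ᵐ p ∂(muPlus Ω m),
    (T u) p = Complex.exp (-l * (tauMinus Ω p : ℂ)) * u (p.1 - tauMinus Ω p • p.2, p.2)

open Classical in
/-- The operator `M_l : L¹₋ → L¹₊`, i.e. the only `T` with `IsTransfer Ω m l T`
(by convention `0` if the formula does not define a bounded operator). -/
def transfer (Ω : Set (E d)) (m : Measure (E d)) (l : ℂ) : L1Minus Ω m →L[ℂ] L1Plus Ω m :=
  if h : ∃ T : L1Minus Ω m →L[ℂ] L1Plus Ω m, IsTransfer Ω m l T then h.choose else 0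

/-- `M_l H`, a bounded operator on `L¹₊`. -/
def MH (Ω : Set (E d)) (m : Measure (E d)) (H : L1Plus Ω m →L[ℂ] L1Minus Ω m) (l : ℂ) :
    L1Plus Ω m →L[ℂ] L1Plus Ω m :=
  (transfer Ω m l).comp H

/-! ### Positivity, irreducibility, weak compactness on `L¹` spaces -/

section L1

variable {X : Type*} [MeasurableSpace X] {Y : Type*} [MeasurableSpace Y]

/-- `f ≥ 0` almost everywhere (in particular `f` is real valued). -/
def Nonneg {μ : Measure X} (f : Lp ℂ 1 μ) : Prop :=
  ∀ᵐ x ∂μ, 0 ≤ (f x).re ∧ (f x).im = 0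

/-- A stochastic operator: it preserves nonnegativity and the integral. -/
def IsStochastic {μ : Measure X} {ν : Measure Y} (T : Lp ℂ 1 μ →L[ℂ] Lp ℂ 1 ν) : Prop :=
  (∀ f, Nonneg f → Nonneg (T f)) ∧ ∀ f : Lp ℂ 1 μ, ∫ y, (T f) y ∂ν = ∫ x, f x ∂μ

/-- Irreducibility of a (positive) operator on `L¹(μ)`, `μ` being `σ`-finite: the only closed ideals
`{f : f = 0 a.e. off A}` that it leaves invariant are `{0}` and the whole space. -/
def IsIrreducibleOp {μ : Measure X} (T : Lp ℂ 1 μ →L[ℂ] Lp ℂ 1 μ) : Prop :=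
  ∀ A : Set X, MeasurableSet A →
    (∀ f : Lp ℂ 1 μ, (∀ᵐ x ∂μ, x ∉ A → f x = 0) → ∀ᵐ x ∂μ, x ∉ A → (T f) x = 0) →
    μ A = 0 ∨ μ Aᶜ = 0

end L1

/-- A weakly compact operator: the image of the closed unit ball is relatively compact for the weak
topology. -/
def IsWeaklyCompactOp {F G : Type*} [NormedAddCommGroup F] [NormedSpace ℂ F]
    [NormedAddCommGroup G] [NormedSpace ℂ G] (T : F →L[ℂ] G) : Prop :=
  IsCompact (closure ((fun f : F => toWeakSpace ℂ G (T f)) '' Metric.closedBall 0 1))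

/-! ### Boundary operators -/

/-- `H` maps `L¹₊` boundedly into
`Y⁻_k = {g ∈ L¹₋ : ∫ max (1, |v|⁻ᵏ) |g| dμ₋ < ∞}`. -/
def MapsIntoWeighted (Ω : Set (E d)) (m : Measure (E d))
    (H : L1Plus Ω m →L[ℂ] L1Minus Ω m) (k : ℕ) : Prop :=
  ∃ C : ℝ, 0 ≤ C ∧ ∀ f : L1Plus Ω m,
    ∫⁻ p, ENNReal.ofReal (max 1 ((‖p.2‖ ^ k)⁻¹) * ‖(H f) p‖) ∂(muMinus Ω m)
      ≤ ENNReal.ofReal (C * ‖f‖)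

/-- Standing assumptions on the boundary operator `H : L¹₊ → L¹₋`. -/
structure BoundaryOperator (Ω : Set (E d)) (m : Measure (E d))
    (H : L1Plus Ω m →L[ℂ] L1Minus Ω m) : Prop where
  stochastic : IsStochastic H
  weighted : ∃ n : ℕ, MapsIntoWeighted Ω m H (n + 1)
  weaklyCompact : IsWeaklyCompactOp (H.comp (MH Ω m H 0))
  irreducible : IsIrreducibleOp (MH Ω m H 0)
  power_tendsto : ∃ ℓ : ℕ, ∀ ε : ℝ, 0 ≤ ε →
    Tendsto (fun η : ℝ => ‖(MH Ω m H ((ε : ℂ) + (η : ℂ) * Complex.I)) ^ ℓ‖)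
      (cocompact ℝ) (𝓝 0)

/-! ### The two definitions by choice do not depend on the choice -/

lemma IsLocalDefining.eq_zero {Ω : Set (E d)} {x : E d} {ρ : E d → ℝ} (hx : x ∈ frontier Ω)
    (hΩ : IsOpen Ω) (h : IsLocalDefining Ω x ρ) : ρ x = 0 := by
  have hxn : x ∉ Ω := by
    rw [hΩ.frontier_eq] at hx
    exact hx.2
  apply le_antisymm
  · by_contra hlt
    push Not at hlt
    have h1 : ∀ᶠ y in 𝓝 x, 0 < ρ y := h.contDiffAt.continuousAt.eventually (lt_mem_nhds hlt)
    have h2 : ∀ᶠ y in 𝓝 x, y ∉ Ω := by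
      filter_upwards [h1, h.mem_iff] with y hy1 hy2 hy
      exact lt_asymm hy1 (hy2.1 hy)
    have h3 : ∃ᶠ y in 𝓝 x, y ∈ Ω := mem_closure_iff_frequently.1 (frontier_subset_closure hx)
    exact h3 h2
  · by_contra hlt
    push Not at hlt
    exact hxn (h.mem_iff.self_of_nhds.2 hlt)

lemma IsLocalDefining.hasDerivAt_line {Ω : Set (E d)} {x : E d} {ρ : E d → ℝ}
    (h : IsLocalDefining Ω x ρ) (w : E d) :
    HasDerivAt (fun t : ℝ => ρ (x + t • w)) ⟪gradient ρ x, w⟫_ℝ 0 := by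
  have h1 : HasFDerivAt ρ (InnerProductSpace.toDual ℝ (E d) (gradient ρ x)) x :=
    (h.contDiffAt.differentiableAt one_ne_zero).hasGradientAt.hasFDerivAt
  have h2 : HasDerivAt (fun t : ℝ => x + t • w) w 0 := by
    simpa using ((hasDerivAt_id (0 : ℝ)).smul_const w).const_add x
  have h3 : HasFDerivAt ρ (InnerProductSpace.toDual ℝ (E d) (gradient ρ x))
      (x + (0 : ℝ) • w) := by simpa using h1
  have h4 := h3.comp_hasDerivAt (0 : ℝ) h2
  simpa [Function.comp_def] using h4

/-- The outward unit normal may be computed from any local defining function. -/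
theorem outwardNormal_eq {Ω : Set (E d)} (hΩ : IsOpen Ω) {x : E d} (hx : x ∈ frontier Ω)
    {ρ : E d → ℝ} (h : IsLocalDefining Ω x ρ) :
    outwardNormal Ω x = ‖gradient ρ x‖⁻¹ • gradient ρ x := by
  have hex : x ∈ frontier Ω ∧ ∃ ρ : E d → ℝ, IsLocalDefining Ω x ρ := ⟨hx, ρ, h⟩
  have h' := hex.2.choose_spec
  rw [outwardNormal, dif_pos hex]
  set σ := hex.2.choose
  set a := gradient σ x with ha
  set b := gradient ρ x with hb
  have ha0 : 0 < ‖a‖ := norm_pos_iff.2 h'.gradient_ne_zero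
  have hb0 : 0 < ‖b‖ := norm_pos_iff.2 h.gradient_ne_zero
  by_contra hne
  have hlt : ⟪‖a‖⁻¹ • a, ‖b‖⁻¹ • b⟫_ℝ < 1 := by
    refine inner_lt_one_iff_real_of_norm_eq_one ?_ ?_ |>.2 hne <;>
    · rw [norm_smul, norm_inv, norm_norm]
      field_simp
  rw [real_inner_smul_left, real_inner_smul_right, ← mul_assoc, ← mul_inv, inv_mul_lt_iff₀
    (by positivity), mul_one] at hlt
  -- a direction which is inward for `σ` and outward for `ρ`
  set w : E d := ‖b‖⁻¹ • b - ‖a‖⁻¹ • a with hw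
  have hwa : ⟪a, w⟫_ℝ < 0 := by
    rw [hw, inner_sub_right, real_inner_smul_right, real_inner_smul_right,
      real_inner_self_eq_norm_sq]
    have : ‖a‖⁻¹ * ‖a‖ ^ 2 = ‖a‖ := by field_simp
    rw [this, sub_neg, inv_mul_lt_iff₀ hb0, mul_comm]
    exact hlt
  have hwb : 0 < ⟪b, w⟫_ℝ := by
    rw [hw, inner_sub_right, real_inner_smul_right, real_inner_smul_right,
      real_inner_self_eq_norm_sq, real_inner_comm]
    have : ‖b‖⁻¹ * ‖b‖ ^ 2 = ‖b‖ := by field_simp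
    rw [this, sub_pos, inv_mul_lt_iff₀ ha0]
    exact hlt
  have hline : Tendsto (fun t : ℝ => x + t • w) (𝓝[>] 0) (𝓝 x) := by
    have : Continuous (fun t : ℝ => x + t • w) := by fun_prop
    have h0 := this.tendsto 0
    simp only [zero_smul, add_zero] at h0
    exact h0.mono_left nhdsWithin_le_nhds
  have e1 := hline.eventually h'.mem_iff
  have e2 := hline.eventually h.mem_iff
  have s1 := (hasDerivAt_iff_tendsto_slope.1 (h'.hasDerivAt_line w)).mono_left
    (nhdsWithin_mono 0 (fun t (ht : (0 : ℝ) < t) => ht.ne'))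
  have s2 := (hasDerivAt_iff_tendsto_slope.1 (h.hasDerivAt_line w)).mono_left
    (nhdsWithin_mono 0 (fun t (ht : (0 : ℝ) < t) => ht.ne'))
  have f1 := s1.eventually (gt_mem_nhds hwa)
  have f2 := s2.eventually (lt_mem_nhds hwb)
  have z1 := h'.eq_zero hx hΩ
  have z2 := h.eq_zero hx hΩ
  obtain ⟨t, ht, g1, g2, g3, g4⟩ :=
    (eventually_mem_nhdsWithin.and (e1.and (e2.and (f1.and f2)))).exists
  have ht' : (0 : ℝ) < t := ht
  simp only [slope_def_field, zero_smul, add_zero, sub_zero] at g3 g4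
  have k1 : σ (x + t • w) < 0 := by
    have := (div_lt_iff₀ ht').1 g3
    linarith
  have k2 : 0 < ρ (x + t • w) := by
    have := (lt_div_iff₀ ht').1 g4
    linarith
  exact lt_asymm k2 (g2.1 (g1.2 k1))

/-- `M_l` is the only operator given by its formula. -/
theorem transfer_eq {Ω : Set (E d)} {m : Measure (E d)} {l : ℂ}
    {T : L1Minus Ω m →L[ℂ] L1Plus Ω m} (hT : IsTransfer Ω m l T) : transfer Ω m l = T := by
  have hex : ∃ T : L1Minus Ω m →L[ℂ] L1Plus Ω m, IsTransfer Ω m l T := ⟨T, hT⟩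
  rw [transfer, dif_pos hex]
  refine ContinuousLinearMap.ext fun u => Lp.ext ?_
  filter_upwards [hex.choose_spec u, hT u] with p h1 h2
  rw [h1, h2]

end DiffuseTransport

end

/-!
The proof has a geometric and an operator theoretic part.

*Geometry.* For a fixed velocity `v`, the backward trace `x ↦ x - τ₋(x, v) v` is injective on the
outgoing part of the boundary, takes values in the incoming or tangential part, and preserves the
projection along `v`. The flux `∫_A |v · n|` through a part `A` of the boundary is `|v|` times
the area of the projection of `A` along `v`, counted with multiplicity (`volume_image_le`,
`le_volume_image`); this is obtained by comparing the boundary, locally a graph over its tangent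
plane with small Lipschitz constant, with that plane. Hence the backward trace maps `μ₊` to a
measure dominated by `μ₋` (`map_backTrace_le`), and the formula for `M_l` defines a contraction
(`exists_isTransfer`). In particular `P = M_0 H` is a positive contraction of `L¹₊`, and `M_l H` is
`P` followed by the multiplication by `exp (-l τ₋)`, with `τ₋ > 0` almost everywhere.

*Operator theory.* By hypothesis `P²` is weakly compact. A positive weakly compact operator has
uniformly integrable image of the unit ball (`uniformTails_of_weaklyCompact`), and so, up to a small
error, any operator `T` dominated by it maps the unit ball into an order interval, on which `T` is
compact by a Hilbert space argument; therefore `T²` is compact (`isCompactOperator_comp_self`). Applied to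
`T = (M_l H)²`, this turns `r(M_l H) ≥ 1` into an eigenvector `M_l H φ = β φ` with `|β| ≥ 1`
(`exists_eigenvector`).

Since `P` does not increase the integral, all inequalities in `|φ| ≤ |β φ| ≤ |P φ| ≤ P |φ|` are
equalities. So `|φ|` is fixed by `P` and, by irreducibility, nonzero almost everywhere, which forces
`|β| = 1` and `Re l = 0`. Wielandt's argument (`map_mul_of_fixed`) then shows that, with `D` the
phase of `φ`, the functions `D ^ k |φ|` are eigenvectors of `M_{k l} H` for the eigenvalue `β ^ k`
of modulus one, for every `k`. If `l ≠ 0` this contradicts `‖(M_{iη} H) ^ ℓ‖ → 0` as `|η| → ∞`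
(`eq_zero_of_peripheral_eigenvector`).
-/

noncomputable section

namespace DiffuseTransport

/-! ### Positive operators between complex `L¹` spaces -/

section PositiveOperators

variable {X Y : Type*} [MeasurableSpace X] [MeasurableSpace Y] {μ : Measure X} {ν : Measure Y}

/-- A positive operator between complex `L¹` spaces. -/
def IsPositiveOp (T : Lp ℂ 1 μ →L[ℂ] Lp ℂ 1 ν) : Prop :=
  ∀ f, Nonneg f → Nonneg (T f)

/-- The modulus `|f|`, as an element of the complex space `L¹`. -/
def modulus (f : Lp ℂ 1 μ) : Lp ℂ 1 μ :=
  ((L1.integrable_coeFn f).norm.ofReal (𝕜 := ℂ)).toL1 _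

lemma coeFn_modulus (f : Lp ℂ 1 μ) : ⇑(modulus f) =ᵐ[μ] fun x => (‖f x‖ : ℂ) :=
  Integrable.coeFn_toL1 _

lemma nonneg_modulus (f : Lp ℂ 1 μ) : Nonneg (modulus f) := by
  filter_upwards [coeFn_modulus f] with x hx
  simp [hx]

@[simp]
lemma norm_modulus (f : Lp ℂ 1 μ) : ‖modulus f‖ = ‖f‖ := by
  rw [L1.norm_eq_integral_norm, L1.norm_eq_integral_norm]
  refine integral_congr_ae ?_
  filter_upwards [coeFn_modulus f] with x hx
  simp [hx]

lemma integrable_re (f : Lp ℂ 1 μ) : Integrable (fun x => (f x).re) μ :=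
  (L1.integrable_coeFn f).re

lemma Nonneg.norm_eq_integral {f : Lp ℂ 1 μ} (hf : Nonneg f) : ‖f‖ = ∫ x, (f x).re ∂μ := by
  rw [L1.norm_eq_integral_norm]
  refine integral_congr_ae ?_
  filter_upwards [hf] with x hx
  have : f x = ((f x).re : ℂ) := Complex.ext rfl (by simpa using hx.2)
  rw [this, Complex.norm_real, Real.norm_of_nonneg hx.1, Complex.ofReal_re]

lemma IsPositiveOp.comp {Z : Type*} [MeasurableSpace Z] {κ : Measure Z}
    {S : Lp ℂ 1 ν →L[ℂ] Lp ℂ 1 κ} {T : Lp ℂ 1 μ →L[ℂ] Lp ℂ 1 ν}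
    (hS : IsPositiveOp S) (hT : IsPositiveOp T) : IsPositiveOp (S.comp T) :=
  fun f hf => hS _ (hT f hf)

namespace IsPositiveOp

variable {T : Lp ℂ 1 μ →L[ℂ] Lp ℂ 1 ν}

lemma map_real (hT : IsPositiveOp T) {f : Lp ℂ 1 μ} (hf : ∀ᵐ x ∂μ, (f x).im = 0) :
    ∀ᵐ y ∂ν, (T f y).im = 0 := by
  have h1 : Nonneg (modulus f + f) := by
    filter_upwards [coeFn_modulus f, hf, Lp.coeFn_add (modulus f) f] with x h1 h2 h3
    rw [h3, Pi.add_apply, h1]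
    have := neg_le_of_abs_le (Complex.abs_re_le_norm (f x))
    refine ⟨?_, ?_⟩
    · simp only [Complex.add_re, Complex.ofReal_re]; linarith
    · simp [h2]
  have h2 := hT _ h1
  rw [map_add] at h2
  filter_upwards [h2, hT _ (nonneg_modulus f), Lp.coeFn_add (T (modulus f)) (T f)]
    with y h3 h4 h5
  rw [h5, Pi.add_apply, Complex.add_im, h4.2, zero_add] at h3
  exact h3.2

lemma re_mono (hT : IsPositiveOp T) {f g : Lp ℂ 1 μ}
    (hf : ∀ᵐ x ∂μ, (f x).im = 0) (hg : ∀ᵐ x ∂μ, (g x).im = 0)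
    (hfg : ∀ᵐ x ∂μ, (f x).re ≤ (g x).re) : ∀ᵐ y ∂ν, (T f y).re ≤ (T g y).re := by
  have h1 : Nonneg (g - f) := by
    filter_upwards [hf, hg, hfg, Lp.coeFn_sub g f] with x h1 h2 h3 h4
    rw [h4, Pi.sub_apply]
    simp [h1, h2, h3]
  have h2 := hT _ h1
  rw [map_sub] at h2
  filter_upwards [h2, Lp.coeFn_sub (T g) (T f)] with y h3 h4
  rw [h4, Pi.sub_apply, Complex.sub_re] at h3
  linarith [h3.1]

/-- `Re (T f) ≤ T |f|`, for a positive operator on complex functions. -/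
lemma re_le_modulus (hT : IsPositiveOp T) (f : Lp ℂ 1 μ) :
    ∀ᵐ y ∂ν, (T f y).re ≤ (T (modulus f) y).re := by
  set a : Lp ℂ 1 μ := ((L1.integrable_coeFn f).re.ofReal (𝕜 := ℂ)).toL1 _ with ha
  set b : Lp ℂ 1 μ := ((L1.integrable_coeFn f).im.ofReal (𝕜 := ℂ)).toL1 _ with hb
  have ha' : ⇑a =ᵐ[μ] fun x => (((f x).re : ℝ) : ℂ) := Integrable.coeFn_toL1 _
  have hb' : ⇑b =ᵐ[μ] fun x => (((f x).im : ℝ) : ℂ) := Integrable.coeFn_toL1 _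
  have hab : f = a + Complex.I • b := by
    refine Lp.ext ?_
    filter_upwards [ha', hb', Lp.coeFn_add a (Complex.I • b), Lp.coeFn_smul Complex.I b]
      with x h1 h2 h3 h4
    rw [h3, Pi.add_apply, h4, Pi.smul_apply, h1, h2, smul_eq_mul, mul_comm]
    exact (Complex.re_add_im _).symm
  have har : ∀ᵐ x ∂μ, (a x).im = 0 := by
    filter_upwards [ha'] with x hx
    simp [hx]
  have hbr : ∀ᵐ x ∂μ, (b x).im = 0 := by
    filter_upwards [hb'] with x hx
    simp [hx]
  have hmr : ∀ᵐ x ∂μ, (modulus f x).im = 0 := (nonneg_modulus f).mono fun x hx => hx.2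
  have hle : ∀ᵐ x ∂μ, (a x).re ≤ (modulus f x).re := by
    filter_upwards [ha', coeFn_modulus f] with x h1 h2
    rw [h1, h2, Complex.ofReal_re, Complex.ofReal_re]
    exact Complex.re_le_norm _
  have hTf : T f = T a + Complex.I • T b := by
    conv_lhs => rw [hab]
    rw [map_add, map_smul]
  filter_upwards [hT.re_mono har hmr hle, hT.map_real hbr, Lp.coeFn_add (T a) (Complex.I • T b),
    Lp.coeFn_smul Complex.I (T b)] with y h1 h2 h3 h4
  rw [hTf, h3, Pi.add_apply, h4, Pi.smul_apply, smul_eq_mul]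
  simpa [h2] using h1

/-- `|T f| ≤ T |f|`: apply `Re (T g) ≤ T |g|` to the countably many rotations `g = e^{iq} f`,
`q` rational. -/
lemma norm_le_modulus (hT : IsPositiveOp T) (f : Lp ℂ 1 μ) :
    ∀ᵐ y ∂ν, ‖T f y‖ ≤ (T (modulus f) y).re := by
  have hrot : ∀ q : ℚ, modulus (Complex.exp ((q : ℝ) * Complex.I) • f) = modulus f := by
    intro q
    refine Lp.ext ?_
    filter_upwards [coeFn_modulus f, coeFn_modulus (Complex.exp ((q : ℝ) * Complex.I) • f),
      Lp.coeFn_smul (Complex.exp ((q : ℝ) * Complex.I)) f] with x h1 h2 h3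
    rw [h1, h2, h3, Pi.smul_apply, norm_smul, Complex.norm_exp_ofReal_mul_I, one_mul]
  have h1 : ∀ᵐ y ∂ν, ∀ q : ℚ,
      (Complex.exp ((q : ℝ) * Complex.I) * T f y).re ≤ (T (modulus f) y).re := by
    rw [ae_all_iff]
    intro q
    have h := hT.re_le_modulus (Complex.exp ((q : ℝ) * Complex.I) • f)
    rw [hrot, map_smul] at h
    filter_upwards [h, Lp.coeFn_smul (Complex.exp ((q : ℝ) * Complex.I)) (T f)] with y h2 h3
    rwa [h3, Pi.smul_apply, smul_eq_mul] at h2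
  filter_upwards [h1] with y hy
  have hcl : IsClosed {t : ℝ | (Complex.exp ((t : ℂ) * Complex.I) * T f y).re ≤
      (T (modulus f) y).re} := isClosed_le (by fun_prop) continuous_const
  have hall : ∀ t : ℝ, (Complex.exp ((t : ℂ) * Complex.I) * T f y).re ≤
      (T (modulus f) y).re := by
    intro t
    have hsub : Set.range ((↑) : ℚ → ℝ) ⊆ {t : ℝ | (Complex.exp ((t : ℂ) * Complex.I) * T f y).re ≤
      (T (modulus f) y).re} := by
      rintro _ ⟨q, rfl⟩
      exact hy q
    have := closure_minimal hsub hcl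
    rw [Rat.denseRange_cast.closure_range] at this
    exact this (mem_univ t)
  have h2 := hall (-(T f y).arg)
  have h3 : Complex.exp (((-(T f y).arg : ℝ) : ℂ) * Complex.I) * T f y = (‖T f y‖ : ℂ) := by
    conv_lhs => rw [← Complex.norm_mul_exp_arg_mul_I (T f y)]
    rw [mul_left_comm, ← Complex.exp_add]
    simp
  rw [h3, Complex.ofReal_re] at h2
  exact h2

lemma norm_le_of_norm_le (hT : IsPositiveOp T) {f g : Lp ℂ 1 μ} (hg : Nonneg g)
    (hfg : ∀ᵐ x ∂μ, ‖f x‖ ≤ (g x).re) : ∀ᵐ y ∂ν, ‖T f y‖ ≤ (T g y).re := by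
  have hle : ∀ᵐ x ∂μ, (modulus f x).re ≤ (g x).re := by
    filter_upwards [coeFn_modulus f, hfg] with x h1 h2
    rwa [h1, Complex.ofReal_re]
  filter_upwards [hT.norm_le_modulus f, hT.re_mono ((nonneg_modulus f).mono fun x hx => hx.2)
    (hg.mono fun x hx => hx.2) hle] with y h1 h2
  exact h1.trans h2

end IsPositiveOp

/-! ### Weak compactness and equi-integrability -/

/-- The tails over the levels `C g` are small, uniformly over the image of the positive part of
the unit ball. -/
def UniformTails (W : Lp ℂ 1 μ →L[ℂ] Lp ℂ 1 ν) (g : Y → ℝ) : Prop :=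
  ∀ δ : ℝ, 0 < δ → ∃ C : ℝ, 0 < C ∧ ∀ f : Lp ℂ 1 μ, Nonneg f → ‖f‖ ≤ 1 →
    ∫ y, max ((W f y).re - C * g y) 0 ∂ν ≤ δ

/-- A positive operator mapping the unit ball into a weakly compact set has uniformly small tails.
Positivity makes this half of the Dunford–Pettis criterion elementary: if it fails along `fₙ` with
levels `2ⁿ`, then the unions `Bₘ` of the sets `{W fₙ > 2ⁿ g}`, `n ≥ m`, decrease to a null set by
Borel–Cantelli, while `∫ W fₙ` over `Bₘ` stays above `δ` for `n ≥ m`, hence so does the integral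
over `Bₘ` of a weak cluster point, for every `m`. -/
theorem uniformTails_of_weaklyCompact {W : Lp ℂ 1 μ →L[ℂ] Lp ℂ 1 ν} (hW : IsPositiveOp W)
    {K : Set (WeakSpace ℂ (Lp ℂ 1 ν))} (hK : IsCompact K)
    (hWK : ∀ f : Lp ℂ 1 μ, ‖f‖ ≤ 1 → toWeakSpace ℂ _ (W f) ∈ K)
    {g : Y → ℝ} (hgm : Measurable g) (hg0 : ∀ y, 0 < g y) : UniformTails W g := by
  intro δ hδ
  by_contra! hcon
  choose f hf0 hf1 hfδ using fun n : ℕ => hcon (2 ^ n) (by positivity)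
  set A : ℕ → Set Y := fun n => {y | 2 ^ n * g y < (W (f n) y).re} with hA
  have hAm : ∀ n, MeasurableSet (A n) := fun n =>
    measurableSet_lt (by fun_prop)
      (Complex.measurable_re.comp (Lp.stronglyMeasurable (W (f n))).measurable)
  set B : ℕ → Set Y := fun m => ⋃ n ∈ Ici m, A n with hB
  have hBm : ∀ m, MeasurableSet (B m) := fun m =>
    MeasurableSet.biUnion (to_countable _) fun n _ => hAm n
  have hpos : ∀ n, Nonneg (W (f n)) := fun n => hW _ (hf0 n)
  -- Borel–Cantelli for the measure `g ν`
  have hev : ∀ᵐ y ∂ν, ∀ᶠ n in atTop, y ∉ A n := by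
    set ρ := ν.withDensity fun y => ENNReal.ofReal (g y) with hρ
    have hρA : ∀ n, ρ (A n) ≤ ENNReal.ofReal (‖W‖ * (1 / 2) ^ n) := by
      intro n
      rw [hρ, withDensity_apply _ (hAm n)]
      calc ∫⁻ y in A n, ENNReal.ofReal (g y) ∂ν
          ≤ ∫⁻ y in A n, ENNReal.ofReal ((1 / 2) ^ n * ‖W (f n) y‖) ∂ν := by
            refine setLIntegral_mono' (hAm n) fun y hy => ENNReal.ofReal_le_ofReal ?_
            have h1 : 2 ^ n * g y ≤ ‖W (f n) y‖ := (le_of_lt hy).trans (Complex.re_le_norm _)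
            rw [one_div, inv_pow, inv_mul_eq_div, le_div_iff₀ (by positivity)]
            linarith
        _ ≤ ∫⁻ y, ENNReal.ofReal ((1 / 2) ^ n * ‖W (f n) y‖) ∂ν := setLIntegral_le_lintegral _ _
        _ = ENNReal.ofReal ((1 / 2) ^ n * ‖W (f n)‖) := by
            rw [L1.norm_eq_integral_norm, ← integral_const_mul, ofReal_integral_eq_lintegral_ofReal
              ((L1.integrable_coeFn _).norm.const_mul _)
              (Eventually.of_forall fun y => by positivity)]
        _ ≤ _ := by
            refine ENNReal.ofReal_le_ofReal ?_
            rw [mul_comm]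
            gcongr
            exact (W.le_opNorm _).trans (mul_le_of_le_one_right (norm_nonneg W) (hf1 n))
    have hsum : ∑' n, ρ (A n) ≠ ∞ := by
      refine ne_top_of_le_ne_top ?_ (ENNReal.tsum_le_tsum hρA)
      rw [← ENNReal.ofReal_tsum_of_nonneg (fun n => by positivity)
        (summable_geometric_two.mul_left _)]
      exact ENNReal.ofReal_ne_top
    have h1 : ∀ᵐ y ∂ρ, ∀ᶠ n in atTop, y ∉ A n := ae_eventually_notMem hsum
    rw [hρ, ae_withDensity_iff (by fun_prop)] at h1
    filter_upwards [h1] with y hy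
    exact hy (by simpa using hg0 y)
  -- the integral over `B m`, as a functional on `L¹`
  let Φ : ℕ → (Lp ℂ 1 ν →L[ℂ] ℂ) := fun m =>
    LinearMap.mkContinuous
      { toFun := fun h => ∫ y in B m, h y ∂ν
        map_add' := fun h k => by
          rw [← integral_add (L1.integrable_coeFn h).integrableOn
            (L1.integrable_coeFn k).integrableOn]
          exact integral_congr_ae (ae_restrict_of_ae (Lp.coeFn_add h k))
        map_smul' := fun c h => by
          rw [RingHom.id_apply, smul_eq_mul, ← integral_const_mul]
          exact integral_congr_ae (ae_restrict_of_ae (Lp.coeFn_smul c h)) } 1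
      (fun h => by
        rw [one_mul, L1.norm_eq_integral_norm]
        exact (norm_integral_le_integral_norm _).trans (setIntegral_le_integral
          (L1.integrable_coeFn h).norm (Eventually.of_forall fun y => norm_nonneg _)))
  have hΦ : ∀ m h, Φ m h = ∫ y in B m, h y ∂ν := fun m h => rfl
  have hlow : ∀ m n, m ≤ n → δ ≤ (Φ m (W (f n))).re := by
    intro m n hmn
    have h1 : (Φ m (W (f n))).re = ∫ y in B m, (W (f n) y).re ∂ν := by
      rw [hΦ]
      exact (integral_re (L1.integrable_coeFn (W (f n))).restrict).symm
    rw [h1]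
    refine (hfδ n).le.trans ?_
    rw [← integral_indicator (hBm m)]
    refine integral_mono_ae ?_ ((integrable_re _).indicator (hBm m)) ?_
    · refine (integrable_re (W (f n))).mono
        ((((Lp.stronglyMeasurable (W (f n))).measurable.re.sub
          (hgm.const_mul _)).max measurable_const).aestronglyMeasurable) ?_
      filter_upwards [hpos n] with y hy
      rw [Real.norm_of_nonneg (le_max_right _ _), Real.norm_of_nonneg hy.1]
      refine max_le ?_ hy.1
      have := hg0 y
      have : 0 ≤ 2 ^ n * g y := by positivity
      linarith
    · filter_upwards [hpos n] with y hy
      by_cases hyA : y ∈ A n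
      · rw [indicator_of_mem (mem_biUnion (mem_Ici.2 hmn) hyA)]
        refine max_le ?_ hy.1
        have := hg0 y
        have : 0 ≤ 2 ^ n * g y := by positivity
        linarith
      · have : (W (f n) y).re ≤ 2 ^ n * g y := not_lt.1 hyA
        rw [max_eq_right (by linarith)]
        exact indicator_apply_nonneg fun _ => hy.1
  obtain ⟨k, -, hk⟩ := hK.exists_mapClusterPt_of_frequently (l := atTop)
    (f := fun n => toWeakSpace ℂ _ (W (f n))) (Frequently.of_forall fun n => hWK _ (hf1 n))
  have hklow : ∀ m, δ ≤ (Φ m ((toWeakSpace ℂ _).symm k)).re := by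
    intro m
    have hc : Continuous fun z : WeakSpace ℂ (Lp ℂ 1 ν) => (Φ m ((toWeakSpace ℂ _).symm z)).re :=
      Complex.continuous_re.comp (WeakBilin.eval_continuous _ (Φ m))
    have h1 := hk.continuousAt_comp hc.continuousAt
    refine isClosed_Ici.mem_of_mapClusterPt h1 ?_
    filter_upwards [eventually_ge_atTop m] with n hn
    exact hlow m n hn
  set h : Lp ℂ 1 ν := (toWeakSpace ℂ _).symm k with hh
  have hlim : Tendsto (fun m => (Φ m h).re) atTop (𝓝 0) := by
    have : Tendsto (fun m => Φ m h) atTop (𝓝 (∫ _y, (0 : ℂ) ∂ν)) := by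
      simp_rw [hΦ, ← integral_indicator (hBm _)]
      refine tendsto_integral_of_dominated_convergence (fun y => ‖h y‖)
        (fun m => ((L1.integrable_coeFn h).indicator (hBm m)).aestronglyMeasurable)
        (L1.integrable_coeFn h).norm
        (fun m => Eventually.of_forall fun y => norm_indicator_le_norm_self _ _) ?_
      filter_upwards [hev] with y hy
      obtain ⟨N, hN⟩ := eventually_atTop.1 hy
      refine tendsto_const_nhds.congr' ?_
      filter_upwards [eventually_ge_atTop N] with m hm
      rw [indicator_of_notMem]
      simp only [hB, mem_iUnion, not_exists]
      exact fun n hn => hN n (hm.trans hn)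
    rw [integral_zero] at this
    simpa [Function.comp_def] using (Complex.continuous_re.tendsto _).comp this
  exact absurd (ge_of_tendsto' hlim hklow) (not_le.2 hδ)

end PositiveOperators

/-! ### Truncation of dominated operators -/

section Truncation

variable {X Y : Type*} [MeasurableSpace X] [MeasurableSpace Y] {μ : Measure X} {ν : Measure Y}

/-- `|T f| ≤ W |f|` for all `f`. -/
def IsDominatedBy (T W : Lp ℂ 1 μ →L[ℂ] Lp ℂ 1 ν) : Prop :=
  ∀ f, ∀ᵐ y ∂ν, ‖T f y‖ ≤ (W (modulus f) y).re

lemma coeFn_sum_smul {ι : Type*} (s : Finset ι) (a : ι → ℂ) (u : ι → Lp ℂ 1 μ) :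
    ⇑(∑ i ∈ s, a i • u i) =ᵐ[μ] fun x => ∑ i ∈ s, a i * u i x := by
  classical
  induction s using Finset.induction_on with
  | empty =>
    simp only [Finset.sum_empty]
    exact Lp.coeFn_zero ℂ 1 μ
  | insert i s hi ih =>
    rw [Finset.sum_insert hi]
    filter_upwards [Lp.coeFn_add (a i • u i) (∑ i ∈ s, a i • u i), Lp.coeFn_smul (a i) (u i), ih]
      with x h1 h2 h3
    rw [h1, Pi.add_apply, h2, h3, Pi.smul_apply, smul_eq_mul, Finset.sum_insert hi]

lemma nonneg_smul {f : Lp ℂ 1 μ} (hf : Nonneg f) {c : ℝ} (hc : 0 ≤ c) : Nonneg ((c : ℂ) • f) := by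
  filter_upwards [hf, Lp.coeFn_smul (c : ℂ) f] with x h1 h2
  rw [h2, Pi.smul_apply, smul_eq_mul]
  simp [h1.2, mul_nonneg hc h1.1]

/-- Truncating `T f` at the level `C ‖f‖ g` costs at most `δ ‖f‖` in `L¹`. -/
lemma exists_truncation {T W : Lp ℂ 1 μ →L[ℂ] Lp ℂ 1 ν} (hTW : IsDominatedBy T W) {g : Y → ℝ}
    (hgm : Measurable g) (hg0 : ∀ y, 0 < g y) {C δ : ℝ} (hC : 0 < C)
    (hWC : ∀ f : Lp ℂ 1 μ, Nonneg f → ‖f‖ ≤ 1 →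
      ∫ y, max ((W f y).re - C * g y) 0 ∂ν ≤ δ) (f : Lp ℂ 1 μ) :
    ∃ w : Y → ℂ, Measurable w ∧ Integrable w ν ∧ (∀ y, ‖w y‖ ≤ C * ‖f‖ * g y) ∧
      ∫ y, ‖T f y - w y‖ ∂ν ≤ δ * ‖f‖ := by
  classical
  rcases eq_or_ne f 0 with rfl | hf
  · refine ⟨0, measurable_zero, integrable_zero _ _ _, by simp, ?_⟩
    rw [map_zero, norm_zero, mul_zero]
    refine le_of_eq (integral_eq_zero_of_ae ?_)
    filter_upwards [Lp.coeFn_zero ℂ 1 ν] with y hy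
    rw [hy]
    simp
  have hf0 : 0 < ‖f‖ := norm_pos_iff.2 hf
  have hTm : Measurable (T f) := (Lp.stronglyMeasurable (T f)).measurable
  set w : Y → ℂ := fun y => if ‖T f y‖ ≤ C * ‖f‖ * g y then T f y else
    ((C * ‖f‖ * g y / ‖T f y‖ : ℝ) : ℂ) * T f y with hw
  have hwm : Measurable w := Measurable.ite (measurableSet_le hTm.norm (hgm.const_mul _)) hTm
    ((Complex.measurable_ofReal.comp ((hgm.const_mul _).div hTm.norm)).mul hTm)
  have hlev : ∀ y, 0 < C * ‖f‖ * g y := fun y => by have := hg0 y; positivity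
  have hle : ∀ y, ‖w y‖ ≤ C * ‖f‖ * g y ∧ ‖w y‖ ≤ ‖T f y‖ ∧
      ‖T f y - w y‖ = max (‖T f y‖ - C * ‖f‖ * g y) 0 := by
    intro y
    by_cases h : ‖T f y‖ ≤ C * ‖f‖ * g y
    · simp only [hw, if_pos h, sub_self, norm_zero]
      exact ⟨h, le_rfl, (max_eq_right (by linarith)).symm⟩
    · have h' := not_le.1 h
      have hpos : 0 < ‖T f y‖ := (hlev y).trans h'
      simp only [hw, if_neg h]
      have h1 : ‖((C * ‖f‖ * g y / ‖T f y‖ : ℝ) : ℂ) * T f y‖ = C * ‖f‖ * g y := by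
        rw [norm_mul, Complex.norm_real, Real.norm_of_nonneg (div_nonneg (hlev y).le hpos.le)]
        field_simp
      refine ⟨h1.le, h1.le.trans h'.le, ?_⟩
      have h2 : T f y - ((C * ‖f‖ * g y / ‖T f y‖ : ℝ) : ℂ) * T f y =
          ((1 - C * ‖f‖ * g y / ‖T f y‖ : ℝ) : ℂ) * T f y := by push_cast; ring
      rw [h2, norm_mul, Complex.norm_real, Real.norm_of_nonneg, max_eq_left (by linarith)]
      · field_simp
      · rw [sub_nonneg, div_le_one hpos]; exact h'.le
  have hwi : Integrable w ν := (L1.integrable_coeFn (T f)).mono hwm.aestronglyMeasurable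
    (Eventually.of_forall fun y => (hle y).2.1)
  refine ⟨w, hwm, hwi, fun y => (hle y).1, ?_⟩
  -- normalise `|f|` and use the uniform tails
  set k : Lp ℂ 1 μ := ((‖f‖⁻¹ : ℝ) : ℂ) • modulus f with hk
  have hkn : ‖k‖ ≤ 1 := by
    rw [hk, norm_smul, norm_modulus, Complex.norm_real, norm_inv, norm_norm,
      inv_mul_cancel₀ hf0.ne']
  have hk0 : Nonneg k := nonneg_smul (nonneg_modulus f) (inv_nonneg.2 hf0.le)
  have hkf : modulus f = ((‖f‖ : ℝ) : ℂ) • k := by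
    rw [hk, smul_smul, ← Complex.ofReal_mul, mul_inv_cancel₀ hf0.ne', Complex.ofReal_one, one_smul]
  have hint : Integrable (fun y => max ((W k y).re - C * g y) 0) ν := by
    refine (integrable_re (W k)).mono
        ((((Lp.stronglyMeasurable (W k)).measurable.re.sub
          (hgm.const_mul _)).max measurable_const).aestronglyMeasurable) ?_
    refine Eventually.of_forall fun y => ?_
    rw [Real.norm_of_nonneg (le_max_right _ _)]
    refine max_le ?_ (norm_nonneg _)
    have := mul_pos hC (hg0 y)
    have := Real.le_norm_self (W k y).re
    linarith
  calc ∫ y, ‖T f y - w y‖ ∂ν ≤ ∫ y, ‖f‖ * max ((W k y).re - C * g y) 0 ∂ν := by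
        refine integral_mono_ae ((L1.integrable_coeFn (T f)).sub hwi).norm (hint.const_mul _) ?_
        have h1 := hTW f
        rw [hkf, map_smul] at h1
        filter_upwards [h1, Lp.coeFn_smul ((‖f‖ : ℝ) : ℂ) (W k)] with y h2 h3
        rw [h3, Pi.smul_apply, smul_eq_mul, Complex.re_ofReal_mul] at h2
        rw [(hle y).2.2, mul_max_of_nonneg _ _ hf0.le, mul_zero]
        refine max_le_max ?_ le_rfl
        linarith
    _ = ‖f‖ * ∫ y, max ((W k y).re - C * g y) 0 ∂ν := integral_const_mul _ _
    _ ≤ δ * ‖f‖ := by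
        rw [mul_comm]
        gcongr
        exact hWC k hk0 hkn

/-- For finitely many functions taking their values on a common finite partition, truncate the
images of the indicators of the cells; the truncated operator is bounded from `L¹` to the functions
dominated by `g`, which bounds the sum of the moduli pointwise. -/
lemma sum_norm_le_of_simple {T W : Lp ℂ 1 μ →L[ℂ] Lp ℂ 1 ν} (hTW : IsDominatedBy T W)
    {g : Y → ℝ} (hgm : Measurable g) (hg0 : ∀ y, 0 < g y) (hgi : Integrable g ν) {C δ : ℝ}
    (hC : 0 < C) (hδ : 0 ≤ δ) (hWC : ∀ f : Lp ℂ 1 μ, Nonneg f → ‖f‖ ≤ 1 →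
      ∫ y, max ((W f y).re - C * g y) 0 ∂ν ≤ δ) {N : ℕ}
    (s : SimpleFunc X (Fin N → ℂ)) (hs : Integrable s μ) (v : Fin N → Lp ℂ 1 μ)
    (hv : ∀ i, ⇑(v i) =ᵐ[μ] fun x => s x i) {r R : ℝ} (hr : ∀ i, ‖v i‖ ≤ r)
    (hR : ∀ a : Fin N → ℂ, (∀ i, ‖a i‖ ≤ 1) → ‖∑ i, a i • v i‖ ≤ R) :
    ∑ i, ‖T (v i)‖ ≤ N * (δ * r) + C * (∫ y, g y ∂ν) * R := by
  classical
  set 𝒞 : Finset (Fin N → ℂ) := s.range.filter (· ≠ 0) with h𝒞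
  set E : (Fin N → ℂ) → Set X := fun c => s ⁻¹' {c} with hE
  have hEm : ∀ c, MeasurableSet (E c) := fun c => s.measurableSet_fiber c
  have hEf : ∀ c ∈ 𝒞, μ (E c) ≠ ∞ := fun c hc =>
    (SimpleFunc.integrable_iff.1 hs c (Finset.mem_filter.1 hc).2).ne
  set p : (Fin N → ℂ) → Lp ℂ 1 μ := fun c =>
    if h : μ (E c) ≠ ∞ then indicatorConstLp 1 (hEm c) h 1 else 0 with hp
  have hpc : ∀ c ∈ 𝒞, ⇑(p c) =ᵐ[μ] (E c).indicator fun _ => (1 : ℂ) := by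
    intro c hc
    simp only [hp, dif_pos (hEf c hc)]
    exact indicatorConstLp_coeFn
  have hpn : ∀ c ∈ 𝒞, ‖p c‖ = μ.real (E c) := by
    intro c hc
    simp only [hp, dif_pos (hEf c hc)]
    rw [norm_indicatorConstLp one_ne_zero ENNReal.one_ne_top]
    simp
  have hvp : ∀ i, v i = ∑ c ∈ 𝒞, c i • p c := by
    intro i
    refine Lp.ext ?_
    have hall : ∀ᵐ x ∂μ, ∀ c ∈ 𝒞, p c x = (E c).indicator (fun _ => (1 : ℂ)) x :=
      (ae_ball_iff 𝒞.countable_toSet).2 hpc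
    filter_upwards [hv i, hall, coeFn_sum_smul 𝒞 (fun c => c i) p] with x h1 h2 h3
    rw [h1, h3, Finset.sum_congr rfl fun c hc => by rw [h2 c hc]]
    by_cases hx : s x = 0
    · rw [hx, Pi.zero_apply, Finset.sum_eq_zero]
      intro c hc
      rw [indicator_of_notMem, mul_zero]
      intro hxc
      exact (Finset.mem_filter.1 hc).2 ((mem_singleton_iff.1 hxc).symm.trans hx)
    · rw [Finset.sum_eq_single_of_mem (s x) (Finset.mem_filter.2 ⟨s.mem_range_self x, hx⟩)]
      · simp [hE]
      · intro c _ hcx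
        rw [indicator_of_notMem, mul_zero]
        exact fun hxc => hcx (mem_singleton_iff.1 hxc).symm
  -- the norm of a combination of the `v i` is computed on the cells
  have hnorm : ∀ b : Fin N → ℂ,
      ‖∑ i, b i • v i‖ = ∑ c ∈ 𝒞, ‖∑ i, b i * c i‖ * μ.real (E c) := by
    intro b
    set φ : (Fin N → ℂ) → ℝ := fun c => ‖∑ i, b i * c i‖ with hφ
    have hφ0 : φ 0 = 0 := by simp [hφ]
    have h1 : ‖∑ i, b i • v i‖ = ∫ x, (s.map φ) x ∂μ := by
      rw [L1.norm_eq_integral_norm]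
      refine integral_congr_ae ?_
      filter_upwards [coeFn_sum_smul Finset.univ b v, ae_all_iff.2 hv] with x h1 h2
      rw [h1]
      simp [hφ, h2]
    have hsi : Integrable (s.map φ) μ := SimpleFunc.integrable_iff_finMeasSupp.2
      ((SimpleFunc.integrable_iff_finMeasSupp.1 hs).map hφ0)
    rw [h1, ← SimpleFunc.integral_eq_integral _ hsi, SimpleFunc.map_integral _ _ hs hφ0, h𝒞,
      Finset.sum_filter_of_ne]
    · simp [hE, hφ, mul_comm]
    · rintro c - hc rfl
      simp at hc
  choose w hwm hwi hwb hwd using fun c => exists_truncation hTW hgm hg0 hC hWC (p c)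
  set F : Fin N → Y → ℂ := fun i y => ∑ c ∈ 𝒞, c i * w c y with hF
  have hFi : ∀ i, Integrable (F i) ν := fun i =>
    integrable_finsetSum _ fun c _ => (hwi c).const_mul _
  have hTv : ∀ i, ⇑(T (v i)) =ᵐ[ν] fun y => ∑ c ∈ 𝒞, c i * T (p c) y := by
    intro i
    rw [hvp i, map_sum]
    simp_rw [map_smul]
    exact coeFn_sum_smul 𝒞 (fun c => c i) fun c => T (p c)
  have hpi : ∀ c, Integrable (fun y => ‖T (p c) y - w c y‖) ν := fun c =>
    ((L1.integrable_coeFn _).sub (hwi c)).norm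
  have hvi : ∀ i, Integrable (fun y => ‖T (v i) y - F i y‖) ν := fun i =>
    ((L1.integrable_coeFn _).sub (hFi i)).norm
  have hdiff : ∀ i, ∫ y, ‖T (v i) y - F i y‖ ∂ν ≤ δ * r := by
    intro i
    calc ∫ y, ‖T (v i) y - F i y‖ ∂ν
        ≤ ∫ y, ∑ c ∈ 𝒞, ‖c i‖ * ‖T (p c) y - w c y‖ ∂ν := by
          refine integral_mono_ae (hvi i)
            (integrable_finsetSum _ fun c _ => (hpi c).const_mul _) ?_
          filter_upwards [hTv i] with y hy
          rw [hy, hF, ← Finset.sum_sub_distrib]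
          refine (norm_sum_le _ _).trans (Finset.sum_le_sum fun c _ => ?_)
          rw [← mul_sub, norm_mul]
      _ = ∑ c ∈ 𝒞, ‖c i‖ * ∫ y, ‖T (p c) y - w c y‖ ∂ν := by
          rw [integral_finsetSum _ fun c _ => (hpi c).const_mul _]
          simp_rw [integral_const_mul]
      _ ≤ ∑ c ∈ 𝒞, ‖c i‖ * (δ * μ.real (E c)) := by
          refine Finset.sum_le_sum fun c hc => ?_
          gcongr
          rw [← hpn c hc]
          exact hwd c
      _ = δ * ‖∑ j, (Pi.single i 1 : Fin N → ℂ) j • v j‖ := by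
          rw [hnorm, Finset.mul_sum]
          refine Finset.sum_congr rfl fun c _ => ?_
          simp only [Pi.single_apply, ite_mul, one_mul, zero_mul, Finset.sum_ite_eq',
            Finset.mem_univ, if_true]
          ring
      _ ≤ δ * r := by
          simp only [Pi.single_apply, ite_smul, one_smul, zero_smul, Finset.sum_ite_eq',
            Finset.mem_univ, if_true]
          exact mul_le_mul_of_nonneg_left (hr i) hδ
  -- the coefficients `b` depend on the point `y`: they turn the sum of moduli into a combination
  have hpt : ∀ y, ∑ i, ‖F i y‖ ≤ C * R * g y := by
    intro y
    have hb : ∀ z : ℂ, ∃ b : ℂ, ‖b‖ ≤ 1 ∧ b * z = (‖z‖ : ℂ) := by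
      intro z
      refine ⟨Complex.exp ((-z.arg : ℝ) * Complex.I), by rw [Complex.norm_exp_ofReal_mul_I], ?_⟩
      conv_lhs => rw [← Complex.norm_mul_exp_arg_mul_I z]
      rw [mul_left_comm, ← Complex.exp_add]
      simp
    choose b hb1 hb2 using fun i => hb (F i y)
    have h1 : ((∑ i, ‖F i y‖ : ℝ) : ℂ) = ∑ c ∈ 𝒞, (∑ i, b i * c i) * w c y := by
      push_cast
      simp_rw [← hb2, hF, Finset.mul_sum, Finset.sum_mul]
      rw [Finset.sum_comm]
      simp_rw [mul_assoc]
    have h2 : ∑ i, ‖F i y‖ = ‖((∑ i, ‖F i y‖ : ℝ) : ℂ)‖ := by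
      rw [Complex.norm_real, Real.norm_of_nonneg (Finset.sum_nonneg fun i _ => norm_nonneg _)]
    rw [h2, h1]
    calc ‖∑ c ∈ 𝒞, (∑ i, b i * c i) * w c y‖
        ≤ ∑ c ∈ 𝒞, ‖∑ i, b i * c i‖ * (C * μ.real (E c) * g y) := by
          refine (norm_sum_le _ _).trans (Finset.sum_le_sum fun c hc => ?_)
          rw [norm_mul, ← hpn c hc]
          gcongr
          exact hwb c y
      _ = C * ‖∑ i, b i • v i‖ * g y := by
          rw [hnorm, Finset.mul_sum, Finset.sum_mul]
          exact Finset.sum_congr rfl fun c _ => by ring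
      _ ≤ C * R * g y := by
          have := hg0 y
          gcongr
          exact hR b hb1
  calc ∑ i, ‖T (v i)‖ ≤ ∑ i, (δ * r + ∫ y, ‖F i y‖ ∂ν) := by
        refine Finset.sum_le_sum fun i _ => ?_
        refine le_trans ?_ (add_le_add_left (hdiff i) _)
        rw [L1.norm_eq_integral_norm,
          ← integral_add (hvi i) (hFi i).norm]
        refine integral_mono (L1.integrable_coeFn _).norm ((hvi i).add (hFi i).norm) fun y => ?_
        simpa using norm_add_le (T (v i) y - F i y) (F i y)
    _ = N * (δ * r) + ∫ y, ∑ i, ‖F i y‖ ∂ν := by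
        rw [Finset.sum_add_distrib, integral_finsetSum _ fun i _ => (hFi i).norm]
        simp
    _ ≤ N * (δ * r) + ∫ y, C * R * g y ∂ν := by
        exact add_le_add_right (integral_mono (integrable_finsetSum _ fun i _ => (hFi i).norm)
          (hgi.const_mul _) hpt) _
    _ = N * (δ * r) + C * (∫ y, g y ∂ν) * R := by
        rw [integral_const_mul]
        ring

/-- The estimate behind compactness: an operator with uniformly small tails behaves, up to the
error `δ`, like an operator from `L¹` to `L^∞`. The functions are approximated by the
coordinates of one vector valued simple function. -/
theorem sum_norm_le {T W : Lp ℂ 1 μ →L[ℂ] Lp ℂ 1 ν} (hTW : IsDominatedBy T W)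
    {g : Y → ℝ} (hgm : Measurable g) (hg0 : ∀ y, 0 < g y) (hgi : Integrable g ν) {C δ : ℝ}
    (hC : 0 < C) (hδ : 0 ≤ δ) (hWC : ∀ f : Lp ℂ 1 μ, Nonneg f → ‖f‖ ≤ 1 →
      ∫ y, max ((W f y).re - C * g y) 0 ∂ν ≤ δ) {N : ℕ}
    (u : Fin N → Lp ℂ 1 μ) {r R : ℝ} (hr : ∀ i, ‖u i‖ ≤ r)
    (hR : ∀ a : Fin N → ℂ, (∀ i, ‖a i‖ ≤ 1) → ‖∑ i, a i • u i‖ ≤ R) :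
    ∑ i, ‖T (u i)‖ ≤ N * (δ * r) + C * (∫ y, g y ∂ν) * R := by
  set G := ∫ y, g y ∂ν with hG
  have hG0 : 0 ≤ G := integral_nonneg fun y => (hg0 y).le
  have key : ∀ η : ℝ, 0 < η → ∑ i, ‖T (u i)‖ ≤
      N * (δ * r) + C * G * R + (N * δ + C * G * N + N * ‖T‖) * η := by
    intro η hη
    have hU : MemLp (fun x i => u i x) 1 μ := memLp_pi_iff.2 fun i => Lp.memLp (u i)
    obtain ⟨s, hs1, hs2⟩ := hU.exists_simpleFunc_eLpNorm_sub_lt ENNReal.one_ne_top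
      (ε := ENNReal.ofReal η) (by simpa using hη)
    have hsi : ∀ i, MemLp (fun x => s x i) 1 μ := fun i => memLp_pi_iff.1 hs2 i
    set v : Fin N → Lp ℂ 1 μ := fun i => (hsi i).toLp _ with hv
    have hvs : ∀ i, ⇑(v i) =ᵐ[μ] fun x => s x i := fun i => MemLp.coeFn_toLp _
    have huv : ∀ i, ‖u i - v i‖ ≤ η := by
      intro i
      rw [Lp.norm_def]
      refine ENNReal.toReal_le_of_le_ofReal hη.le (le_trans ?_ hs1.le)
      refine eLpNorm_mono_ae ?_
      filter_upwards [Lp.coeFn_sub (u i) (v i), hvs i] with x h1 h2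
      rw [h1, Pi.sub_apply, h2]
      exact norm_le_pi_norm (((fun x i => u i x) - s) x) i
    have hvr : ∀ i, ‖v i‖ ≤ r + η := fun i => by
      have := norm_sub_norm_le (v i) (u i)
      rw [norm_sub_rev] at this
      linarith [huv i, hr i]
    have hvR : ∀ a : Fin N → ℂ, (∀ i, ‖a i‖ ≤ 1) → ‖∑ i, a i • v i‖ ≤ R + N * η := by
      intro a ha
      have h1 : ∑ i, a i • v i = ∑ i, a i • u i - ∑ i, a i • (u i - v i) := by
        rw [← Finset.sum_sub_distrib]
        exact Finset.sum_congr rfl fun i _ => by rw [smul_sub, sub_sub_cancel]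
      have h2 : ‖∑ i, a i • (u i - v i)‖ ≤ N * η := by
        refine (norm_sum_le _ _).trans ((Finset.sum_le_card_nsmul _ _ η fun i _ => ?_).trans ?_)
        · rw [norm_smul]
          exact (mul_le_of_le_one_left (norm_nonneg _) (ha i)).trans (huv i)
        · simp
      rw [h1]
      exact (norm_sub_le _ _).trans (add_le_add (hR a ha) h2)
    have h1 := sum_norm_le_of_simple hTW hgm hg0 hgi hC hδ hWC s
      (memLp_one_iff_integrable.1 hs2) v hvs hvr hvR
    have h2 : ∑ i, ‖T (u i)‖ ≤ ∑ i, (‖T (v i)‖ + ‖T‖ * η) := by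
      refine Finset.sum_le_sum fun i _ => ?_
      have h3 : T (u i) = T (v i) + T (u i - v i) := by rw [map_sub]; abel
      rw [h3]
      refine (norm_add_le _ _).trans (add_le_add_right ?_ _)
      exact (T.le_opNorm _).trans (mul_le_mul_of_nonneg_left (huv i) (norm_nonneg T))
    rw [Finset.sum_add_distrib] at h2
    simp only [Finset.sum_const, Finset.card_univ, Fintype.card_fin, nsmul_eq_mul] at h2
    calc _ ≤ _ := h2
      _ ≤ _ := add_le_add_left h1 _
      _ = _ := by rw [← hG]; ring
  set B : ℝ := N * δ + C * G * N + N * ‖T‖ with hB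
  have hB0 : 0 ≤ B := by positivity
  refine le_of_forall_pos_le_add fun ε hε => (key (ε / (B + 1)) (by positivity)).trans ?_
  have : B * (ε / (B + 1)) ≤ ε := by
    rw [mul_div_assoc', div_le_iff₀ (by positivity)]
    nlinarith
  linarith

end Truncation

/-! ### Compactness -/

section Compactness

/-- An operator on a Hilbert space is compact if, for every `κ > 0`, the orthonormal families on
which it stays larger than `κ` have bounded size: it is within `κ` of its restriction to the span
of such a family of maximal size. -/
theorem isCompactOperator_of_orthonormal {𝓗 Z : Type*} [NormedAddCommGroup 𝓗]
    [InnerProductSpace ℂ 𝓗] [NormedAddCommGroup Z] [NormedSpace ℂ Z] [CompleteSpace Z]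
    (S : 𝓗 →L[ℂ] Z)
    (h : ∀ κ : ℝ, 0 < κ → ∃ N : ℕ, ∀ (n : ℕ) (e : Fin n → 𝓗), Orthonormal ℂ e →
      (∀ i, κ < ‖S (e i)‖) → n ≤ N) : IsCompactOperator S := by
  classical
  have hcl : IsClosed {f : 𝓗 →L[ℂ] Z | IsCompactOperator f} :=
    isClosed_setOfPred_isCompactOperator
  change S ∈ {f : 𝓗 →L[ℂ] Z | IsCompactOperator f}
  rw [← hcl.closure_eq, Metric.mem_closure_iff]
  intro ε hε
  obtain ⟨N, hN⟩ := h (ε / 2) (by positivity)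
  let p : ℕ → Prop := fun n => ∃ e : Fin n → 𝓗, Orthonormal ℂ e ∧ ∀ i, ε / 2 < ‖S (e i)‖
  have hp0 : p 0 := ⟨Fin.elim0, ⟨fun i => i.elim0, fun i => i.elim0⟩, fun i => i.elim0⟩
  have hpn := Nat.findGreatest_spec (P := p) (Nat.zero_le N) hp0
  set n := Nat.findGreatest p N with hn
  obtain ⟨e, he, hSe⟩ := hpn
  have hmax : ¬ p (n + 1) := fun hp' => by
    have h1 : n + 1 ≤ N := by
      obtain ⟨e', he', hSe'⟩ := hp'
      exact hN _ e' he' hSe'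
    have h2 : n + 1 ≤ n := Nat.le_findGreatest h1 hp'
    omega
  set V : Submodule ℂ 𝓗 := Submodule.span ℂ (range e) with hV
  have : FiniteDimensional ℂ V := FiniteDimensional.span_of_finite ℂ (finite_range e)
  have hsmall : ∀ y ∈ Vᗮ, ‖S y‖ ≤ ε / 2 * ‖y‖ := by
    intro y hy
    rcases eq_or_ne y 0 with rfl | hy0
    · simp
    have hyn : 0 < ‖y‖ := norm_pos_iff.2 hy0
    by_contra hlt
    refine hmax ⟨Matrix.vecCons (((‖y‖⁻¹ : ℝ) : ℂ) • y) e, orthonormal_vecCons_iff.2 ⟨?_, ?_, he⟩,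
      Fin.cases ?_ fun i => ?_⟩
    · rw [norm_smul, Complex.norm_real, norm_inv, norm_norm, inv_mul_cancel₀ hyn.ne']
    · intro i
      rw [inner_smul_left, Submodule.inner_left_of_mem_orthogonal
        (Submodule.subset_span (mem_range_self i)) hy, mul_zero]
    · rw [Matrix.cons_val_zero, map_smul, norm_smul, Complex.norm_real, norm_inv, norm_norm,
        inv_mul_eq_div, lt_div_iff₀ hyn]
      exact not_le.1 hlt
    · exact hSe i
  refine ⟨(S ∘L V.subtypeL) ∘L V.orthogonalProjectionOnto, ?_, ?_⟩
  · exact (isCompactOperator_of_locallyCompactSpace_rng (S ∘L V.subtypeL)).comp_clm _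
  · rw [dist_eq_norm]
    refine lt_of_le_of_lt (ContinuousLinearMap.opNorm_le_bound _ (by positivity : 0 ≤ ε / 2)
      fun x => ?_) (half_lt_self hε)
    have h1 : (S - (S ∘L V.subtypeL) ∘L V.orthogonalProjectionOnto) x =
        S (x - V.starProjection x) := by simp
    rw [h1]
    refine (hsmall _ (V.sub_starProjection_mem_orthogonal x)).trans ?_
    gcongr
    rw [← V.starProjection_orthogonal_val]
    exact Vᗮ.norm_starProjection_apply_le x

variable {X : Type*} [MeasurableSpace X] {μ : Measure X}

/-- If `T` is dominated by an operator with uniformly small tails, then `T ∘ J` is compact for every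
bounded `J : L² → L¹`. For `n` orthonormal vectors `e i`, the combinations `∑ a i • e i` with
`‖a i‖ ≤ 1` have norm at most `√n`, so that `sum_norm_le` bounds `∑ ‖T (J (e i))‖` by a small
multiple of `n` plus a multiple of `√n`. -/
theorem isCompactOperator_comp_of_uniformTails {T W : Lp ℂ 1 μ →L[ℂ] Lp ℂ 1 μ}
    (hTW : IsDominatedBy T W) {g : X → ℝ} (hm : Measurable g) (h0 : ∀ x, 0 < g x) (hi : Integrable g μ)
    (hW : UniformTails W g) (J : Lp ℂ 2 μ →L[ℂ] Lp ℂ 1 μ) :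
    IsCompactOperator (T ∘L J) := by
  refine isCompactOperator_of_orthonormal _ fun κ hκ => ?_
  obtain ⟨C, hC, hWC⟩ := hW (κ / (2 * (‖J‖ + 1))) (by positivity)
  set G := ∫ x, g x ∂μ with hG
  have hG0 : 0 ≤ G := integral_nonneg fun x => (h0 x).le
  refine ⟨⌈(2 * (C * G * ‖J‖) / κ) ^ 2⌉₊, fun n e he hκe => ?_⟩
  rcases Nat.eq_zero_or_pos n with rfl | hn
  · exact Nat.zero_le _
  have hR : ∀ a : Fin n → ℂ, (∀ i, ‖a i‖ ≤ 1) → ‖∑ i, a i • J (e i)‖ ≤ ‖J‖ * √n := by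
    intro a ha
    have h1 : ∑ i, a i • J (e i) = J (∑ i, a i • e i) := by simp [map_sum, map_smul]
    rw [h1]
    refine (J.le_opNorm _).trans (mul_le_mul_of_nonneg_left ?_ (norm_nonneg J))
    refine Real.le_sqrt_of_sq_le ?_
    have h2 : (‖∑ i, a i • e i‖ : ℝ) ^ 2 = ∑ i, ‖a i‖ ^ 2 := by
      have h3 := he.inner_sum a a Finset.univ
      rw [inner_self_eq_norm_sq_to_K] at h3
      have h4 : ((‖∑ i, a i • e i‖ ^ 2 : ℝ) : ℂ) = ((∑ i, ‖a i‖ ^ 2 : ℝ) : ℂ) := by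
        push_cast
        refine h3.trans (Finset.sum_congr rfl fun i _ => ?_)
        rw [Complex.conj_mul']
      exact_mod_cast h4
    rw [h2]
    calc ∑ i, ‖a i‖ ^ 2 ≤ ∑ _i : Fin n, (1 : ℝ) :=
          Finset.sum_le_sum fun i _ => pow_le_one₀ (norm_nonneg _) (ha i)
      _ = n := by simp
  have hr : ∀ i, ‖J (e i)‖ ≤ ‖J‖ := fun i => by simpa [he.1 i] using J.le_opNorm (e i)
  have h1 := sum_norm_le hTW hm h0 hi hC
    (by positivity) hWC (fun i => J (e i)) hr hR
  have h2 : n * κ ≤ ∑ i, ‖T (J (e i))‖ := by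
    have : ∑ _i : Fin n, κ ≤ ∑ i, ‖T (J (e i))‖ := Finset.sum_le_sum fun i _ => (hκe i).le
    simpa using this
  have h3 : κ / (2 * (‖J‖ + 1)) * ‖J‖ ≤ κ / 2 := by
    rw [div_mul_eq_mul_div, div_le_div_iff₀ (by positivity) (by positivity)]
    nlinarith [norm_nonneg J]
  have hn0 : (0 : ℝ) < n := by exact_mod_cast hn
  have hs0 : 0 < √(n : ℝ) := Real.sqrt_pos.2 hn0
  have h4 : n * (κ / 2) ≤ C * G * ‖J‖ * √n := by
    have := mul_le_mul_of_nonneg_left h3 hn0.le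
    rw [← hG] at h1
    nlinarith
  have h5 : √(n : ℝ) ≤ 2 * (C * G * ‖J‖) / κ := by
    rw [le_div_iff₀ hκ]
    have h6 : √(n : ℝ) * √(n : ℝ) = n := Real.mul_self_sqrt hn0.le
    have h7 : √(n : ℝ) * (√(n : ℝ) * κ) ≤ √(n : ℝ) * (2 * (C * G * ‖J‖)) := by
      rw [← mul_assoc, h6]
      linarith
    exact le_of_mul_le_mul_left h7 hs0
  have h8 : (n : ℝ) ≤ (2 * (C * G * ‖J‖) / κ) ^ 2 := by
    rw [← Real.sq_sqrt hn0.le]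
    exact pow_le_pow_left₀ hs0.le h5 2
  exact_mod_cast h8.trans (Nat.le_ceil _)

lemma exists_pos_sq_integrable (μ : Measure X) [SigmaFinite μ] :
    ∃ h : X → ℝ, Measurable h ∧ (∀ x, 0 < h x) ∧ Integrable (fun x => h x ^ 2) μ := by
  obtain ⟨g, hg0, hgm, hgi⟩ := exists_pos_lintegral_lt_of_sigmaFinite μ one_ne_zero
  refine ⟨fun x => √(g x), by fun_prop, fun x => Real.sqrt_pos.2 (hg0 x), ?_⟩
  simp_rw [Real.sq_sqrt (NNReal.coe_nonneg _)]
  refine ⟨by fun_prop, ?_⟩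
  rw [hasFiniteIntegral_iff_enorm]
  simpa using hgi.trans ENNReal.one_lt_top

/-- The square of an operator dominated by a positive operator with weakly compact image of the
unit ball is compact. Up to a small error, `T` maps the unit ball into an order interval
`{|f| ≤ C h ^ 2}`, which is contained in the image of a ball of `L²` under the multiplication
by `h`, and `T` is compact there. -/
theorem isCompactOperator_comp_self [SigmaFinite μ] {T W : Lp ℂ 1 μ →L[ℂ] Lp ℂ 1 μ}
    (hTW : IsDominatedBy T W) (hW : IsPositiveOp W)
    {K : Set (WeakSpace ℂ (Lp ℂ 1 μ))} (hK : IsCompact K)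
    (hWK : ∀ f : Lp ℂ 1 μ, ‖f‖ ≤ 1 → toWeakSpace ℂ _ (W f) ∈ K) :
    IsCompactOperator (T ∘L T) := by
  obtain ⟨h, hm, h0, hi⟩ := exists_pos_sq_integrable μ
  have hUT : UniformTails W fun x => h x ^ 2 :=
    uniformTails_of_weaklyCompact hW hK hWK (hm.pow_const 2) fun x => pow_pos (h0 x) 2
  have hL2 : MemLp (fun x => (h x : ℂ)) 2 μ := by
    refine (memLp_two_iff_integrable_sq_norm (by fun_prop)).2 ?_
    simpa using hi
  set hL : Lp ℂ 2 μ := hL2.toLp _ with hhL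
  set J : Lp ℂ 2 μ →L[ℂ] Lp ℂ 1 μ := (ContinuousLinearMap.mul ℂ ℂ).holderL μ 2 2 1 hL with hJ
  have hJc : ∀ k : Lp ℂ 2 μ, ⇑(J k) =ᵐ[μ] fun x => (h x : ℂ) * k x := by
    intro k
    have h1 := ContinuousLinearMap.coeFn_holder (r := 1) (ContinuousLinearMap.mul ℂ ℂ) hL k
    filter_upwards [h1, hL2.coeFn_toLp] with x h2 h3
    rw [hJ, ContinuousLinearMap.holderL_apply_apply, h2, h3]
    rfl
  have hS : IsCompactOperator (T ∘L J).toLinearMap :=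
    isCompactOperator_comp_of_uniformTails hTW (hm.pow_const 2) (fun x => pow_pos (h0 x) 2) hi hUT J
  have htb : TotallyBounded ((T ∘L T) '' Metric.closedBall 0 1) := by
    rw [Metric.totallyBounded_iff]
    intro ε hε
    obtain ⟨C, hC, hWC⟩ := hUT (ε / (2 * (‖T‖ + 1))) (by positivity)
    obtain ⟨t, htf, ht⟩ := Metric.totallyBounded_iff.1
      ((hS.isCompact_closure_image_closedBall (C * ‖hL‖)).totallyBounded.subset
        subset_closure) (ε / 2) (by positivity)
    refine ⟨t, htf, ?_⟩
    rintro _ ⟨f, hf, rfl⟩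
    rw [mem_closedBall_zero_iff] at hf
    obtain ⟨w, hwm, hwi, hwb, hwd⟩ := exists_truncation hTW (hm.pow_const 2)
      (fun y => pow_pos (h0 y) 2) hC hWC f
    have hkb : ∀ x, ‖w x / (h x : ℂ)‖ ≤ C * ‖(h x : ℂ)‖ := by
      intro x
      rw [norm_div, Complex.norm_real, Real.norm_of_nonneg (h0 x).le, div_le_iff₀ (h0 x)]
      refine (hwb x).trans ?_
      rw [mul_assoc, mul_assoc, ← sq]
      refine mul_le_mul_of_nonneg_left ?_ hC.le
      exact mul_le_of_le_one_left (by positivity) hf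
    have hk2 : MemLp (fun x => w x / (h x : ℂ)) 2 μ :=
      hL2.of_le_mul (hwm.div (Complex.measurable_ofReal.comp hm)).aestronglyMeasurable
        (Eventually.of_forall hkb)
    set k : Lp ℂ 2 μ := hk2.toLp _ with hk
    have hkn : ‖k‖ ≤ C * ‖hL‖ := by
      refine Lp.norm_le_mul_norm_of_ae_le_mul ?_
      filter_upwards [hk2.coeFn_toLp, hL2.coeFn_toLp] with x h1 h2
      rw [h1, h2]
      exact hkb x
    have hTf : ‖T f - J k‖ ≤ ε / (2 * (‖T‖ + 1)) := by
      refine le_trans (le_of_eq ?_) (hwd.trans (mul_le_of_le_one_right (by positivity) hf))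
      rw [L1.norm_eq_integral_norm]
      refine integral_congr_ae ?_
      filter_upwards [Lp.coeFn_sub (T f) (J k), hJc k, hk2.coeFn_toLp] with x h1 h2 h3
      rw [h1, Pi.sub_apply, h2, h3, mul_div_cancel₀]
      exact_mod_cast (h0 x).ne'
    have hmem : (T ∘L J) k ∈ ⋃ y ∈ t, Metric.ball y (ε / 2) :=
      ht ⟨k, by simpa using hkn, rfl⟩
    simp only [mem_iUnion, Metric.mem_ball, exists_prop] at hmem ⊢
    obtain ⟨y, hy, hyk⟩ := hmem
    refine ⟨y, hy, ?_⟩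
    have h1 : dist ((T ∘L T) f) ((T ∘L J) k) ≤ ε / 2 := by
      rw [dist_eq_norm, ContinuousLinearMap.comp_apply, ContinuousLinearMap.comp_apply, ← map_sub]
      refine (T.le_opNorm _).trans ((mul_le_mul_of_nonneg_left hTf (norm_nonneg T)).trans ?_)
      rw [mul_div_assoc', div_le_div_iff₀ (by positivity) (by positivity)]
      nlinarith [norm_nonneg T]
    have := dist_triangle ((T ∘L T) f) ((T ∘L J) k) y
    linarith
  exact (isCompactOperator_iff_isCompact_closure_image_closedBall
    (T ∘L T).toLinearMap zero_lt_one).2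
    (htb.closure.isCompact_of_isClosed isClosed_closure)

end Compactness

/-! ### Peripheral eigenvectors of positive contractions -/

section Peripheral

variable {X : Type*} [MeasurableSpace X] {μ : Measure X}

/-- `T² y = w² y` for some `y ≠ 0` yields an eigenvector of `T`, for `w` or `-w`. -/
lemma exists_eigenvector_of_sq {Z : Type*} [NormedAddCommGroup Z] [NormedSpace ℂ Z]
    (T : Z →L[ℂ] Z) {w : ℂ} {y : Z} (hy : y ≠ 0) (h : T (T y) = w ^ 2 • y) :
    ∃ (β : ℂ) (z : Z), β ^ 2 = w ^ 2 ∧ z ≠ 0 ∧ T z = β • z := by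
  by_cases h0 : T y = w • y
  · exact ⟨w, y, rfl, hy, h0⟩
  · refine ⟨-w, T y - w • y, by ring, sub_ne_zero.2 h0, ?_⟩
    rw [map_sub, map_smul, h, neg_smul, smul_sub, smul_smul, sq]
    abel

/-- If the fourth power of an operator is compact and its spectral radius is at least `1`, then it
has an eigenvalue of modulus at least `1`. -/
lemma exists_eigenvector {Z : Type*} [NormedAddCommGroup Z] [NormedSpace ℂ Z] [CompleteSpace Z]
    (B : Z →L[ℂ] Z) (hB : IsCompactOperator ((B * B) ∘L (B * B)))
    (hr : 1 ≤ spectralRadius ℂ B) :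
    ∃ (β : ℂ) (z : Z), 1 ≤ ‖β‖ ∧ z ≠ 0 ∧ B z = β • z := by
  have hnt : Nontrivial Z := by
    by_contra hsub
    rw [not_nontrivial_iff_subsingleton] at hsub
    have : Subsingleton (Z →L[ℂ] Z) := ⟨fun S T => ContinuousLinearMap.ext fun z =>
      Subsingleton.elim _ _⟩
    rw [spectrum.SpectralRadius.of_subsingleton] at hr
    exact absurd hr (by simp)
  obtain ⟨z, hz, hzr⟩ := spectrum.exists_nnnorm_eq_spectralRadius B
  have hz1 : 1 ≤ ‖z‖ := by
    rw [← hzr] at hr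
    exact_mod_cast hr
  have hz0 : z ≠ 0 := norm_pos_iff.1 (by linarith)
  have hz4 : z ^ 4 ∈ spectrum ℂ ((B * B) ∘L (B * B)) := by
    have h1 := spectrum.pow_mem_pow B 4 hz
    have h2 : B ^ 4 = (B * B) ∘L (B * B) := by
      rw [← ContinuousLinearMap.mul_def]
      simp only [pow_succ, pow_zero, one_mul, mul_assoc]
    rwa [h2] at h1
  obtain ⟨x, hx⟩ := ((hB.hasEigenvalue_iff_mem_spectrum (pow_ne_zero 4 hz0)).2
    hz4).exists_hasEigenvector
  have hx2 : (B * B) ((B * B) x) = (z ^ 2) ^ 2 • x := by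
    have := hx.apply_eq_smul
    rw [← pow_mul]
    exact this
  obtain ⟨γ, y, hγ, hy0, hy⟩ := exists_eigenvector_of_sq (B * B) hx.2 hx2
  obtain ⟨w, hw⟩ := IsAlgClosed.exists_pow_nat_eq γ zero_lt_two
  rw [← hw] at hy
  obtain ⟨β, v, hβ, hv0, hv⟩ := exists_eigenvector_of_sq B hy0 hy
  refine ⟨β, v, ?_, hv0, hv⟩
  have h4 : ‖β‖ ^ 4 = ‖z‖ ^ 4 := by
    rw [← norm_pow, ← norm_pow]
    congr 1
    rw [show β ^ 4 = (β ^ 2) ^ 2 by ring, hβ, hw, hγ]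
    ring
  rw [(pow_left_inj₀ (norm_nonneg β) (norm_nonneg z) four_ne_zero).1 h4]
  exact hz1

lemma IsDominatedBy.comp {S T V W : Lp ℂ 1 μ →L[ℂ] Lp ℂ 1 μ} (hS : IsDominatedBy S V)
    (hT : IsDominatedBy T W) (hV : IsPositiveOp V) (hW : IsPositiveOp W) :
    IsDominatedBy (S ∘L T) (V ∘L W) := by
  intro f
  have h1 : ∀ᵐ x ∂μ, ‖modulus (T f) x‖ ≤ (W (modulus f) x).re := by
    filter_upwards [hT f, coeFn_modulus (T f)] with x h1 h2
    rwa [h2, Complex.norm_real, norm_norm]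
  filter_upwards [hS (T f), hV.norm_le_of_norm_le (hW _ (nonneg_modulus f)) h1] with x h2 h3
  exact h2.trans ((Complex.re_le_norm _).trans h3)

section Multiplier

variable {P B : Lp ℂ 1 μ →L[ℂ] Lp ℂ 1 μ} {e : X → ℂ}

lemma isDominatedBy_of_multiplier (hP : IsPositiveOp P) (he : ∀ᵐ x ∂μ, ‖e x‖ ≤ 1)
    (hB : ∀ f, ∀ᵐ x ∂μ, B f x = e x * P f x) : IsDominatedBy B P := by
  intro f
  filter_upwards [he, hB f, hP.norm_le_modulus f] with x h1 h2 h3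
  rw [h2, norm_mul]
  exact (mul_le_of_le_one_left (norm_nonneg _) h1).trans h3

/-- For an eigenvector `φ` of `e P` with eigenvalue of modulus at least `1`, all the
inequalities `|φ| ≤ |β φ| = |e P φ| ≤ |P φ| ≤ P |φ|` are equalities, because `P` does not increase
the integral. -/
lemma modulus_fixed_of_eigenvector (hP : IsPositiveOp P) (hPc : ∀ f, Nonneg f → ‖P f‖ ≤ ‖f‖)
    (he : ∀ᵐ x ∂μ, ‖e x‖ ≤ 1) (hB : ∀ f, ∀ᵐ x ∂μ, B f x = e x * P f x)
    {φ : Lp ℂ 1 μ} {β : ℂ} (hβ : 1 ≤ ‖β‖) (hφ : B φ = β • φ) :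
    P (modulus φ) = modulus φ ∧
      ∀ᵐ x ∂μ, ‖β‖ * ‖φ x‖ = ‖φ x‖ ∧ ‖e x‖ * ‖φ x‖ = ‖φ x‖ := by
  have hpos : Nonneg (P (modulus φ)) := hP _ (nonneg_modulus φ)
  have hBφ := hB φ
  rw [hφ] at hBφ
  have hchain : ∀ᵐ x ∂μ, ‖φ x‖ ≤ ‖β‖ * ‖φ x‖ ∧ ‖β‖ * ‖φ x‖ = ‖e x‖ * ‖P φ x‖ ∧
      ‖e x‖ * ‖P φ x‖ ≤ ‖P φ x‖ ∧ ‖P φ x‖ ≤ (P (modulus φ) x).re := by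
    filter_upwards [hBφ, he, hP.norm_le_modulus φ, Lp.coeFn_smul β φ] with x h1 h2 h3 h4
    refine ⟨le_mul_of_one_le_left (norm_nonneg _) hβ, ?_,
      mul_le_of_le_one_left (norm_nonneg _) h2, h3⟩
    rw [← norm_mul, ← norm_mul, ← h1, h4, Pi.smul_apply, smul_eq_mul]
  have hint : ∫ x, ((P (modulus φ) x).re - ‖φ x‖) ∂μ = 0 := by
    refine le_antisymm ?_ (integral_nonneg_of_ae ?_)
    · rw [integral_sub (integrable_re _) (L1.integrable_coeFn φ).norm, ← hpos.norm_eq_integral,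
        ← L1.norm_eq_integral_norm, sub_nonpos, ← norm_modulus φ]
      exact hPc _ (nonneg_modulus φ)
    · filter_upwards [hchain] with x hx
      simp only [Pi.zero_apply, sub_nonneg]
      linarith
  have heq : ∀ᵐ x ∂μ, (P (modulus φ) x).re - ‖φ x‖ = 0 := by
    refine (integral_eq_zero_iff_of_nonneg_ae ?_
      ((integrable_re _).sub (L1.integrable_coeFn φ).norm)).1 hint
    filter_upwards [hchain] with x hx
    simp only [Pi.zero_apply, Pi.sub_apply, sub_nonneg]
    linarith
  refine ⟨Lp.ext ?_, ?_⟩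
  · filter_upwards [heq, hpos, coeFn_modulus φ] with x h1 h2 h3
    rw [h3]
    refine Complex.ext ?_ (by simp [h2.2])
    rw [Complex.ofReal_re]
    linarith
  · filter_upwards [heq, hchain] with x h1 h2
    have h3 : ‖P φ x‖ = ‖φ x‖ := by linarith
    rw [h3] at h2
    exact ⟨by linarith, by linarith⟩

end Multiplier

/-- A nonnegative fixed point of an irreducible positive operator vanishes or is almost everywhere
nonzero. -/
lemma eq_zero_or_ae_ne_zero_of_fixed {P : Lp ℂ 1 μ →L[ℂ] Lp ℂ 1 μ} (hP : IsPositiveOp P)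
    (hirr : IsIrreducibleOp P) {g : Lp ℂ 1 μ} (hg : Nonneg g) (hPg : P g = g) :
    g = 0 ∨ ∀ᵐ x ∂μ, g x ≠ 0 := by
  have hgm : Measurable g := (Lp.stronglyMeasurable g).measurable
  set A : Set X := {x | g x ≠ 0} with hA
  have hAm : MeasurableSet A := (hgm (measurableSet_singleton 0)).compl
  have key : ∀ f : Lp ℂ 1 μ, (∀ᵐ x ∂μ, x ∉ A → f x = 0) → ∀ᵐ x ∂μ, x ∉ A → P f x = 0 := by
    intro f hf
    have hfm : Measurable f := (Lp.stronglyMeasurable f).measurable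
    -- approximate `f` by its restrictions to `{|f| ≤ k g}`
    set S : ℕ → Set X := fun k => {x | ‖f x‖ ≤ k * (g x).re} with hS
    have hSm : ∀ k, MeasurableSet (S k) := fun k =>
      measurableSet_le hfm.norm ((Complex.measurable_re.comp hgm).const_mul _)
    have hfi : ∀ k, Integrable ((S k).indicator f) μ := fun k =>
      (L1.integrable_coeFn f).indicator (hSm k)
    set F : ℕ → Lp ℂ 1 μ := fun k => (hfi k).toL1 _ with hF
    have hFc : ∀ k, ⇑(F k) =ᵐ[μ] (S k).indicator f := fun k => Integrable.coeFn_toL1 _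
    have hPF : ∀ k, ∀ᵐ x ∂μ, x ∉ A → P (F k) x = 0 := by
      intro k
      have h1 : ∀ᵐ x ∂μ, ‖F k x‖ ≤ ((((k : ℝ) : ℂ) • g) x).re := by
        filter_upwards [hFc k, Lp.coeFn_smul ((k : ℝ) : ℂ) g, hg] with x h1 h2 h3
        rw [h1, h2, Pi.smul_apply, smul_eq_mul, Complex.re_ofReal_mul]
        by_cases hx : x ∈ S k
        · rw [indicator_of_mem hx]; exact hx
        · rw [indicator_of_notMem hx, norm_zero]
          exact mul_nonneg (Nat.cast_nonneg k) h3.1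
      have h2 := hP.norm_le_of_norm_le (nonneg_smul hg (Nat.cast_nonneg k)) h1
      rw [map_smul, hPg] at h2
      filter_upwards [h2, Lp.coeFn_smul ((k : ℝ) : ℂ) g] with x h3 h4 hx
      rw [h4, Pi.smul_apply, not_not.1 hx, smul_zero, Complex.zero_re] at h3
      exact norm_le_zero_iff.1 h3
    have hlim : Tendsto (fun k => ‖f - F k‖) atTop (𝓝 0) := by
      have h1 : Tendsto (fun k => ∫ x, ‖f x - (S k).indicator f x‖ ∂μ) atTop
          (𝓝 (∫ _x, (0 : ℝ) ∂μ)) := by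
        refine tendsto_integral_of_dominated_convergence (fun x => ‖f x‖)
          (fun k => ((L1.integrable_coeFn f).sub (hfi k)).norm.aestronglyMeasurable)
          (L1.integrable_coeFn f).norm (fun k => Eventually.of_forall fun x => ?_) ?_
        · rw [norm_norm]
          by_cases hx : x ∈ S k <;> simp [hx]
        · filter_upwards [hf, hg] with x h1 h2
          refine tendsto_const_nhds.congr' ?_
          by_cases hx : x ∈ A
          · have hgx : 0 < (g x).re := by
              refine lt_of_le_of_ne h2.1 fun h0 => hx ?_
              exact Complex.ext h0.symm h2.2
            obtain ⟨n, hn⟩ := exists_nat_ge (‖f x‖ / (g x).re)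
            filter_upwards [eventually_ge_atTop n] with k hk
            have hxk : x ∈ S k := by
              rw [div_le_iff₀ hgx] at hn
              refine hn.trans (mul_le_mul_of_nonneg_right ?_ hgx.le)
              exact_mod_cast hk
            simp [hxk]
          · refine Eventually.of_forall fun k => ?_
            simp [indicator, h1 hx]
      rw [integral_zero] at h1
      refine h1.congr fun k => ?_
      rw [L1.norm_eq_integral_norm]
      refine integral_congr_ae ?_
      filter_upwards [Lp.coeFn_sub f (F k), hFc k] with x h2 h3
      rw [h2, Pi.sub_apply, h3]
    have hle : ∀ k, ∫ x in Aᶜ, ‖P f x‖ ∂μ ≤ ‖P‖ * ‖f - F k‖ := by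
      intro k
      calc ∫ x in Aᶜ, ‖P f x‖ ∂μ = ∫ x in Aᶜ, ‖P (f - F k) x‖ ∂μ := by
            refine setIntegral_congr_ae hAm.compl ?_
            rw [map_sub]
            filter_upwards [hPF k, Lp.coeFn_sub (P f) (P (F k))] with x h1 h2 hx
            rw [h2, Pi.sub_apply, h1 hx, sub_zero]
        _ ≤ ∫ x, ‖P (f - F k) x‖ ∂μ := setIntegral_le_integral (L1.integrable_coeFn _).norm
            (Eventually.of_forall fun x => norm_nonneg _)
        _ ≤ _ := by
            rw [← L1.norm_eq_integral_norm]
            exact P.le_opNorm _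
    have hzero : ∫ x in Aᶜ, ‖P f x‖ ∂μ = 0 := by
      refine le_antisymm ?_ (integral_nonneg fun x => norm_nonneg _)
      have := hlim.const_mul ‖P‖
      rw [mul_zero] at this
      exact ge_of_tendsto' this hle
    have h1 := (integral_eq_zero_iff_of_nonneg (fun x => norm_nonneg _)
      (L1.integrable_coeFn (P f)).norm.integrableOn).1 hzero
    have h2 := (ae_restrict_iff' hAm.compl).1 h1
    filter_upwards [h2] with x hx hxA
    exact norm_eq_zero.1 (hx hxA)
  rcases hirr A hAm key with h | h
  · left
    refine Lp.ext ?_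
    have h1 : ∀ᵐ x ∂μ, x ∉ A := measure_eq_zero_iff_ae_notMem.1 h
    filter_upwards [h1, Lp.coeFn_zero ℂ 1 μ] with x h2 h3
    rw [h3, not_not.1 h2]
    rfl
  · right
    have h1 : ∀ᵐ x ∂μ, x ∉ Aᶜ := measure_eq_zero_iff_ae_notMem.1 h
    filter_upwards [h1] with x hx
    exact not_not.1 hx

/-- Wielandt's rigidity: if `g ≥ 0` is fixed by the positive operator `P` and `P (D g) = s g` with
`|D| ≤ 1` and `|s| = 1`, then `P (D f) = s P f` for all `|f| ≤ g`. For `0 ≤ q ≤ 2 g`, both `q` and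
`2 g - q` give `Re s̄ P (D q) ≤ P q`, and the two inequalities add up to an equality; real and
imaginary parts of `f` reduce to this case. -/
lemma map_mul_of_fixed {P : Lp ℂ 1 μ →L[ℂ] Lp ℂ 1 μ} (hP : IsPositiveOp P) {g : Lp ℂ 1 μ}
    (hg : Nonneg g) (hPg : P g = g) {D s : X → ℂ} (hD : ∀ᵐ x ∂μ, ‖D x‖ ≤ 1)
    (hs : ∀ᵐ x ∂μ, ‖s x‖ = 1)
    {M : Lp ℂ 1 μ →ₗ[ℂ] Lp ℂ 1 μ} (hM : ∀ f, ∀ᵐ x ∂μ, M f x = D x * f x)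
    (hPMg : ∀ᵐ x ∂μ, P (M g) x = s x * g x)
    {f : Lp ℂ 1 μ} (hfg : ∀ᵐ x ∂μ, ‖f x‖ ≤ (g x).re) :
    ∀ᵐ x ∂μ, P (M f) x = s x * P f x := by
  have hbound : ∀ q, Nonneg q → ∀ᵐ x ∂μ, ‖P (M q) x‖ ≤ (P q x).re ∧ (P q x).im = 0 := by
    intro q hq
    have h1 : ∀ᵐ x ∂μ, ‖M q x‖ ≤ (q x).re := by
      filter_upwards [hM q, hD, hq] with x h1 h2 h3
      rw [h1, norm_mul]
      have : q x = ((q x).re : ℂ) := Complex.ext rfl (by simpa using h3.2)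
      rw [this, Complex.norm_real, Real.norm_of_nonneg h3.1, Complex.ofReal_re]
      exact mul_le_of_le_one_left h3.1 h2
    filter_upwards [hP.norm_le_of_norm_le hq h1, hP q hq] with x h2 h3
    exact ⟨h2, h3.2⟩
  have hg0 : ∀ᵐ x ∂μ, (g x).im = 0 := hg.mono fun x hx => hx.2
  have hreal : ∀ a : Lp ℂ 1 μ, (∀ᵐ x ∂μ, (a x).im = 0) → (∀ᵐ x ∂μ, |(a x).re| ≤ (g x).re) →
      ∀ᵐ x ∂μ, P (M a) x = s x * P a x := by
    intro a ha hag
    have hq : Nonneg (g + a) := by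
      filter_upwards [ha, hag, hg0, Lp.coeFn_add g a] with x h1 h2 h3 h4
      rw [h4, Pi.add_apply, Complex.add_re, Complex.add_im, h1, h3]
      exact ⟨by linarith [(abs_le.1 h2).1], by simp⟩
    have hq' : Nonneg (g - a) := by
      filter_upwards [ha, hag, hg0, Lp.coeFn_sub g a] with x h1 h2 h3 h4
      rw [h4, Pi.sub_apply, Complex.sub_re, Complex.sub_im, h1, h3]
      exact ⟨by linarith [(abs_le.1 h2).2], by simp⟩
    have b1 := hbound _ hq
    have b2 := hbound _ hq'
    simp only [map_add, map_sub, hPg] at b1 b2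
    filter_upwards [b1, b2, hs, hPMg, Lp.coeFn_add g (P a), Lp.coeFn_sub g (P a),
      Lp.coeFn_add (P (M g)) (P (M a)), Lp.coeFn_sub (P (M g)) (P (M a)), hg0]
      with x h1 h2 h3 h4 h5 h6 h7 h8 h9
    rw [h5, h7, Pi.add_apply, Pi.add_apply, h4] at h1
    rw [h6, h8, Pi.sub_apply, Pi.sub_apply, h4] at h2
    -- divide by the unimodular number `s x`
    set z := (starRingEnd ℂ) (s x) * P (M a) x with hz
    have hss : (starRingEnd ℂ) (s x) * s x = 1 := by
      rw [Complex.conj_mul', h3]; simp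
    have hss' : s x * (starRingEnd ℂ) (s x) = 1 := by rw [mul_comm]; exact hss
    have hsz : P (M a) x = s x * z := by rw [hz, ← mul_assoc, hss', one_mul]
    rw [hsz, ← mul_add, norm_mul, h3, one_mul] at h1
    rw [hsz, ← mul_sub, norm_mul, h3, one_mul] at h2
    have r1 := (Complex.re_le_norm _).trans h1.1
    have r2 := (Complex.re_le_norm _).trans h2.1
    simp only [Complex.add_re, Complex.sub_re, Complex.add_im] at r1 r2 h1
    have hre : z.re = (P a x).re := by linarith
    have him : z.im = 0 := by
      have h10 := h1.1
      rw [← Complex.add_re, ← sq_le_sq₀ (norm_nonneg _), Complex.sq_norm, Complex.normSq_apply,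
        Complex.add_re, Complex.add_re, Complex.add_im, hre, h9] at h10
      · nlinarith [sq_nonneg z.im]
      · exact (norm_nonneg _).trans (by simpa using h1.1)
    rw [hsz]
    congr 1
    refine Complex.ext hre ?_
    rw [him]
    linarith [h1.2]
  set a : Lp ℂ 1 μ := ((L1.integrable_coeFn f).re.ofReal (𝕜 := ℂ)).toL1 _ with ha
  set b : Lp ℂ 1 μ := ((L1.integrable_coeFn f).im.ofReal (𝕜 := ℂ)).toL1 _ with hb
  have ha' : ⇑a =ᵐ[μ] fun x => (((f x).re : ℝ) : ℂ) := Integrable.coeFn_toL1 _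
  have hb' : ⇑b =ᵐ[μ] fun x => (((f x).im : ℝ) : ℂ) := Integrable.coeFn_toL1 _
  have hab : f = a + Complex.I • b := by
    refine Lp.ext ?_
    filter_upwards [ha', hb', Lp.coeFn_add a (Complex.I • b), Lp.coeFn_smul Complex.I b]
      with x h1 h2 h3 h4
    rw [h3, Pi.add_apply, h4, Pi.smul_apply, h1, h2, smul_eq_mul, mul_comm]
    exact (Complex.re_add_im _).symm
  have hsa := hreal a (by filter_upwards [ha'] with x hx; simp [hx])
    (by
      filter_upwards [ha', hfg] with x h1 h2
      rw [h1, Complex.ofReal_re]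
      exact (Complex.abs_re_le_norm _).trans h2)
  have hsb := hreal b (by filter_upwards [hb'] with x hx; simp [hx])
    (by
      filter_upwards [hb', hfg] with x h1 h2
      rw [h1, Complex.ofReal_re]
      exact (Complex.abs_im_le_norm _).trans h2)
  rw [hab]
  simp only [map_add, map_smul]
  filter_upwards [hsa, hsb, Lp.coeFn_add (P a) (Complex.I • P b), Lp.coeFn_smul Complex.I (P b),
    Lp.coeFn_add (P (M a)) (Complex.I • P (M b)), Lp.coeFn_smul Complex.I (P (M b))]
    with x h1 h2 h3 h4 h5 h6
  rw [h3, h5, Pi.add_apply, Pi.add_apply, h4, h6, Pi.smul_apply, Pi.smul_apply, h1, h2,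
    smul_eq_mul, smul_eq_mul]
  ring

/-- Multiplication by a bounded measurable function, as an operator on `L¹`. -/
lemma exists_multiplication (μ : Measure X) {D : X → ℂ} (hDm : Measurable D) (hD : ∀ x, ‖D x‖ ≤ 1) :
    ∃ M : Lp ℂ 1 μ →L[ℂ] Lp ℂ 1 μ, ∀ f, ∀ᵐ x ∂μ, M f x = D x * f x := by
  have hi : ∀ f : Lp ℂ 1 μ, Integrable (fun x => D x * f x) μ := fun f =>
    (L1.integrable_coeFn f).bdd_mul hDm.aestronglyMeasurable (Eventually.of_forall hD)
  have hc : ∀ f : Lp ℂ 1 μ, ⇑((hi f).toL1 _) =ᵐ[μ] fun x => D x * f x := fun f =>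
    Integrable.coeFn_toL1 _
  refine ⟨LinearMap.mkContinuous
    { toFun := fun f => (hi f).toL1 _
      map_add' := fun f g => ?_
      map_smul' := fun c f => ?_ } 1 fun f => ?_, fun f => hc f⟩
  · refine Lp.ext ?_
    filter_upwards [hc (f + g), hc f, hc g, Lp.coeFn_add f g,
      Lp.coeFn_add ((hi f).toL1 _) ((hi g).toL1 _)] with x h1 h2 h3 h4 h5
    rw [h1, h5, Pi.add_apply, h2, h3, h4, Pi.add_apply, mul_add]
  · refine Lp.ext ?_
    filter_upwards [hc (c • f), hc f, Lp.coeFn_smul c f, Lp.coeFn_smul c ((hi f).toL1 _)]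
      with x h1 h2 h3 h4
    rw [h1, RingHom.id_apply, h4, Pi.smul_apply, h2, h3, Pi.smul_apply, smul_eq_mul, smul_eq_mul]
    ring
  · rw [one_mul, L1.norm_eq_integral_norm, L1.norm_eq_integral_norm]
    refine integral_mono_ae (L1.integrable_coeFn _).norm (L1.integrable_coeFn f).norm ?_
    filter_upwards [hc f] with x hx
    rw [LinearMap.coe_mk, AddHom.coe_mk, hx, norm_mul]
    exact mul_le_of_le_one_left (norm_nonneg _) (hD x)

/-- An eigenvector of `e^{-lτ} P`, `Re l ≥ 0`, with eigenvalue of modulus at least `1` forces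
`l = iη` by irreducibility, and then, by Wielandt's argument, the operator `e^{-ikητ} P` has an
eigenvalue of modulus one for all `k`: its powers do not tend to zero as `k → ∞`. -/
theorem eq_zero_of_peripheral_eigenvector {P : Lp ℂ 1 μ →L[ℂ] Lp ℂ 1 μ} (hP : IsPositiveOp P)
    (hPc : ∀ f, Nonneg f → ‖P f‖ ≤ ‖f‖) (hirr : IsIrreducibleOp P)
    {τ : X → ℝ} (hτ : ∀ᵐ x ∂μ, 0 < τ x)
    {B : ℂ → (Lp ℂ 1 μ →L[ℂ] Lp ℂ 1 μ)} (hB : ∀ l : ℂ, 0 ≤ l.re → ∀ f, ∀ᵐ x ∂μ,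
      B l f x = Complex.exp (-l * (τ x : ℂ)) * P f x)
    (hpow : ∃ ℓ : ℕ, Tendsto (fun η : ℝ => ‖B (η * Complex.I) ^ ℓ‖) (cocompact ℝ) (𝓝 0))
    {l : ℂ} (hl : 0 ≤ l.re) {φ : Lp ℂ 1 μ} (hφ0 : φ ≠ 0) {β : ℂ} (hβ : 1 ≤ ‖β‖)
    (hφ : B l φ = β • φ) : l = 0 := by
  have hexp : ∀ (z : ℂ) (t : ℝ), ‖Complex.exp (-z * (t : ℂ))‖ = Real.exp (-z.re * t) := by
    intro z t
    rw [Complex.norm_exp]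
    simp
  have he : ∀ᵐ x ∂μ, ‖Complex.exp (-l * (τ x : ℂ))‖ ≤ 1 := by
    filter_upwards [hτ] with x hx
    rw [hexp, Real.exp_le_one_iff]
    nlinarith
  obtain ⟨hPg, hmod⟩ := modulus_fixed_of_eigenvector hP hPc he (hB l hl) hβ hφ
  set g := modulus φ with hg
  have hg0 : Nonneg g := nonneg_modulus φ
  have hφae : ∀ᵐ x ∂μ, φ x ≠ 0 := by
    rcases eq_zero_or_ae_ne_zero_of_fixed hP hirr hg0 hPg with h | h
    · exact absurd (norm_modulus φ) (by rw [← hg, h, norm_zero]; exact (norm_pos_iff.2 hφ0).ne)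
    · filter_upwards [h, coeFn_modulus φ] with x h1 h2 h3
      rw [h2, h3] at h1
      simp at h1
  have hne : NeBot (ae μ) := by
    rw [ae_neBot]
    rintro rfl
    exact hφ0 (Lp.ext (by simp [EventuallyEq]))
  have hβ1 : ‖β‖ = 1 := by
    obtain ⟨x, h1, h2⟩ := (hmod.and hφae).exists
    exact mul_right_cancel₀ (norm_ne_zero_iff.2 h2) (h1.1.trans (one_mul _).symm)
  have hlre : l.re = 0 := by
    obtain ⟨x, h1, h2, h3⟩ := (hmod.and (hφae.and hτ)).exists
    have h4 := mul_right_cancel₀ (norm_ne_zero_iff.2 h2) (h1.2.trans (one_mul _).symm)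
    rw [hexp, Real.exp_eq_one_iff] at h4
    rcases mul_eq_zero.1 h4 with h5 | h5
    · linarith
    · exact absurd h5 h3.ne'
  by_contra hl0
  have him : l.im ≠ 0 := fun h => hl0 (Complex.ext hlre h)
  have hlI : l = (l.im : ℂ) * Complex.I := by
    refine Complex.ext ?_ ?_ <;> simp [hlre]
  have hφm : Measurable φ := (Lp.stronglyMeasurable φ).measurable
  -- `D` is the phase of `φ = D g`; the eigenvalue equation reads `P (D g) = s g` with `|s| = 1`
  set D : X → ℂ := fun x => φ x / (‖φ x‖ : ℂ) with hD
  have hDm : Measurable D := hφm.div (Complex.measurable_ofReal.comp hφm.norm)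
  have hD1 : ∀ x, ‖D x‖ ≤ 1 := by
    intro x
    rw [hD, norm_div, Complex.norm_real, norm_norm]
    exact div_self_le_one _
  have hD2 : ∀ᵐ x ∂μ, ‖D x‖ = 1 := by
    filter_upwards [hφae] with x hx
    rw [hD, norm_div, Complex.norm_real, norm_norm, div_self (norm_ne_zero_iff.2 hx)]
  obtain ⟨M, hM⟩ := exists_multiplication μ hDm hD1
  set s : X → ℂ := fun x => β * D x * Complex.exp (l * (τ x : ℂ)) with hs
  have hs1 : ∀ᵐ x ∂μ, ‖s x‖ = 1 := by
    filter_upwards [hD2] with x hx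
    have := hexp (-l) (τ x)
    rw [neg_neg] at this
    rw [hs, norm_mul, norm_mul, hβ1, hx, this]
    simp [hlre]
  have hMg : M g = φ := by
    refine Lp.ext ?_
    filter_upwards [hM g, coeFn_modulus φ, hφae] with x h1 h2 h3
    rw [h1, h2, hD, div_mul_cancel₀]
    exact_mod_cast norm_ne_zero_iff.2 h3
  have hPMg : ∀ᵐ x ∂μ, P (M g) x = s x * g x := by
    have h0 := hB l hl φ
    rw [hφ] at h0
    rw [hMg]
    filter_upwards [h0, Lp.coeFn_smul β φ, hM g] with x h1 h2 h3
    rw [h2, Pi.smul_apply, smul_eq_mul] at h1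
    rw [hMg] at h3
    have h4 : Complex.exp (l * (τ x : ℂ)) * Complex.exp (-l * (τ x : ℂ)) = 1 := by
      rw [← Complex.exp_add]
      simp
    calc P φ x = Complex.exp (l * (τ x : ℂ)) * (Complex.exp (-l * (τ x : ℂ)) * P φ x) := by
          rw [← mul_assoc, h4, one_mul]
      _ = s x * g x := by
          rw [← h1, h3, hs]
          ring
  -- rigidity gives `P (D ^ k g) = s ^ k g`, so that `D ^ k g` is an eigenvector for `k l`
  set ψ : ℕ → Lp ℂ 1 μ := fun k => (M ^ k) g with hψ
  have hψs : ∀ k, ψ (k + 1) = M (ψ k) := fun k => by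
    simp only [hψ, pow_succ', mul_apply_eq_comp]
  have hψc : ∀ k, ∀ᵐ x ∂μ, ψ k x = D x ^ k * g x := by
    intro k
    induction k with
    | zero => exact Eventually.of_forall fun x => by simp [hψ]
    | succ k ih =>
      rw [hψs]
      filter_upwards [hM (ψ k), ih] with x h1 h2
      rw [h1, h2]
      ring
  have hψn : ∀ k, ∀ᵐ x ∂μ, ‖ψ k x‖ = (g x).re := by
    intro k
    filter_upwards [hψc k, hD2, coeFn_modulus φ] with x h1 h2 h3
    rw [h1, norm_mul, norm_pow, h2, one_pow, one_mul, h3, Complex.norm_real, norm_norm,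
      Complex.ofReal_re]
  have hPψ : ∀ k, ∀ᵐ x ∂μ, P (ψ k) x = s x ^ k * g x := by
    intro k
    induction k with
    | zero =>
      have : ψ 0 = g := by simp [hψ]
      rw [this, hPg]
      exact Eventually.of_forall fun x => by simp
    | succ k ih =>
      rw [hψs]
      have h := map_mul_of_fixed hP hg0 hPg (Eventually.of_forall hD1) hs1
        (M := M.toLinearMap) hM hPMg ((hψn k).mono fun x hx => hx.le)
      filter_upwards [h, ih] with x h1 h2
      rw [h2] at h1
      refine h1.trans ?_
      ring
  have hnorm : ∀ k, ‖ψ k‖ = ‖φ‖ := by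
    intro k
    rw [← norm_modulus φ, ← hg, hg0.norm_eq_integral, L1.norm_eq_integral_norm]
    exact integral_congr_ae (hψn k)
  have heig : ∀ k : ℕ, B (((k * l.im : ℝ) : ℂ) * Complex.I) (ψ k) = β ^ k • ψ k := by
    intro k
    refine Lp.ext ?_
    filter_upwards [hB (((k * l.im : ℝ) : ℂ) * Complex.I) (by simp) (ψ k), hPψ k, hψc k,
      Lp.coeFn_smul (β ^ k) (ψ k)] with x h1 h2 h3 h4
    rw [h1, h2, h4, Pi.smul_apply, smul_eq_mul, h3, hs]
    have h5 : Complex.exp (-(((k * l.im : ℝ) : ℂ) * Complex.I) * (τ x : ℂ)) *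
        Complex.exp (l * (τ x : ℂ)) ^ k = 1 := by
      rw [← Complex.exp_nat_mul, ← Complex.exp_add]
      have : -(((k * l.im : ℝ) : ℂ) * Complex.I) * (τ x : ℂ) + k * (l * (τ x : ℂ)) = 0 := by
        conv_lhs => rw [hlI]
        push_cast
        simp
        ring
      rw [this, Complex.exp_zero]
    calc _ = (Complex.exp (-(((k * l.im : ℝ) : ℂ) * Complex.I) * (τ x : ℂ)) *
        Complex.exp (l * (τ x : ℂ)) ^ k) * (β ^ k * (D x ^ k * g x)) := by ring
      _ = _ := by rw [h5, one_mul]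
  obtain ⟨ℓ, hℓ⟩ := hpow
  have hge : ∀ k : ℕ, 1 ≤ ‖B (((k * l.im : ℝ) : ℂ) * Complex.I) ^ ℓ‖ := by
    intro k
    set T := B (((k * l.im : ℝ) : ℂ) * Complex.I) with hT
    have h1 : ∀ n : ℕ, (T ^ n) (ψ k) = (β ^ k) ^ n • ψ k := by
      intro n
      induction n with
      | zero => simp
      | succ n ih =>
        rw [pow_succ', mul_apply_eq_comp, ih, map_smul, heig k, smul_smul, pow_succ]
    have h2 := (T ^ ℓ).le_opNorm (ψ k)
    rw [h1, norm_smul, norm_pow, norm_pow, hβ1, one_pow, one_pow, one_mul] at h2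
    have h3 : 0 < ‖ψ k‖ := by
      rw [hnorm]
      exact norm_pos_iff.2 hφ0
    exact le_of_mul_le_mul_right (by rwa [one_mul]) h3
  have hseq : Tendsto (fun k : ℕ => (k * l.im : ℝ)) atTop (cocompact ℝ) := by
    rw [← Metric.cobounded_eq_cocompact, ← tendsto_norm_atTop_iff_cobounded]
    simp_rw [norm_mul]
    refine Tendsto.atTop_mul_const (norm_pos_iff.2 him) ?_
    simpa using tendsto_natCast_atTop_atTop (R := ℝ)
  have := ge_of_tendsto' (hℓ.comp hseq) hge
  linarith

/-- The abstract form of the result: with `P` a positive irreducible contraction of `L¹` whose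
square is weakly compact, the operators `e^{-lτ} P` have spectral radius less than `1` for
`l ≠ 0`, `Re l ≥ 0`, provided some power of `e^{-iητ} P` tends to zero as `|η| → ∞`. -/
theorem spectralRadius_lt_one [SigmaFinite μ] {P : Lp ℂ 1 μ →L[ℂ] Lp ℂ 1 μ}
    (hP : IsPositiveOp P) (hPc : ∀ f, Nonneg f → ‖P f‖ ≤ ‖f‖) (hirr : IsIrreducibleOp P)
    {K : Set (WeakSpace ℂ (Lp ℂ 1 μ))} (hK : IsCompact K)
    (hPK : ∀ f : Lp ℂ 1 μ, ‖f‖ ≤ 1 → toWeakSpace ℂ _ (P (P f)) ∈ K)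
    {τ : X → ℝ} (hτ : ∀ᵐ x ∂μ, 0 < τ x)
    {B : ℂ → (Lp ℂ 1 μ →L[ℂ] Lp ℂ 1 μ)} (hB : ∀ l : ℂ, 0 ≤ l.re → ∀ f, ∀ᵐ x ∂μ,
      B l f x = Complex.exp (-l * (τ x : ℂ)) * P f x)
    (hpow : ∃ ℓ : ℕ, Tendsto (fun η : ℝ => ‖B (η * Complex.I) ^ ℓ‖) (cocompact ℝ) (𝓝 0))
    {l : ℂ} (hl0 : l ≠ 0) (hl : 0 ≤ l.re) : spectralRadius ℂ (B l) < 1 := by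
  by_contra! hr
  have he : ∀ᵐ x ∂μ, ‖Complex.exp (-l * (τ x : ℂ))‖ ≤ 1 := by
    filter_upwards [hτ] with x hx
    rw [Complex.norm_exp, Real.exp_le_one_iff]
    simp only [neg_mul, Complex.neg_re, Complex.re_mul_ofReal, Left.neg_nonpos_iff]
    positivity
  have hdom : IsDominatedBy (B l) P := isDominatedBy_of_multiplier hP he (hB l hl)
  have hcomp := isCompactOperator_comp_self (hdom.comp hdom hP hP) (hP.comp hP) hK hPK
  obtain ⟨β, φ, hβ, hφ0, hφ⟩ := exists_eigenvector (B l) hcomp hr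
  exact hl0 (eq_zero_of_peripheral_eigenvector hP hPc hirr hτ hB hpow hl hφ0 hβ hφ)

end Peripheral

/-! ### First order properties of a `C¹` boundary -/

section Boundary

variable {d : ℕ}

lemma continuousAt_gradient {x : E d} {ρ : E d → ℝ} (h : ContDiffAt ℝ 1 ρ x) :
    ContinuousAt (gradient ρ) x :=
  (InnerProductSpace.toDual ℝ (E d)).symm.continuous.continuousAt.comp
    (h.continuousAt_fderiv one_ne_zero)

lemma IsLocalDefining.eventually {Ω : Set (E d)} {x : E d} {ρ : E d → ℝ}
    (h : IsLocalDefining Ω x ρ) : ∀ᶠ y in 𝓝 x, IsLocalDefining Ω y ρ := by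
  filter_upwards [h.contDiffAt.eventually (by simp),
    (continuousAt_gradient h.contDiffAt).eventually_ne h.gradient_ne_zero,
    h.mem_iff.eventually_nhds] with y h1 h2 h3
  exact ⟨h1, h2, h3⟩

lemma continuousOn_outwardNormal {Ω : Set (E d)} (hΩ : IsOpen Ω) (hC : HasC1Boundary Ω) :
    ContinuousOn (outwardNormal Ω) (frontier Ω) := by
  intro x hx
  obtain ⟨ρ, hρ⟩ := hC x hx
  have hg := continuousAt_gradient hρ.contDiffAt
  have h1 : ContinuousAt (fun y => ‖gradient ρ y‖⁻¹ • gradient ρ y) x :=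
    (hg.norm.inv₀ (norm_ne_zero_iff.2 hρ.gradient_ne_zero)).smul hg
  refine h1.continuousWithinAt.congr_of_eventuallyEq ?_ (outwardNormal_eq hΩ hx hρ)
  filter_upwards [nhdsWithin_le_nhds hρ.eventually, self_mem_nhdsWithin] with y h2 h3
  exact outwardNormal_eq hΩ h3 h2

lemma norm_outwardNormal {Ω : Set (E d)} (hΩ : IsOpen Ω) (hC : HasC1Boundary Ω) {x : E d}
    (hx : x ∈ frontier Ω) : ‖outwardNormal Ω x‖ = 1 := by
  obtain ⟨ρ, hρ⟩ := hC x hx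
  rw [outwardNormal_eq hΩ hx hρ, norm_smul, norm_inv, norm_norm,
    inv_mul_cancel₀ (norm_ne_zero_iff.2 hρ.gradient_ne_zero)]

lemma measurable_outwardNormal {Ω : Set (E d)} (hΩ : IsOpen Ω) (hC : HasC1Boundary Ω) :
    Measurable (outwardNormal Ω) := by
  classical
  have h1 : outwardNormal Ω = (frontier Ω).piecewise (outwardNormal Ω) 0 := by
    ext1 x
    by_cases hx : x ∈ frontier Ω
    · rw [piecewise_eq_of_mem _ _ _ hx]
    · rw [piecewise_eq_of_notMem _ _ _ hx, outwardNormal, dif_neg fun h => hx h.1]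
      rfl
  rw [h1]
  exact (continuousOn_outwardNormal hΩ hC).measurable_piecewise continuousOn_const
    isClosed_frontier.measurableSet

/-- Near a boundary point, chords of the boundary are almost orthogonal to the normal. -/
lemma eventually_inner_normal_le {Ω : Set (E d)} (hΩ : IsOpen Ω) (hC : HasC1Boundary Ω) {x₀ : E d}
    (hx₀ : x₀ ∈ frontier Ω) {ε : ℝ} (hε : 0 < ε) :
    ∃ U ∈ 𝓝 x₀, ∀ x ∈ U ∩ frontier Ω, ∀ y ∈ U ∩ frontier Ω,
      |⟪outwardNormal Ω x₀, x - y⟫_ℝ| ≤ ε * ‖x - y‖ := by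
  obtain ⟨ρ, hρ⟩ := hC x₀ hx₀
  have hg0 : 0 < ‖gradient ρ x₀‖ := norm_pos_iff.2 hρ.gradient_ne_zero
  have h1 : HasStrictFDerivAt ρ (InnerProductSpace.toDual ℝ (E d) (gradient ρ x₀)) x₀ :=
    hρ.contDiffAt.hasStrictFDerivAt'
      (hρ.contDiffAt.differentiableAt one_ne_zero).hasGradientAt.hasFDerivAt one_ne_zero
  have h2 := h1.isLittleO.def (mul_pos hε hg0)
  rw [nhds_prod_eq, Filter.eventually_prod_self_iff'] at h2
  obtain ⟨V, hV, hVs⟩ := h2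
  refine ⟨V ∩ {y | IsLocalDefining Ω y ρ}, inter_mem hV hρ.eventually, ?_⟩
  rintro x ⟨⟨hx1, hx2⟩, hx3⟩ y ⟨⟨hy1, hy2⟩, hy3⟩
  have h3 := hVs _ hx1 _ hy1
  simp only [hx2.eq_zero hx3 hΩ, hy2.eq_zero hy3 hΩ, sub_self, zero_sub, norm_neg,
    InnerProductSpace.toDual_apply_apply] at h3
  rw [outwardNormal_eq hΩ hx₀ hρ, real_inner_smul_left, abs_mul, abs_inv, abs_norm,
    inv_mul_le_iff₀ hg0]
  rw [Real.norm_eq_abs] at h3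
  linarith

lemma eventually_mem_of_inner_neg {Ω : Set (E d)} (hΩ : IsOpen Ω) (hC : HasC1Boundary Ω)
    {x w : E d} (hx : x ∈ frontier Ω) (hw : ⟪w, outwardNormal Ω x⟫_ℝ < 0) :
    ∀ᶠ s : ℝ in 𝓝[>] 0, x + s • w ∈ Ω := by
  obtain ⟨ρ, hρ⟩ := hC x hx
  have hg0 : 0 < ‖gradient ρ x‖ := norm_pos_iff.2 hρ.gradient_ne_zero
  rw [outwardNormal_eq hΩ hx hρ, real_inner_smul_right, real_inner_comm,
    inv_mul_lt_iff₀ hg0, mul_zero] at hw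
  have hline : Tendsto (fun t : ℝ => x + t • w) (𝓝[>] 0) (𝓝 x) := by
    have : Continuous (fun t : ℝ => x + t • w) := by fun_prop
    have h0 := this.tendsto 0
    simp only [zero_smul, add_zero] at h0
    exact h0.mono_left nhdsWithin_le_nhds
  have s1 := (hasDerivAt_iff_tendsto_slope.1 (hρ.hasDerivAt_line w)).mono_left
    (nhdsWithin_mono 0 (fun t (ht : (0 : ℝ) < t) => ht.ne'))
  filter_upwards [s1.eventually (gt_mem_nhds hw), hline.eventually hρ.mem_iff,
    eventually_mem_nhdsWithin] with t g1 g2 g3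
  refine g2.2 ?_
  simp only [slope_def_field, zero_smul, add_zero, sub_zero, hρ.eq_zero hx hΩ] at g1
  have := (div_lt_iff₀ (show (0 : ℝ) < t from g3)).1 g1
  linarith

lemma eventually_notMem_of_inner_pos {Ω : Set (E d)} (hΩ : IsOpen Ω) (hC : HasC1Boundary Ω)
    {x w : E d} (hx : x ∈ frontier Ω) (hw : 0 < ⟪w, outwardNormal Ω x⟫_ℝ) :
    ∀ᶠ s : ℝ in 𝓝[>] 0, x + s • w ∉ Ω := by
  obtain ⟨ρ, hρ⟩ := hC x hx
  have hg0 : 0 < ‖gradient ρ x‖ := norm_pos_iff.2 hρ.gradient_ne_zero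
  rw [outwardNormal_eq hΩ hx hρ, real_inner_smul_right, real_inner_comm,
    lt_inv_mul_iff₀ hg0, mul_zero] at hw
  have hline : Tendsto (fun t : ℝ => x + t • w) (𝓝[>] 0) (𝓝 x) := by
    have : Continuous (fun t : ℝ => x + t • w) := by fun_prop
    have h0 := this.tendsto 0
    simp only [zero_smul, add_zero] at h0
    exact h0.mono_left nhdsWithin_le_nhds
  have s1 := (hasDerivAt_iff_tendsto_slope.1 (hρ.hasDerivAt_line w)).mono_left
    (nhdsWithin_mono 0 (fun t (ht : (0 : ℝ) < t) => ht.ne'))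
  filter_upwards [s1.eventually (lt_mem_nhds hw), hline.eventually hρ.mem_iff,
    eventually_mem_nhdsWithin] with t g1 g2 g3 g4
  simp only [slope_def_field, zero_smul, add_zero, sub_zero, hρ.eq_zero hx hΩ] at g1
  have := (lt_div_iff₀ (show (0 : ℝ) < t from g3)).1 g1
  have := g2.1 g4
  linarith

end Boundary

/-! ### Projections along a direction -/

section Projection

variable {d : ℕ}

/-- The model `ℝᵈ⁻¹` of the hyperplanes of `ℝᵈ`. -/
abbrev Hyp (d : ℕ) : Type := EuclideanSpace ℝ (Fin (d - 1))

/-- `J` identifies `ℝᵈ⁻¹` with the hyperplane orthogonal to the unit vector `e`, and `P` is the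
orthogonal projection onto this hyperplane read in `ℝᵈ⁻¹`. -/
structure IsHyperplaneProj (e : E d) (J : Hyp d →ₗᵢ[ℝ] E d) (P : E d →L[ℝ] Hyp d) : Prop where
  norm_eq : ‖e‖ = 1
  inner_eq : ∀ x y, ⟪P x, y⟫_ℝ = ⟪x, J y⟫_ℝ
  apply_eq : ∀ x, J (P x) = x - ⟪e, x⟫_ℝ • e

lemma exists_isHyperplaneProj {e : E d} (he : ‖e‖ = 1) : ∃ J P, IsHyperplaneProj e J P := by
  have he0 : e ≠ 0 := by
    rintro rfl
    simp at he
  set V : Submodule ℝ (E d) := (ℝ ∙ e)ᗮ with hV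
  have hfr : Module.finrank ℝ V = d - 1 := by
    have h1 := Submodule.finrank_add_finrank_orthogonal (ℝ ∙ e)
    rw [finrank_span_singleton he0, finrank_euclideanSpace_fin] at h1
    rw [hV]
    omega
  let I : Hyp d ≃ₗᵢ[ℝ] V := ((stdOrthonormalBasis ℝ V).reindex (finCongr hfr)).repr.symm
  let J : Hyp d →ₗᵢ[ℝ] E d := V.subtypeₗᵢ.comp I.toLinearIsometry
  refine ⟨J, J.toContinuousLinearMap.adjoint, he, fun x y => ?_, fun x => ?_⟩
  · rw [ContinuousLinearMap.adjoint_inner_left]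
    rfl
  · set z := x - ⟪e, x⟫_ℝ • e with hz
    have hzV : z ∈ V := by
      rw [hV, Submodule.mem_orthogonal_singleton_iff_inner_right, hz, inner_sub_right,
        real_inner_smul_right, real_inner_self_eq_norm_sq, he]
      ring
    have hJz : J (I.symm ⟨z, hzV⟩) = z := by simp [J]
    have h1 : J.toContinuousLinearMap.adjoint x = I.symm ⟨z, hzV⟩ := by
      refine ext_inner_right ℝ fun y => ?_
      rw [ContinuousLinearMap.adjoint_inner_left, ← J.inner_map_map, hJz, hz, inner_sub_left,
        real_inner_smul_left]
      have h2 : ⟪e, J y⟫_ℝ = 0 :=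
        (Submodule.mem_orthogonal_singleton_iff_inner_right).1 (I y).2
      rw [h2, mul_zero, sub_zero]
      rfl
    rw [h1, hJz]

namespace IsHyperplaneProj

variable {e : E d} {J : Hyp d →ₗᵢ[ℝ] E d} {P : E d →L[ℝ] Hyp d}

lemma apply_self (h : IsHyperplaneProj e J P) : P e = 0 := by
  have h1 := h.apply_eq e
  rw [real_inner_self_eq_norm_sq, h.norm_eq, one_pow, one_smul, sub_self] at h1
  exact J.injective (h1.trans J.map_zero.symm)

lemma norm_sq (h : IsHyperplaneProj e J P) (x : E d) :
    ‖P x‖ ^ 2 = ‖x‖ ^ 2 - ⟪e, x⟫_ℝ ^ 2 := by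
  rw [← J.norm_map, h.apply_eq, norm_sub_sq_real, norm_smul, h.norm_eq, real_inner_smul_right,
    real_inner_comm, Real.norm_eq_abs, mul_one, sq_abs]
  ring

lemma norm_le (h : IsHyperplaneProj e J P) (x : E d) : ‖P x‖ ≤ ‖x‖ := by
  rw [← sq_le_sq₀ (norm_nonneg _) (norm_nonneg _), h.norm_sq]
  nlinarith [sq_nonneg ⟪e, x⟫_ℝ]

lemma norm_sub_le (h : IsHyperplaneProj e J P) (x : E d) : ‖x - J (P x)‖ = |⟪e, x⟫_ℝ| := by
  rw [h.apply_eq, sub_sub_cancel, norm_smul, h.norm_eq, mul_one, Real.norm_eq_abs]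

/-- The projection between two hyperplanes has determinant the cosine of the angle between them:
`Lᵀ L = 1 - w wᵀ` with `w` the component of `e` orthogonal to `n`, so that
`det L ^ 2 = 1 - |w| ^ 2`. -/
lemma abs_det_comp (h : IsHyperplaneProj e J P) {n : E d} {J' : Hyp d →ₗᵢ[ℝ] E d}
    {P' : E d →L[ℝ] Hyp d} (h' : IsHyperplaneProj n J' P') :
    |(P ∘L J'.toContinuousLinearMap).det| = |⟪e, n⟫_ℝ| := by
  set L := P ∘L J'.toContinuousLinearMap with hL
  set w := P' e with hw
  have h1 : L.adjoint ∘L L = (LinearMap.transvection (innerₛₗ ℝ w) (-w)).toContinuousLinearMap := by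
    refine ContinuousLinearMap.ext fun y => ext_inner_right ℝ fun z => ?_
    rw [ContinuousLinearMap.comp_apply, ContinuousLinearMap.adjoint_inner_left,
      LinearMap.coe_toContinuousLinearMap', LinearMap.transvection.apply]
    simp only [hL, ContinuousLinearMap.comp_apply, LinearIsometry.coe_toContinuousLinearMap,
      innerₛₗ_apply_apply]
    rw [h.inner_eq, h.apply_eq, inner_sub_right, J'.inner_map_map, real_inner_smul_right,
      inner_add_left, real_inner_smul_left, inner_neg_left, hw, h'.inner_eq, h'.inner_eq,
      real_inner_comm e (J' y)]
    ring
  have h2 : L.toLinearMap.normDet ^ 2 = (L.adjoint ∘L L).det := by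
    have := L.normDet_sq
    simpa using this
  have h3 : (L.adjoint ∘L L).det = ⟪e, n⟫_ℝ ^ 2 := by
    rw [h1, ContinuousLinearMap.det, LinearMap.coe_toContinuousLinearMap,
      LinearMap.transvection.det,
      innerₛₗ_apply_apply, inner_neg_right, real_inner_self_eq_norm_sq, hw, h'.norm_sq, h.norm_eq,
      real_inner_comm]
    ring
  rw [h3, LinearMap.normDet_eq_abs_det] at h2
  rw [ContinuousLinearMap.det]
  rw [← sq_abs ⟪e, n⟫_ℝ] at h2
  exact (pow_left_inj₀ (abs_nonneg _) (abs_nonneg _) two_ne_zero).1 h2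

end IsHyperplaneProj

end Projection

/-! ### Area of projections of the boundary -/

section Area

variable {d : ℕ}

open scoped NNReal

lemma euclideanHausdorffMeasure_image_le {X Y : Type*} [EMetricSpace X] [MeasurableSpace X]
    [BorelSpace X] [EMetricSpace Y] [MeasurableSpace Y] [BorelSpace Y] {K : ℝ≥0} {f : X → Y}
    {s : Set X} (h : LipschitzOnWith K f s) (k : ℕ) :
    (μHE[k] : Measure Y) (f '' s) ≤ (K : ℝ≥0∞) ^ k * (μHE[k] : Measure X) s := by
  simp only [Measure.euclideanHausdorffMeasure_def, Measure.smul_apply]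
  have h1 := h.hausdorffMeasure_image_le (d := k) (Nat.cast_nonneg k)
  rw [ENNReal.rpow_natCast] at h1
  rw [ENNReal.smul_def, ENNReal.smul_def, smul_eq_mul, smul_eq_mul, mul_left_comm]
  gcongr

/-- A set whose chords are almost orthogonal to `n` is the graph of a Lipschitz function over the
hyperplane orthogonal to `n`. -/
lemma norm_sub_le_of_flat {n : E d} {J : Hyp d →ₗᵢ[ℝ] E d} {P : E d →L[ℝ] Hyp d}
    (h : IsHyperplaneProj n J P) {ε : ℝ} (hε : ε < 1) {x y : E d}
    (hxy : |⟪n, x - y⟫_ℝ| ≤ ε * ‖x - y‖) : ‖x - y‖ ≤ (1 - ε)⁻¹ * ‖P x - P y‖ := by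
  rw [le_inv_mul_iff₀ (by linarith), ← map_sub, ← J.norm_map]
  have h1 : ‖x - y‖ ≤ ‖(x - y) - J (P (x - y))‖ + ‖J (P (x - y))‖ := by
    simpa using norm_add_le ((x - y) - J (P (x - y))) (J (P (x - y)))
  rw [h.norm_sub_le] at h1
  linarith

/-- A graph over the hyperplane orthogonal to `n` with small chords in the direction of `n`:
comparison of its area with the area of its projection along another direction `e`. -/
lemma area_of_flat {e n : E d} {J J' : Hyp d →ₗᵢ[ℝ] E d} {P P' : E d →L[ℝ] Hyp d}
    (h : IsHyperplaneProj e J P) (h' : IsHyperplaneProj n J' P') {ε : ℝ} (hε0 : 0 < ε)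
    (hε1 : ε < 1) {A : Set (E d)}
    (hA : ∀ x ∈ A, ∀ y ∈ A, |⟪n, x - y⟫_ℝ| ≤ ε * ‖x - y‖) :
    volume (P' '' A) ≤ μHE[d - 1] A ∧
    μHE[d - 1] A ≤ ENNReal.ofReal (1 - ε)⁻¹ ^ (d - 1) * volume (P' '' A) ∧
    ∃ φ : Hyp d → Hyp d, φ '' (P' '' A) = P '' A ∧
      ApproximatesLinearOn φ (P ∘L J'.toContinuousLinearMap) (P' '' A)
        (ε * (1 - ε)⁻¹).toNNReal := by
  have hK : 0 ≤ (1 - ε)⁻¹ := inv_nonneg.2 (by linarith)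
  set R : Hyp d → E d := Function.invFunOn P' A with hR
  have hinj : InjOn P' A := by
    intro x hx y hy hxy
    have h1 := norm_sub_le_of_flat h' hε1 (hA x hx y hy)
    rw [hxy, sub_self, norm_zero, mul_zero] at h1
    exact sub_eq_zero.1 (norm_le_zero_iff.1 h1)
  have hRA : ∀ q ∈ P' '' A, R q ∈ A ∧ P' (R q) = q := fun q hq => Function.invFunOn_pos hq
  have hRim : R '' (P' '' A) = A := by
    rw [image_image]
    refine (image_congr fun x hx => hinj.leftInvOn_invFunOn hx).trans (image_id' A)
  have hRlip : LipschitzOnWith (1 - ε)⁻¹.toNNReal R (P' '' A) := by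
    refine LipschitzOnWith.of_dist_le_mul fun q hq q' hq' => ?_
    rw [dist_eq_norm, dist_eq_norm, Real.coe_toNNReal _ hK]
    have h1 := norm_sub_le_of_flat h' hε1 (hA _ (hRA q hq).1 _ (hRA q' hq').1)
    rwa [(hRA q hq).2, (hRA q' hq').2] at h1
  have hvol : (μHE[d - 1] : Measure (Hyp d)) = volume :=
    EuclideanSpace.euclideanHausdorffMeasure_eq_volume (d - 1)
  refine ⟨?_, ?_, fun q => P (R q), ?_, ?_⟩
  · have h1 : LipschitzOnWith 1 P' A := by
      refine LipschitzOnWith.of_dist_le_mul fun x _ y _ => ?_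
      rw [dist_eq_norm, dist_eq_norm, ← map_sub, NNReal.coe_one, one_mul]
      exact h'.norm_le _
    have h2 := euclideanHausdorffMeasure_image_le h1 (d - 1)
    rw [hvol] at h2
    simpa using h2
  · have h2 := euclideanHausdorffMeasure_image_le hRlip (d - 1)
    rw [hvol, hRim] at h2
    exact h2
  · conv_rhs => rw [← hRim]
    exact (image_image P R (P' '' A)).symm
  · intro q hq q' hq'
    have h1 : P (R q) - P (R q') - (P ∘L J'.toContinuousLinearMap) (q - q') =
        P ((R q - R q') - J' (P' (R q - R q'))) := by
      rw [map_sub P', (hRA q hq).2, (hRA q' hq').2]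
      simp only [map_sub, ContinuousLinearMap.comp_apply,
        LinearIsometry.coe_toContinuousLinearMap]
    rw [h1, Real.coe_toNNReal _ (by positivity)]
    refine (h.norm_le _).trans ?_
    rw [h'.norm_sub_le]
    refine (hA _ (hRA q hq).1 _ (hRA q' hq').1).trans ?_
    have h2 := norm_sub_le_of_flat h' hε1 (hA _ (hRA q hq).1 _ (hRA q' hq').1)
    rw [(hRA q hq).2, (hRA q' hq').2] at h2
    rw [mul_assoc]
    gcongr

variable {Ω : Set (E d)}

/-- Local comparison of the surface measure with the area of the projection along `e`: up to an
arbitrarily small error, the ratio is the cosine `|e · n|`. -/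
lemma exists_nhds_area (hΩ : IsOpen Ω) (hC : HasC1Boundary Ω) {x₀ : E d} (hx₀ : x₀ ∈ frontier Ω)
    {e : E d} {J : Hyp d →ₗᵢ[ℝ] E d} {P : E d →L[ℝ] Hyp d} (h : IsHyperplaneProj e J P) {κ : ℝ}
    (hκ : 0 < κ) : ∃ U ∈ 𝓝 x₀, ∀ A ⊆ U ∩ frontier Ω,
      volume (P '' A) ≤ ENNReal.ofReal (|⟪e, outwardNormal Ω x₀⟫_ℝ| + κ) * μHE[d - 1] A ∧
      ENNReal.ofReal (|⟪e, outwardNormal Ω x₀⟫_ℝ| - κ) * μHE[d - 1] A ≤ volume (P '' A) := by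
  set n := outwardNormal Ω x₀ with hn
  obtain ⟨J', P', h'⟩ := exists_isHyperplaneProj (norm_outwardNormal hΩ hC hx₀)
  set c := |⟪e, n⟫_ℝ| with hc
  have hc0 : 0 ≤ c := abs_nonneg _
  have hc1 : c ≤ 1 := by
    have := abs_real_inner_le_norm e n
    rwa [h.norm_eq, h'.norm_eq, one_mul] at this
  set L := P ∘L J'.toContinuousLinearMap with hL
  have hdet : |L.det| = c := h.abs_det_comp h'
  have e1 := addHaar_image_le_mul_of_det_lt (volume : Measure (Hyp d)) L
    (m := (c + κ).toNNReal) (by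
      rw [hdet]
      exact (ENNReal.ofReal_lt_ofReal_iff (by linarith)).2 (by linarith))
  have e2 : ∀ᶠ δ in 𝓝[>] (0 : ℝ≥0), ∀ (s : Set (Hyp d)) (f : Hyp d → Hyp d),
      ApproximatesLinearOn f L s δ → κ < c →
        ((c - κ / 2).toNNReal : ℝ≥0∞) * volume s ≤ volume (f '' s) := by
    by_cases hκc : κ < c
    · filter_upwards [mul_le_addHaar_image_of_lt_det (volume : Measure (Hyp d)) L
        (m := (c - κ / 2).toNNReal) (by
          rw [hdet]
          exact (ENNReal.ofReal_lt_ofReal_iff (by linarith)).2 (by linarith))] with δ hδ s f hf _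
      exact hδ s f hf
    · exact Eventually.of_forall fun _ _ _ _ h => absurd h hκc
  obtain ⟨δ, ⟨hδ1, hδ2⟩, hδ0⟩ := ((e1.and e2).and eventually_mem_nhdsWithin).exists
  have hδ0' : (0 : ℝ) < δ := by exact_mod_cast (show (0 : ℝ≥0) < δ from hδ0)
  -- the flatness `ε` has to keep the linearisation error of `area_of_flat` below `δ`, and the ratio
  -- of the area to the area of the projection along the normal close to one
  have hε : ∃ ε : ℝ, 0 < ε ∧ ε < 1 ∧ ε * (1 - ε)⁻¹ ≤ δ ∧ (1 - ε)⁻¹ ^ (d - 1) ≤ 1 + κ / 2 := by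
    have c1 : ContinuousAt (fun ε : ℝ => (1 - ε)⁻¹) 0 :=
      (continuousAt_const.sub continuousAt_id).inv₀ (by simp)
    have t1 : Tendsto (fun ε : ℝ => ε * (1 - ε)⁻¹) (𝓝 0) (𝓝 0) := by
      have := tendsto_id.mul c1.tendsto
      rwa [sub_zero, inv_one, mul_one] at this
    have t2 : Tendsto (fun ε : ℝ => (1 - ε)⁻¹ ^ (d - 1)) (𝓝 0) (𝓝 1) := by
      have := c1.tendsto.pow (d - 1)
      rwa [sub_zero, inv_one, one_pow] at this
    have ev := (((t1.eventually (gt_mem_nhds hδ0')).and (t2.eventually (gt_mem_nhds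
      (show (1 : ℝ) < 1 + κ / 2 by linarith)))).and
      (gt_mem_nhds (show (0 : ℝ) < 1 by norm_num))).filter_mono
      (nhdsWithin_le_nhds (s := Ioi (0 : ℝ)))
    obtain ⟨ε, ⟨⟨h1, h2⟩, h3⟩, h4⟩ := (ev.and eventually_mem_nhdsWithin).exists
    exact ⟨ε, h4, h3, h1.le, h2.le⟩
  obtain ⟨ε, hε0, hε1, hεδ, hεκ⟩ := hε
  obtain ⟨U, hU, hflat⟩ := eventually_inner_normal_le hΩ hC hx₀ hε0
  refine ⟨U, hU, fun A hA => ?_⟩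
  obtain ⟨a1, a2, φ, hφ, hφL⟩ := area_of_flat h h' hε0 hε1 (A := A)
    (fun x hx y hy => hflat x (hA hx) y (hA hy))
  have hφδ : ApproximatesLinearOn φ L (P' '' A) δ :=
    hφL.mono_num (by rw [Real.toNNReal_le_iff_le_coe]; exact hεδ)
  refine ⟨?_, ?_⟩
  · rw [← hφ]
    exact (hδ1 _ _ hφδ).trans (mul_le_mul_right a1 _)
  · by_cases hκc : κ < c
    · rw [← hφ]
      refine le_trans ?_ (hδ2 _ _ hφδ hκc)
      refine (mul_le_mul_right a2 _).trans ?_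
      rw [← mul_assoc]
      gcongr
      rw [← ENNReal.ofReal_pow (inv_nonneg.2 (by linarith)), ← ENNReal.ofReal_mul (by linarith)]
      refine ENNReal.ofReal_le_ofReal ?_
      calc (c - κ) * (1 - ε)⁻¹ ^ (d - 1) ≤ (c - κ) * (1 + κ / 2) := by
            gcongr
        _ ≤ c - κ / 2 := by nlinarith
    · rw [ENNReal.ofReal_of_nonpos (by linarith), zero_mul]
      exact zero_le

/-- The boundary has finite area. -/
lemma measure_frontier_lt_top (hΩ : IsOpen Ω) (hC : HasC1Boundary Ω)
    (hb : Bornology.IsBounded Ω) : (μHE[d - 1] : Measure (E d)) (frontier Ω) < ∞ := by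
  have hbf : Bornology.IsBounded (frontier Ω) := hb.closure.subset frontier_subset_closure
  have hcpt : IsCompact (frontier Ω) := Metric.isCompact_of_isClosed_isBounded isClosed_frontier hbf
  refine hcpt.measure_lt_top_of_nhdsWithin fun x₀ hx₀ => ?_
  obtain ⟨J, P, h⟩ := exists_isHyperplaneProj (norm_outwardNormal hΩ hC hx₀)
  obtain ⟨U, hU, hflat⟩ := eventually_inner_normal_le hΩ hC hx₀ (ε := 1 / 2) (by norm_num)
  obtain ⟨-, a2, -⟩ := area_of_flat h h (by norm_num) (by norm_num) (A := U ∩ frontier Ω) hflat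
  refine ⟨U ∩ frontier Ω, inter_mem (nhdsWithin_le_nhds hU) self_mem_nhdsWithin, ?_⟩
  refine a2.trans_lt (ENNReal.mul_lt_top (by finiteness) ?_)
  exact (P.lipschitz.isBounded_image (hbf.subset inter_subset_right)).measure_lt_top

/-- A set every point of which has a neighbourhood with a hereditary property is contained in a
countable union of disjoint measurable sets with this property. -/
lemma exists_measurable_partition {Z : Type*} [TopologicalSpace Z] [SecondCountableTopology Z]
    [MeasurableSpace Z] [OpensMeasurableSpace Z] {S : Set Z} {p : Set Z → Prop}
    (hp : ∀ s t, s ⊆ t → p t → p s) (hp0 : p ∅) (h : ∀ x ∈ S, ∃ U ∈ 𝓝 x, p (U ∩ S)) :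
    ∃ V : ℕ → Set Z, (∀ i, MeasurableSet (V i)) ∧ Pairwise (Function.onFun Disjoint V) ∧
      S ⊆ ⋃ i, V i ∧ ∀ i, p (V i ∩ S) := by
  choose! U hU hpU using h
  obtain ⟨t, htS, htc, hSt⟩ := TopologicalSpace.countable_cover_nhdsWithin
    (f := fun x => interior (U x)) (s := S)
    fun x hx => nhdsWithin_le_nhds (interior_mem_nhds.2 (hU x hx))
  rcases t.eq_empty_or_nonempty with rfl | hne
  · refine ⟨fun _ => ∅, fun _ => MeasurableSet.empty, fun i j _ => disjoint_bot_left, ?_,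
      fun _ => by simpa using hp0⟩
    simpa using hSt
  obtain ⟨f, hf⟩ := htc.exists_eq_range hne
  set W : ℕ → Set Z := fun i => interior (U (f i)) with hW
  refine ⟨disjointed W,
    fun i => MeasurableSet.disjointed (fun j => isOpen_interior.measurableSet) i,
    disjoint_disjointed W, ?_, fun i => ?_⟩
  · rw [iUnion_disjointed]
    refine hSt.trans ?_
    rw [hf, biUnion_range]
  · have hfi : f i ∈ S := htS (hf ▸ mem_range_self i)
    exact hp _ _ (inter_subset_inter_left S ((disjointed_subset W i).trans interior_subset))
      (hpU _ hfi)

/-- Partition of the boundary into pieces where the comparison of areas holds up to `κ`. -/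
lemma exists_area_partition (hΩ : IsOpen Ω) (hC : HasC1Boundary Ω) {e : E d}
    {J : Hyp d →ₗᵢ[ℝ] E d} {P : E d →L[ℝ] Hyp d} (h : IsHyperplaneProj e J P) {κ : ℝ}
    (hκ : 0 < κ) : ∃ V : ℕ → Set (E d), (∀ i, MeasurableSet (V i)) ∧
      Pairwise (Function.onFun Disjoint V) ∧ frontier Ω ⊆ ⋃ i, V i ∧
      ∀ i, ∀ A ⊆ V i ∩ frontier Ω, MeasurableSet A →
        volume (P '' A) ≤ ∫⁻ x in A, ENNReal.ofReal |⟪e, outwardNormal Ω x⟫_ℝ| ∂μHE[d - 1] +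
            ENNReal.ofReal κ * μHE[d - 1] A ∧
        ∫⁻ x in A, ENNReal.ofReal |⟪e, outwardNormal Ω x⟫_ℝ| ∂μHE[d - 1] ≤
          volume (P '' A) + ENNReal.ofReal κ * μHE[d - 1] A := by
  have hwm : Measurable fun x => ENNReal.ofReal |⟪e, outwardNormal Ω x⟫_ℝ| := by
    have := measurable_outwardNormal hΩ hC
    fun_prop
  refine exists_measurable_partition (p := fun s => ∀ A ⊆ s, MeasurableSet A →
        volume (P '' A) ≤ ∫⁻ x in A, ENNReal.ofReal |⟪e, outwardNormal Ω x⟫_ℝ| ∂μHE[d - 1] +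
            ENNReal.ofReal κ * μHE[d - 1] A ∧
        ∫⁻ x in A, ENNReal.ofReal |⟪e, outwardNormal Ω x⟫_ℝ| ∂μHE[d - 1] ≤
          volume (P '' A) + ENNReal.ofReal κ * μHE[d - 1] A)
    (fun s t hst ht A hA => ht A (hA.trans hst)) (fun A hA _ => ?_) (fun x₀ hx₀ => ?_)
  · rw [subset_empty_iff.1 hA]
    simp
  · obtain ⟨U, hU, hUA⟩ := exists_nhds_area hΩ hC hx₀ h (half_pos hκ)
    have hcont : ContinuousWithinAt (fun x => |⟪e, outwardNormal Ω x⟫_ℝ|) (frontier Ω) x₀ :=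
      (continuousWithinAt_const.inner (continuousOn_outwardNormal hΩ hC x₀ hx₀)).abs
    have hev : ∀ᶠ x in 𝓝[frontier Ω] x₀, |⟪e, outwardNormal Ω x⟫_ℝ| ∈
        Metric.ball |⟪e, outwardNormal Ω x₀⟫_ℝ| (κ / 2) :=
      hcont.eventually (Metric.ball_mem_nhds _ (half_pos hκ))
    obtain ⟨U', hU', hU's⟩ := mem_nhdsWithin_iff_exists_mem_nhds_inter.1 hev
    refine ⟨U ∩ U', inter_mem hU hU', fun A hA hAm => ?_⟩
    set c := |⟪e, outwardNormal Ω x₀⟫_ℝ| with hc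
    have hc0 : 0 ≤ c := abs_nonneg _
    obtain ⟨a1, a2⟩ := hUA A (hA.trans (inter_subset_inter_left _ inter_subset_left))
    have hcl : ∀ x ∈ A, |(|⟪e, outwardNormal Ω x⟫_ℝ| - c)| < κ / 2 := fun x hx =>
      hU's ⟨(hA hx).1.2, (hA hx).2⟩
    refine ⟨a1.trans ?_, ?_⟩
    · calc ENNReal.ofReal (c + κ / 2) * μHE[d - 1] A
          = ∫⁻ _ in A, ENNReal.ofReal (c + κ / 2) ∂μHE[d - 1] := (setLIntegral_const _ _).symm
        _ ≤ ∫⁻ x in A, (ENNReal.ofReal |⟪e, outwardNormal Ω x⟫_ℝ| + ENNReal.ofReal κ)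
              ∂μHE[d - 1] := by
            refine setLIntegral_mono' hAm fun x hx => ?_
            rw [← ENNReal.ofReal_add (abs_nonneg _) hκ.le]
            refine ENNReal.ofReal_le_ofReal ?_
            linarith [(abs_lt.1 (hcl x hx)).1]
        _ = _ := by rw [lintegral_add_left hwm, setLIntegral_const]
    · calc ∫⁻ x in A, ENNReal.ofReal |⟪e, outwardNormal Ω x⟫_ℝ| ∂μHE[d - 1]
          ≤ ∫⁻ _ in A, (ENNReal.ofReal (c - κ / 2) + ENNReal.ofReal κ) ∂μHE[d - 1] := by
            refine setLIntegral_mono' hAm fun x hx => ?_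
            refine le_trans ?_ ENNReal.ofReal_add_le
            refine ENNReal.ofReal_le_ofReal ?_
            linarith [(abs_lt.1 (hcl x hx)).2]
        _ = ENNReal.ofReal (c - κ / 2) * μHE[d - 1] A + ENNReal.ofReal κ * μHE[d - 1] A := by
            rw [setLIntegral_const, add_mul]
        _ ≤ _ := by gcongr

lemma le_of_forall_le_add_mul {a b c : ℝ≥0∞} (hc : c ≠ ∞)
    (h : ∀ κ : ℝ, 0 < κ → a ≤ b + ENNReal.ofReal κ * c) : a ≤ b := by
  have ht : Tendsto (fun κ : ℝ => b + ENNReal.ofReal κ * c) (𝓝[>] 0) (𝓝 (b + 0 * c)) := by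
    refine tendsto_const_nhds.add (ENNReal.Tendsto.mul_const ?_ (Or.inr hc))
    have := (ENNReal.continuous_ofReal.tendsto 0).mono_left (nhdsWithin_le_nhds (s := Ioi 0))
    simpa using this
  rw [zero_mul, add_zero] at ht
  exact ge_of_tendsto ht (eventually_mem_nhdsWithin.mono fun κ hκ => h κ hκ)

/-- The projection along `e` of a part `A` of the boundary has area at most `∫_A |e · n|`. -/
theorem volume_image_le (hΩ : IsOpen Ω) (hC : HasC1Boundary Ω) (hb : Bornology.IsBounded Ω)
    {e : E d} {J : Hyp d →ₗᵢ[ℝ] E d} {P : E d →L[ℝ] Hyp d} (h : IsHyperplaneProj e J P)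
    {A : Set (E d)} (hA : A ⊆ frontier Ω) (hAm : MeasurableSet A) :
    volume (P '' A) ≤ ∫⁻ x in A, ENNReal.ofReal |⟪e, outwardNormal Ω x⟫_ℝ| ∂μHE[d - 1] := by
  refine le_of_forall_le_add_mul
    ((measure_mono hA).trans_lt (measure_frontier_lt_top hΩ hC hb)).ne fun κ hκ => ?_
  obtain ⟨V, hVm, hVd, hVc, hV⟩ := exists_area_partition hΩ hC h hκ
  have hAV : A = ⋃ i, A ∩ V i := by
    rw [← inter_iUnion, inter_eq_left.2 (hA.trans hVc)]
  have hm : ∀ i, MeasurableSet (A ∩ V i) := fun i => hAm.inter (hVm i)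
  have hd : Pairwise (Function.onFun Disjoint fun i => A ∩ V i) := fun i j hij =>
    (hVd hij).mono inter_subset_right inter_subset_right
  calc volume (P '' A) = volume (⋃ i, P '' (A ∩ V i)) := by rw [← image_iUnion, ← hAV]
    _ ≤ ∑' i, volume (P '' (A ∩ V i)) := measure_iUnion_le _
    _ ≤ ∑' i, (∫⁻ x in A ∩ V i, ENNReal.ofReal |⟪e, outwardNormal Ω x⟫_ℝ| ∂μHE[d - 1] +
            ENNReal.ofReal κ * μHE[d - 1] (A ∩ V i)) :=
        ENNReal.tsum_le_tsum fun i => (hV i _ (fun x hx => ⟨hx.2, hA hx.1⟩) (hm i)).1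
    _ = _ := by
        rw [ENNReal.tsum_add, ENNReal.tsum_mul_left, ← measure_iUnion hd hm,
          ← lintegral_iUnion hm hd, ← hAV]

/-- Conversely, `∫_A |e · n|` is at most the area of the projection of `A` along `e`, if this
projection is injective on `A`. -/
theorem le_volume_image (hΩ : IsOpen Ω) (hC : HasC1Boundary Ω) (hb : Bornology.IsBounded Ω)
    {e : E d} {J : Hyp d →ₗᵢ[ℝ] E d} {P : E d →L[ℝ] Hyp d} (h : IsHyperplaneProj e J P)
    {A : Set (E d)} (hA : A ⊆ frontier Ω) (hAm : MeasurableSet A) (hinj : InjOn P A) :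
    ∫⁻ x in A, ENNReal.ofReal |⟪e, outwardNormal Ω x⟫_ℝ| ∂μHE[d - 1] ≤ volume (P '' A) := by
  refine le_of_forall_le_add_mul
    ((measure_mono hA).trans_lt (measure_frontier_lt_top hΩ hC hb)).ne fun κ hκ => ?_
  obtain ⟨V, hVm, hVd, hVc, hV⟩ := exists_area_partition hΩ hC h hκ
  have hAV : A = ⋃ i, A ∩ V i := by
    rw [← inter_iUnion, inter_eq_left.2 (hA.trans hVc)]
  have hm : ∀ i, MeasurableSet (A ∩ V i) := fun i => hAm.inter (hVm i)
  have hd : Pairwise (Function.onFun Disjoint fun i => A ∩ V i) := fun i j hij =>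
    (hVd hij).mono inter_subset_right inter_subset_right
  have hPm : ∀ i, MeasurableSet (P '' (A ∩ V i)) := fun i =>
    (hm i).image_of_measurable_injOn P.measurable (hinj.mono inter_subset_left)
  have hPd : Pairwise (Function.onFun Disjoint fun i => P '' (A ∩ V i)) := fun i j hij =>
    (hd hij).image hinj inter_subset_left inter_subset_left
  calc ∫⁻ x in A, ENNReal.ofReal |⟪e, outwardNormal Ω x⟫_ℝ| ∂μHE[d - 1]
      = ∑' i, ∫⁻ x in A ∩ V i, ENNReal.ofReal |⟪e, outwardNormal Ω x⟫_ℝ| ∂μHE[d - 1] := by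
        rw [← lintegral_iUnion hm hd, ← hAV]
    _ ≤ ∑' i, (volume (P '' (A ∩ V i)) + ENNReal.ofReal κ * μHE[d - 1] (A ∩ V i)) :=
        ENNReal.tsum_le_tsum fun i => (hV i _ (fun x hx => ⟨hx.2, hA hx.1⟩) (hm i)).2
    _ = _ := by
        rw [ENNReal.tsum_add, ENNReal.tsum_mul_left, ← measure_iUnion hd hm,
          ← measure_iUnion hPd hPm, ← image_iUnion, ← hAV]

end Area

/-! ### Transport along the characteristics -/

section Transport

variable {d : ℕ} {Ω : Set (E d)}

/-- The backward characteristic from `(x, v)` followed until it leaves `Ω`: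
`(x, v) ↦ (x - τ₋(x, v) v, v)`. -/
def backTrace (Ω : Set (E d)) (p : E d × E d) : E d × E d :=
  (p.1 - tauMinus Ω p • p.2, p.2)

lemma tauMinus_nonneg (Ω : Set (E d)) (p : E d × E d) : 0 ≤ tauMinus Ω p :=
  Real.sInf_nonneg fun _ hs => hs.1.le

lemma bddBelow_exit (Ω : Set (E d)) (p : E d × E d) :
    BddBelow {s : ℝ | 0 < s ∧ p.1 - s • p.2 ∉ Ω} := ⟨0, fun _ hs => hs.1.le⟩

lemma mem_of_lt_tauMinus {p : E d × E d} {s : ℝ} (hs : 0 < s) (hst : s < tauMinus Ω p) :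
    p.1 - s • p.2 ∈ Ω := by
  by_contra h
  exact absurd (csInf_le (bddBelow_exit Ω p) ⟨hs, h⟩) (not_le.2 hst)

lemma measurable_tauMinus (hΩ : IsOpen Ω) : Measurable (tauMinus Ω) := by
  set G : ℝ → Set (E d × E d) := fun c => {p | ∀ s, 0 < s → s < c → p.1 - s • p.2 ∈ Ω} with hG
  have hGm : ∀ c, MeasurableSet (G c) := by
    intro c
    have h1 : G c = ⋂ n : ℕ, {p : E d × E d |
        ∀ s ∈ Icc (1 / ((n : ℝ) + 1)) (c - 1 / ((n : ℝ) + 1)), p.1 - s • p.2 ∈ Ω} := by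
      ext p
      simp only [hG, mem_ofPred_eq, mem_iInter]
      constructor
      · intro h n s hs
        have : 0 < 1 / ((n : ℝ) + 1) := by positivity
        exact h s (by linarith [hs.1]) (by linarith [hs.2])
      · intro h s hs hsc
        obtain ⟨n, hn⟩ := exists_nat_one_div_lt (lt_min hs (sub_pos.2 hsc))
        refine h n s ⟨(hn.trans_le (min_le_left _ _)).le, ?_⟩
        linarith [hn.trans_le (min_le_right _ _)]
    rw [h1]
    refine MeasurableSet.iInter fun n => IsOpen.measurableSet ?_
    rw [isOpen_iff_mem_nhds]
    intro p hp
    refine isCompact_Icc.eventually_forall_of_forall_eventually fun s hs => ?_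
    have hcont : Continuous fun z : (E d × E d) × ℝ => z.1.1 - z.2 • z.1.2 := by fun_prop
    exact hcont.continuousAt.eventually (hΩ.mem_nhds (hp s hs))
  refine measurable_of_Ici fun c => ?_
  by_cases hc : c ≤ 0
  · have : tauMinus Ω ⁻¹' Ici c = univ :=
      eq_univ_of_forall fun p => hc.trans (tauMinus_nonneg Ω p)
    rw [this]
    exact MeasurableSet.univ
  · push Not at hc
    -- if the characteristic never leaves `Ω`, then `tauMinus` takes the value `0`
    have : tauMinus Ω ⁻¹' Ici c = G c \ ⋂ n : ℕ, G n := by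
      ext p
      simp only [mem_preimage, mem_Ici, Set.mem_sdiff, mem_iInter, not_forall]
      constructor
      · intro h
        refine ⟨fun s hs hsc => mem_of_lt_tauMinus hs (hsc.trans_le h), ?_⟩
        by_contra hall
        push Not at hall
        have hempty : {s : ℝ | 0 < s ∧ p.1 - s • p.2 ∉ Ω} = ∅ := by
          refine eq_empty_of_forall_notMem fun s hs => ?_
          obtain ⟨n, hn⟩ := exists_nat_gt s
          exact hs.2 (hall n s hs.1 hn)
        rw [tauMinus, hempty, Real.sInf_empty] at h
        linarith
      · rintro ⟨h, n, hn⟩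
        simp only [hG, mem_ofPred_eq, not_forall] at hn
        obtain ⟨s, hs, -, hsΩ⟩ := hn
        refine le_csInf ⟨s, hs, hsΩ⟩ fun t ht => ?_
        by_contra htc
        exact ht.2 (h t ht.1 (not_le.1 htc))
    rw [this]
    exact (hGm c).diff (MeasurableSet.iInter fun n => hGm n)

lemma measurable_backTrace (hΩ : IsOpen Ω) : Measurable (backTrace Ω) :=
  (measurable_fst.sub ((measurable_tauMinus hΩ).smul measurable_snd)).prodMk measurable_snd

lemma exists_exit (hb : Bornology.IsBounded Ω) (x : E d) {v : E d} (hv : v ≠ 0) :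
    {s : ℝ | 0 < s ∧ x - s • v ∉ Ω}.Nonempty := by
  obtain ⟨R, hR⟩ := hb.exists_norm_le
  have hv0 : 0 < ‖v‖ := norm_pos_iff.2 hv
  have hpos : 0 < |R| + ‖x‖ + 1 := by positivity
  refine ⟨(|R| + ‖x‖ + 1) / ‖v‖, by positivity, fun h => ?_⟩
  have h1 := hR _ h
  have h2 : ‖((|R| + ‖x‖ + 1) / ‖v‖) • v‖ = |R| + ‖x‖ + 1 := by
    rw [norm_smul, Real.norm_of_nonneg (by positivity), div_mul_cancel₀ _ hv0.ne']
  have h3 := norm_sub_norm_le (((|R| + ‖x‖ + 1) / ‖v‖) • v) x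
  rw [norm_sub_rev] at h3
  linarith [le_abs_self R]

section Point

variable {x v : E d}

lemma tauMinus_pos (hΩ : IsOpen Ω) (hC : HasC1Boundary Ω) (hb : Bornology.IsBounded Ω)
    (hx : x ∈ frontier Ω) (hv : 0 < ⟪v, outwardNormal Ω x⟫_ℝ) : 0 < tauMinus Ω (x, v) := by
  have hv0 : v ≠ 0 := by
    rintro rfl
    simp at hv
  have h1 := eventually_mem_of_inner_neg hΩ hC hx (w := -v) (by rw [inner_neg_left]; linarith)
  obtain ⟨δ, hδ, h2⟩ := mem_nhdsGT_iff_exists_Ioo_subset.1 h1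
  refine lt_of_lt_of_le (show (0 : ℝ) < δ from hδ) (le_csInf (exists_exit hb x hv0) fun s hs => ?_)
  by_contra hlt
  have h3 : x + s • -v ∈ Ω := h2 ⟨hs.1, not_le.1 hlt⟩
  rw [smul_neg, ← sub_eq_add_neg] at h3
  exact hs.2 h3

lemma backTrace_mem_frontier (hΩ : IsOpen Ω) (hC : HasC1Boundary Ω) (hb : Bornology.IsBounded Ω)
    (hx : x ∈ frontier Ω) (hv : 0 < ⟪v, outwardNormal Ω x⟫_ℝ) :
    x - tauMinus Ω (x, v) • v ∈ frontier Ω := by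
  have hv0 : v ≠ 0 := by
    rintro rfl
    simp at hv
  have hτ := tauMinus_pos hΩ hC hb hx hv
  have hcont : Continuous fun s : ℝ => x - s • v := by fun_prop
  rw [hΩ.frontier_eq]
  constructor
  · have h1 : tauMinus Ω (x, v) ∈ closure (Ioo 0 (tauMinus Ω (x, v))) := by
      rw [closure_Ioo hτ.ne]
      exact ⟨hτ.le, le_rfl⟩
    exact map_mem_closure (f := fun s : ℝ => x - s • v) hcont h1 fun s hs =>
      mem_of_lt_tauMinus hs.1 hs.2
  · have h1 : tauMinus Ω (x, v) ∈ closure {s : ℝ | 0 < s ∧ x - s • v ∉ Ω} :=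
      csInf_mem_closure (exists_exit hb x hv0) (bddBelow_exit Ω (x, v))
    have h2 := map_mem_closure (f := fun s : ℝ => x - s • v) hcont h1 (t := Ωᶜ) fun s hs => hs.2
    rwa [hΩ.isClosed_compl.closure_eq] at h2

lemma inner_backTrace_nonpos (hΩ : IsOpen Ω) (hC : HasC1Boundary Ω)
    (hb : Bornology.IsBounded Ω) (hx : x ∈ frontier Ω) (hv : 0 < ⟪v, outwardNormal Ω x⟫_ℝ) :
    ⟪v, outwardNormal Ω (x - tauMinus Ω (x, v) • v)⟫_ℝ ≤ 0 := by
  by_contra hpos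
  have h1 := eventually_notMem_of_inner_pos hΩ hC (backTrace_mem_frontier hΩ hC hb hx hv)
    (not_le.1 hpos)
  have h2 : ∀ᶠ s : ℝ in 𝓝[>] 0, s < tauMinus Ω (x, v) :=
    nhdsWithin_le_nhds (gt_mem_nhds (tauMinus_pos hΩ hC hb hx hv))
  obtain ⟨s, ⟨hs1, hs2⟩, hs3⟩ := ((h1.and h2).and eventually_mem_nhdsWithin).exists
  have hs3' : (0 : ℝ) < s := hs3
  refine hs1 ?_
  have h3 := mem_of_lt_tauMinus (p := (x, v)) (s := tauMinus Ω (x, v) - s) (by linarith)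
    (by linarith)
  convert h3 using 1
  rw [sub_smul]
  abel

end Point

lemma injOn_backTrace (hΩ : IsOpen Ω) (hC : HasC1Boundary Ω) (hb : Bornology.IsBounded Ω)
    (v : E d) :
    InjOn (fun x => x - tauMinus Ω (x, v) • v)
      {x | x ∈ frontier Ω ∧ 0 < ⟪v, outwardNormal Ω x⟫_ℝ} := by
  have key : ∀ x ∈ frontier Ω, 0 < ⟪v, outwardNormal Ω x⟫_ℝ → ∀ y,
      tauMinus Ω (x, v) < tauMinus Ω (y, v) →
      x - tauMinus Ω (x, v) • v = y - tauMinus Ω (y, v) • v → False := by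
    intro x hx hxv y hlt h
    have hτ := tauMinus_pos hΩ hC hb hx hxv
    have h1 := mem_of_lt_tauMinus (Ω := Ω) (p := (y, v))
      (s := tauMinus Ω (y, v) - tauMinus Ω (x, v))
      (by linarith) (by linarith)
    have h2 : y - (tauMinus Ω (y, v) - tauMinus Ω (x, v)) • v = x := by
      rw [sub_smul, ← sub_add, ← h, sub_add_cancel]
    rw [hΩ.frontier_eq] at hx
    rw [h2] at h1
    exact hx.2 h1
  intro x hx y hy h
  rcases lt_trichotomy (tauMinus Ω (x, v)) (tauMinus Ω (y, v)) with hlt | heq | hlt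
  · exact (key x hx.1 hx.2 y hlt h).elim
  · simpa [heq] using h
  · exact (key y hy.1 hy.2 x hlt h.symm).elim

/-- The projection along `e` is injective on the boundary near a point where `e` is
transversal. -/
lemma exists_nhds_injOn (hΩ : IsOpen Ω) (hC : HasC1Boundary Ω) {e : E d}
    {J : Hyp d →ₗᵢ[ℝ] E d} {P : E d →L[ℝ] Hyp d} (h : IsHyperplaneProj e J P) {x₀ : E d}
    (hx₀ : x₀ ∈ frontier Ω) (he : ⟪e, outwardNormal Ω x₀⟫_ℝ ≠ 0) :
    ∃ U ∈ 𝓝 x₀, InjOn P (U ∩ frontier Ω) := by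
  have hc : 0 < |⟪e, outwardNormal Ω x₀⟫_ℝ| := abs_pos.2 he
  obtain ⟨U, hU, hflat⟩ := eventually_inner_normal_le hΩ hC hx₀ (half_pos hc)
  refine ⟨U, hU, fun x hx y hy hxy => ?_⟩
  have h1 : x - y = ⟪e, x - y⟫_ℝ • e := by
    have := h.apply_eq (x - y)
    rw [map_sub, hxy, sub_self, map_zero] at this
    exact sub_eq_zero.1 this.symm
  have h2 := hflat x hx y hy
  rw [h1, real_inner_smul_right, real_inner_comm e, abs_mul, norm_smul, h.norm_eq, mul_one,
    Real.norm_eq_abs] at h2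
  have h3 : |⟪e, x - y⟫_ℝ| = 0 := by
    by_contra hne
    have : 0 < |⟪e, x - y⟫_ℝ| := lt_of_le_of_ne (abs_nonneg _) (Ne.symm hne)
    nlinarith
  rw [abs_eq_zero.1 h3, zero_smul] at h1
  exact sub_eq_zero.1 h1

/-- For a fixed velocity, the flux `|v · n|` through a part of the outgoing boundary is at most the
flux through its backward trace: both have the same projection along `v`. -/
lemma lintegral_outgoing_le (hΩ : IsOpen Ω) (hC : HasC1Boundary Ω) (hb : Bornology.IsBounded Ω)
    {v : E d} (hv : v ≠ 0) {B : Set (E d)} (hB : MeasurableSet B) :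
    ∫⁻ x in {x | x ∈ frontier Ω ∧ 0 < ⟪v, outwardNormal Ω x⟫_ℝ ∧ x - tauMinus Ω (x, v) • v ∈ B},
        ENNReal.ofReal |⟪v, outwardNormal Ω x⟫_ℝ| ∂μHE[d - 1] ≤
      ∫⁻ x in {x | x ∈ frontier Ω ∧ ⟪v, outwardNormal Ω x⟫_ℝ < 0 ∧ x ∈ B},
        ENNReal.ofReal |⟪v, outwardNormal Ω x⟫_ℝ| ∂μHE[d - 1] := by
  have hv0 : 0 < ‖v‖ := norm_pos_iff.2 hv
  set e : E d := ‖v‖⁻¹ • v with he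
  have he1 : ‖e‖ = 1 := by rw [he, norm_smul, norm_inv, norm_norm, inv_mul_cancel₀ hv0.ne']
  have hve : v = ‖v‖ • e := by rw [he, smul_smul, mul_inv_cancel₀ hv0.ne', one_smul]
  obtain ⟨J, P, h⟩ := exists_isHyperplaneProj he1
  have hPv : P v = 0 := by rw [hve, map_smul, h.apply_self, smul_zero]
  have hnm := measurable_outwardNormal hΩ hC
  have hwe : Measurable fun x => ENNReal.ofReal |⟪e, outwardNormal Ω x⟫_ℝ| := by fun_prop
  have hw : ∀ x, ENNReal.ofReal |⟪v, outwardNormal Ω x⟫_ℝ| =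
      ENNReal.ofReal ‖v‖ * ENNReal.ofReal |⟪e, outwardNormal Ω x⟫_ℝ| := by
    intro x
    rw [← ENNReal.ofReal_mul hv0.le, he, real_inner_smul_left, abs_mul, abs_inv, abs_norm,
      mul_inv_cancel_left₀ hv0.ne']
  set T : E d → E d := fun x => x - tauMinus Ω (x, v) • v with hT
  have hTm : Measurable T := by
    have := (measurable_tauMinus hΩ).comp (measurable_prodMk_right (y := v))
    exact measurable_id.sub (this.smul_const v)
  have hPT : ∀ x, P (T x) = P x := fun x => by
    rw [hT, map_sub, map_smul, hPv, smul_zero, sub_zero]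
  set D := {x | x ∈ frontier Ω ∧ 0 < ⟪v, outwardNormal Ω x⟫_ℝ ∧ T x ∈ B} with hD
  have hDf : D ⊆ frontier Ω := fun x hx => hx.1
  have hinner : Measurable fun x => ⟪v, outwardNormal Ω x⟫_ℝ := by fun_prop
  have hDm : MeasurableSet D := isClosed_frontier.measurableSet.inter
    ((measurableSet_lt measurable_const hinner).inter (hTm hB))
  obtain ⟨V, hVm, hVd, hVc, hV⟩ := exists_measurable_partition (S := D) (p := fun s => InjOn P s)
    (fun s t hst ht => ht.mono hst) (injOn_empty _) (fun x hx => by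
      obtain ⟨U, hU, hinj⟩ := exists_nhds_injOn hΩ hC h hx.1 (by
        intro h0
        have h1 := hx.2.1
        rw [hve, real_inner_smul_left, h0, mul_zero] at h1
        exact lt_irrefl _ h1)
      exact ⟨U, hU, hinj.mono (inter_subset_inter_right _ hDf)⟩)
  have hDV : D = ⋃ i, V i ∩ D := by
    rw [← iUnion_inter, inter_eq_right.2 hVc]
  have hm : ∀ i, MeasurableSet (V i ∩ D) := fun i => (hVm i).inter hDm
  have hd : Pairwise (Function.onFun Disjoint fun i => V i ∩ D) := fun i j hij =>
    (hVd hij).mono inter_subset_left inter_subset_left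
  have hTinj : InjOn T D := (injOn_backTrace hΩ hC hb v).mono
    (show D ⊆ {x | _ ∧ _} from fun x hx => ⟨hx.1, hx.2.1⟩)
  have hTf : ∀ i, T '' (V i ∩ D) ⊆ frontier Ω := by
    rintro i _ ⟨x, hx, rfl⟩
    exact backTrace_mem_frontier hΩ hC hb hx.2.1 hx.2.2.1
  have hTVm : ∀ i, MeasurableSet (T '' (V i ∩ D)) := fun i =>
    (hm i).image_of_measurable_injOn hTm (hTinj.mono inter_subset_right)
  have hTd : Pairwise (Function.onFun Disjoint fun i => T '' (V i ∩ D)) := fun i j hij =>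
    (hd hij).image hTinj inter_subset_right inter_subset_right
  have hmain : ∫⁻ x in D, ENNReal.ofReal |⟪e, outwardNormal Ω x⟫_ℝ| ∂μHE[d - 1] ≤
      ∫⁻ x in T '' D, ENNReal.ofReal |⟪e, outwardNormal Ω x⟫_ℝ| ∂μHE[d - 1] := by
    calc ∫⁻ x in D, ENNReal.ofReal |⟪e, outwardNormal Ω x⟫_ℝ| ∂μHE[d - 1]
        = ∑' i, ∫⁻ x in V i ∩ D, ENNReal.ofReal |⟪e, outwardNormal Ω x⟫_ℝ| ∂μHE[d - 1] := by
          rw [← lintegral_iUnion hm hd, ← hDV]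
      _ ≤ ∑' i, ∫⁻ x in T '' (V i ∩ D),
            ENNReal.ofReal |⟪e, outwardNormal Ω x⟫_ℝ| ∂μHE[d - 1] := by
          refine ENNReal.tsum_le_tsum fun i => ?_
          refine (le_volume_image hΩ hC hb h (inter_subset_right.trans hDf) (hm i) (hV i)).trans ?_
          have hP : P '' (V i ∩ D) = P '' (T '' (V i ∩ D)) := by
            rw [image_image]
            exact image_congr fun x _ => (hPT x).symm
          rw [hP]
          exact volume_image_le hΩ hC hb h (hTf i) (hTVm i)
      _ = _ := by rw [← lintegral_iUnion hTVm hTd, ← image_iUnion, ← hDV]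
  set N := {x | x ∈ frontier Ω ∧ ⟪v, outwardNormal Ω x⟫_ℝ < 0 ∧ x ∈ B} with hN
  have hNm : MeasurableSet N := isClosed_frontier.measurableSet.inter
    ((measurableSet_lt hinner measurable_const).inter hB)
  have hZm : MeasurableSet {x | ⟪v, outwardNormal Ω x⟫_ℝ = 0} :=
    measurableSet_eq_fun hinner measurable_const
  calc ∫⁻ x in D, ENNReal.ofReal |⟪v, outwardNormal Ω x⟫_ℝ| ∂μHE[d - 1]
      ≤ ∫⁻ x in T '' D, ENNReal.ofReal |⟪v, outwardNormal Ω x⟫_ℝ| ∂μHE[d - 1] := by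
        simp only [hw]
        rw [lintegral_const_mul _ hwe, lintegral_const_mul _ hwe]
        gcongr
    _ ≤ ∫⁻ x in N ∪ {x | ⟪v, outwardNormal Ω x⟫_ℝ = 0},
          ENNReal.ofReal |⟪v, outwardNormal Ω x⟫_ℝ| ∂μHE[d - 1] := by
        refine lintegral_mono_set ?_
        rintro _ ⟨x, hx, rfl⟩
        rcases (inner_backTrace_nonpos hΩ hC hb hx.1 hx.2.1).lt_or_eq with hlt | heq
        · exact Or.inl ⟨backTrace_mem_frontier hΩ hC hb hx.1 hx.2.1, hlt, hx.2.2⟩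
        · exact Or.inr heq
    _ ≤ ∫⁻ x in N, ENNReal.ofReal |⟪v, outwardNormal Ω x⟫_ℝ| ∂μHE[d - 1] +
          ∫⁻ x in {x | ⟪v, outwardNormal Ω x⟫_ℝ = 0},
            ENNReal.ofReal |⟪v, outwardNormal Ω x⟫_ℝ| ∂μHE[d - 1] := lintegral_union_le _ _ _
    _ = ∫⁻ x in N, ENNReal.ofReal |⟪v, outwardNormal Ω x⟫_ℝ| ∂μHE[d - 1] := by
        rw [setLIntegral_congr_fun hZm (g := fun _ => 0)
          (fun x (hx : ⟪v, outwardNormal Ω x⟫_ℝ = 0) => by simp [hx])]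
        simp

end Transport

/-! ### The backward trace and the boundary measures -/

section BoundaryMeasures

variable {d : ℕ} {Ω : Set (E d)} {m : Measure (E d)}

lemma measurable_inner_normal (hΩ : IsOpen Ω) (hC : HasC1Boundary Ω) :
    Measurable fun p : E d × E d => ⟪p.2, outwardNormal Ω p.1⟫_ℝ :=
  measurable_snd.inner ((measurable_outwardNormal hΩ hC).comp measurable_fst)

lemma measurableSet_gammaPlus (hΩ : IsOpen Ω) (hC : HasC1Boundary Ω) :
    MeasurableSet (gammaPlus Ω m) :=
  (measurable_fst isClosed_frontier.measurableSet).inter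
    ((measurable_snd m.isClosed_support.measurableSet).inter
      (measurableSet_lt measurable_const (measurable_inner_normal hΩ hC)))

lemma measurableSet_gammaMinus (hΩ : IsOpen Ω) (hC : HasC1Boundary Ω) :
    MeasurableSet (gammaMinus Ω m) :=
  (measurable_fst isClosed_frontier.measurableSet).inter
    ((measurable_snd m.isClosed_support.measurableSet).inter
      (measurableSet_lt (measurable_inner_normal hΩ hC) measurable_const))

lemma isFiniteMeasure_surfaceMeasure (hΩ : IsOpen Ω) (hC : HasC1Boundary Ω)
    (hb : Bornology.IsBounded Ω) : IsFiniteMeasure (surfaceMeasure Ω) :=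
  isFiniteMeasure_restrict.2 (measure_frontier_lt_top hΩ hC hb).ne

lemma sigmaFinite_boundaryMeasure [SigmaFinite m] (hΩ : IsOpen Ω) (hC : HasC1Boundary Ω)
    (hb : Bornology.IsBounded Ω) : SigmaFinite (boundaryMeasure Ω m) := by
  have := isFiniteMeasure_surfaceMeasure hΩ hC hb
  have hm := measurable_inner_normal hΩ hC
  exact SigmaFinite.withDensity_ofReal (μ := (surfaceMeasure Ω).prod m) _

lemma boundaryMeasure_apply [SigmaFinite m] (hΩ : IsOpen Ω) (hC : HasC1Boundary Ω)
    (hb : Bornology.IsBounded Ω) {A : Set (E d × E d)} (hA : MeasurableSet A)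
    (hAf : ∀ p ∈ A, p.1 ∈ frontier Ω) :
    boundaryMeasure Ω m A = ∫⁻ v, ∫⁻ x in {x | (x, v) ∈ A},
      ENNReal.ofReal |⟪v, outwardNormal Ω x⟫_ℝ| ∂μHE[d - 1] ∂m := by
  have := isFiniteMeasure_surfaceMeasure hΩ hC hb
  have hm := measurable_inner_normal hΩ hC
  have hw : Measurable fun p : E d × E d => ENNReal.ofReal |⟪p.2, outwardNormal Ω p.1⟫_ℝ| := by
    fun_prop
  rw [boundaryMeasure, withDensity_apply _ hA, ← lintegral_indicator hA,
    lintegral_prod_symm _ (hw.indicator hA).aemeasurable]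
  refine lintegral_congr fun v => ?_
  have hAv : MeasurableSet {x | (x, v) ∈ A} := measurable_prodMk_right hA
  have h1 : ∀ x, A.indicator (fun p : E d × E d =>
        ENNReal.ofReal |⟪p.2, outwardNormal Ω p.1⟫_ℝ|) (x, v) =
      {x | (x, v) ∈ A}.indicator (fun x => ENNReal.ofReal |⟪v, outwardNormal Ω x⟫_ℝ|) x :=
    fun x => rfl
  simp only [h1]
  rw [lintegral_indicator hAv, surfaceMeasure, Measure.restrict_restrict hAv,
    inter_eq_left.2 (show {x | (x, v) ∈ A} ⊆ frontier Ω from fun x hx => hAf _ hx)]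

/-- The backward trace maps `μ₊` to a measure dominated by `μ₋`. -/
theorem map_backTrace_le [SigmaFinite m] (hΩ : IsOpen Ω) (hC : HasC1Boundary Ω)
    (hb : Bornology.IsBounded Ω) (hm0 : m {0} = 0) :
    (muPlus Ω m).map (backTrace Ω) ≤ muMinus Ω m := by
  have hΨ := measurable_backTrace hΩ
  refine Measure.le_iff.2 fun B hB => ?_
  rw [Measure.map_apply hΨ hB, muPlus, muMinus, Measure.restrict_apply (hΨ hB),
    Measure.restrict_apply hB,
    boundaryMeasure_apply hΩ hC hb ((hΨ hB).inter (measurableSet_gammaPlus hΩ hC))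
      fun p hp => hp.2.1,
    boundaryMeasure_apply hΩ hC hb (hB.inter (measurableSet_gammaMinus hΩ hC)) fun p hp => hp.2.1]
  have hv : ∀ᵐ v ∂m, v ≠ 0 := by
    rw [ae_iff]
    simpa using hm0
  refine lintegral_mono_ae ?_
  filter_upwards [hv] with v hv0
  by_cases hvs : v ∈ m.support
  · have key := lintegral_outgoing_le hΩ hC hb hv0 (B := {x | (x, v) ∈ B})
      (measurable_prodMk_right hB)
    refine (lintegral_mono_set fun x hx => ?_).trans (key.trans (lintegral_mono_set fun x hx => ?_))
    · exact ⟨hx.2.1, hx.2.2.2, hx.1⟩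
    · exact ⟨hx.2.2, hx.1, hvs, hx.2.1⟩
  · have : {x | (x, v) ∈ backTrace Ω ⁻¹' B ∩ gammaPlus Ω m} = ∅ :=
      eq_empty_of_forall_notMem fun x hx => hvs hx.2.2.1
    rw [this]
    simp

end BoundaryMeasures

/-! ### The transfer operators -/

section Transfer

variable {d : ℕ} {Ω : Set (E d)} {m : Measure (E d)}

/-- The formula for `M_l` defines a bounded operator: the factor `exp (-l τ₋)` has modulus at most
one, and composition with the backward trace is a contraction from `L¹₋` to `L¹₊`. -/
theorem exists_isTransfer (hΩ : IsOpen Ω)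
    (hmap : (muPlus Ω m).map (backTrace Ω) ≤ muMinus Ω m) {l : ℂ} (hl : 0 ≤ l.re) :
    ∃ T : L1Minus Ω m →L[ℂ] L1Plus Ω m, IsTransfer Ω m l T ∧ ∀ u, ‖T u‖ ≤ ‖u‖ := by
  have hΨ := measurable_backTrace hΩ
  have hq : Measure.QuasiMeasurePreserving (backTrace Ω) (muPlus Ω m) (muMinus Ω m) :=
    ⟨hΨ, Measure.absolutelyContinuous_of_le hmap⟩
  set c : E d × E d → ℂ := fun p => Complex.exp (-l * (tauMinus Ω p : ℂ)) with hc
  have hcm : Measurable c := by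
    have := measurable_tauMinus hΩ
    fun_prop
  have hc1 : ∀ p, ‖c p‖ ≤ 1 := by
    intro p
    rw [hc, Complex.norm_exp, Real.exp_le_one_iff]
    simp only [neg_mul, Complex.neg_re, Complex.mul_re, Complex.ofReal_re, Complex.ofReal_im,
      mul_zero, sub_zero, Left.neg_nonpos_iff]
    exact mul_nonneg hl (tauMinus_nonneg Ω p)
  have hcomp : ∀ u : L1Minus Ω m, Integrable (fun p => u (backTrace Ω p)) (muPlus Ω m) := fun u =>
    ((L1.integrable_coeFn u).mono_measure hmap).comp_measurable hΨ
  have hint : ∀ u : L1Minus Ω m, Integrable (fun p => c p * u (backTrace Ω p)) (muPlus Ω m) :=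
    fun u => (hcomp u).bdd_mul hcm.aestronglyMeasurable (Eventually.of_forall hc1)
  have hcoe : ∀ u, ⇑((hint u).toL1 _) =ᵐ[muPlus Ω m] fun p => c p * u (backTrace Ω p) :=
    fun u => Integrable.coeFn_toL1 _
  let T₀ : L1Minus Ω m →ₗ[ℂ] L1Plus Ω m :=
    { toFun := fun u => (hint u).toL1 _
      map_add' := fun u w => by
        refine Lp.ext ?_
        filter_upwards [hcoe u, hcoe w, hcoe (u + w), hq.ae (Lp.coeFn_add u w),
          Lp.coeFn_add ((hint u).toL1 _) ((hint w).toL1 _)] with p h1 h2 h3 h4 h5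
        rw [h3, h4, h5, Pi.add_apply, Pi.add_apply, h1, h2, mul_add]
      map_smul' := fun a u => by
        refine Lp.ext ?_
        filter_upwards [hcoe u, hcoe (a • u), hq.ae (Lp.coeFn_smul a u),
          Lp.coeFn_smul a ((hint u).toL1 _)] with p h1 h2 h3 h4
        rw [h2, h3, RingHom.id_apply, h4, Pi.smul_apply, Pi.smul_apply, h1, smul_eq_mul,
          smul_eq_mul, mul_left_comm] }
  have hnorm : ∀ u, ‖T₀ u‖ ≤ 1 * ‖u‖ := by
    intro u
    rw [one_mul, L1.norm_eq_integral_norm, L1.norm_eq_integral_norm]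
    calc ∫ p, ‖(T₀ u) p‖ ∂(muPlus Ω m) ≤ ∫ p, ‖u (backTrace Ω p)‖ ∂(muPlus Ω m) := by
          refine integral_mono_ae (L1.integrable_coeFn _).norm (hcomp u).norm ?_
          filter_upwards [hcoe u] with p hp
          have : T₀ u p = c p * u (backTrace Ω p) := hp
          rw [this, norm_mul]
          exact mul_le_of_le_one_left (norm_nonneg _) (hc1 p)
      _ = ∫ q, ‖u q‖ ∂((muPlus Ω m).map (backTrace Ω)) :=
          (integral_map hΨ.aemeasurable
            ((L1.integrable_coeFn u).mono_measure hmap).aestronglyMeasurable.norm).symm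
      _ ≤ ∫ q, ‖u q‖ ∂(muMinus Ω m) :=
          integral_mono_measure hmap (Eventually.of_forall fun q => norm_nonneg _)
            (L1.integrable_coeFn u).norm
  exact ⟨T₀.mkContinuous 1 hnorm, fun u => hcoe u, fun u => by simpa using hnorm u⟩

lemma ae_tauMinus_pos (hΩ : PhaseSpace Ω m) : ∀ᵐ p ∂(muPlus Ω m), 0 < tauMinus Ω p := by
  filter_upwards [ae_restrict_mem (measurableSet_gammaPlus hΩ.isOpen hΩ.c1Boundary)] with p hp
  exact tauMinus_pos hΩ.isOpen hΩ.c1Boundary hΩ.isBounded hp.1 hp.2.2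

variable [SigmaFinite m]

lemma PhaseSpace.map_backTrace_le (hΩ : PhaseSpace Ω m) :
    (muPlus Ω m).map (backTrace Ω) ≤ muMinus Ω m :=
  DiffuseTransport.map_backTrace_le hΩ.isOpen hΩ.c1Boundary hΩ.isBounded hΩ.measure_zero

theorem isTransfer_transfer (hΩ : PhaseSpace Ω m) {l : ℂ} (hl : 0 ≤ l.re) :
    IsTransfer Ω m l (transfer Ω m l) := by
  obtain ⟨T, hT, -⟩ := exists_isTransfer hΩ.isOpen hΩ.map_backTrace_le hl
  rwa [transfer_eq hT]

lemma norm_transfer_apply_le (hΩ : PhaseSpace Ω m) {l : ℂ} (hl : 0 ≤ l.re) (u : L1Minus Ω m) :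
    ‖transfer Ω m l u‖ ≤ ‖u‖ := by
  obtain ⟨T, hT, hn⟩ := exists_isTransfer hΩ.isOpen hΩ.map_backTrace_le hl
  rw [transfer_eq hT]
  exact hn u

lemma isPositiveOp_transfer_zero (hΩ : PhaseSpace Ω m) : IsPositiveOp (transfer Ω m 0) := by
  intro u hu
  have hq : Measure.QuasiMeasurePreserving (backTrace Ω) (muPlus Ω m) (muMinus Ω m) :=
    ⟨measurable_backTrace hΩ.isOpen, Measure.absolutelyContinuous_of_le hΩ.map_backTrace_le⟩
  filter_upwards [isTransfer_transfer hΩ (l := 0) le_rfl u, hq.ae hu] with p h1 h2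
  rw [h1, neg_zero, zero_mul, Complex.exp_zero, one_mul]
  exact h2

/-- The multiplication by `exp (-l τ₋)` relates `M_l H` to `M_0 H`. -/
lemma MH_apply_ae (hΩ : PhaseSpace Ω m) (H : L1Plus Ω m →L[ℂ] L1Minus Ω m) {l : ℂ}
    (hl : 0 ≤ l.re) (f : L1Plus Ω m) : ∀ᵐ p ∂(muPlus Ω m),
      MH Ω m H l f p = Complex.exp (-l * (tauMinus Ω p : ℂ)) * MH Ω m H 0 f p := by
  filter_upwards [isTransfer_transfer hΩ hl (H f),
    isTransfer_transfer hΩ (l := 0) le_rfl (H f)] with p h1 h2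
  have h3 : MH Ω m H 0 f p = H f (p.1 - tauMinus Ω p • p.2, p.2) :=
    h2.trans (by simp)
  rw [h3]
  exact h1

lemma norm_MH_zero_le (hΩ : PhaseSpace Ω m) {H : L1Plus Ω m →L[ℂ] L1Minus Ω m}
    (hH : IsStochastic H) {f : L1Plus Ω m} (hf : Nonneg f) : ‖MH Ω m H 0 f‖ ≤ ‖f‖ := by
  refine (norm_transfer_apply_le hΩ (l := 0) le_rfl (H f)).trans (le_of_eq ?_)
  rw [(hH.1 f hf).norm_eq_integral, hf.norm_eq_integral]
  have h1 := congrArg Complex.re (hH.2 f)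
  have h2 := integral_re (L1.integrable_coeFn (H f))
  have h3 := integral_re (L1.integrable_coeFn f)
  exact (h2.trans h1).trans h3.symm

theorem spectralRadius_MH_lt_one (hΩ : PhaseSpace Ω m) {H : L1Plus Ω m →L[ℂ] L1Minus Ω m}
    (hH : BoundaryOperator Ω m H) {l : ℂ} (hl0 : l ≠ 0) (hl : 0 ≤ l.re) :
    spectralRadius ℂ (MH Ω m H l) < 1 := by
  have : SigmaFinite (boundaryMeasure Ω m) :=
    sigmaFinite_boundaryMeasure hΩ.isOpen hΩ.c1Boundary hΩ.isBounded
  have : SigmaFinite (muPlus Ω m) := by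
    unfold muPlus
    infer_instance
  refine spectralRadius_lt_one (P := MH Ω m H 0) (B := MH Ω m H) (τ := tauMinus Ω)
    (K := WeakSpace.map (transfer Ω m 0) '' closure ((fun f =>
      toWeakSpace ℂ _ (H.comp (MH Ω m H 0) f)) '' Metric.closedBall 0 1))
    ((isPositiveOp_transfer_zero hΩ).comp hH.stochastic.1)
    (fun f hf => norm_MH_zero_le hΩ hH.stochastic hf) hH.irreducible
    (hH.weaklyCompact.image (WeakSpace.map (transfer Ω m 0)).continuous) (fun f hf => ?_)
    (ae_tauMinus_pos hΩ) (fun l hl f => MH_apply_ae hΩ H hl f) ?_ hl0 hl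
  · exact ⟨_, subset_closure ⟨f, by simpa using hf, rfl⟩, rfl⟩
  · obtain ⟨ℓ, hℓ⟩ := hH.power_tendsto
    exact ⟨ℓ, by simpa using hℓ 0 le_rfl⟩

end Transfer

end DiffuseTransport

end

theorem proposition3p6 {d : ℕ} (Ω : Set (DiffuseTransport.E d))
    (m : MeasureTheory.Measure (DiffuseTransport.E d)) [MeasureTheory.SigmaFinite m]
    (hΩ : DiffuseTransport.PhaseSpace Ω m)
    (H : DiffuseTransport.L1Plus Ω m →L[ℂ] DiffuseTransport.L1Minus Ω m)
    (hH : DiffuseTransport.BoundaryOperator Ω m H) :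
    -- the operators `M_l` are well defined by their formula
    (∀ l : ℂ, 0 ≤ l.re → DiffuseTransport.IsTransfer Ω m l (DiffuseTransport.transfer Ω m l)) ∧
    (∀ l : ℂ, l ≠ 0 → 0 ≤ l.re → spectralRadius ℂ (DiffuseTransport.MH Ω m H l) < 1) ∧
    (∀ η : ℝ, η ≠ 0 →
      spectralRadius ℂ (DiffuseTransport.MH Ω m H ((η : ℂ) * Complex.I)) < 1) := by
  refine ⟨fun l hl => DiffuseTransport.isTransfer_transfer hΩ hl,
    fun l hl0 hl => DiffuseTransport.spectralRadius_MH_lt_one hΩ hH hl0 hl,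
    fun η hη => DiffuseTransport.spectralRadius_MH_lt_one hΩ hH ?_ ?_⟩
  · exact mul_ne_zero (Complex.ofReal_ne_zero.2 hη) Complex.I_ne_zero
  · simp
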